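/- A CNF formula $F$ is a finite set of clauses, a clause being a finite set of literals without a complementary pair; $\mathrm{var}(c)$ and $\mathrm{var}(F)$ are the sets of variables occurring in $c$ and in $F$. For a finite set $B$ of variables and $\tau: B\to\{0,1\}$, the formula $F[\tau]$ is obtained from $F$ by removing all clauses with a literal set to $1$ by $\tau$ and deleting the literals set to $0$ from the remaining clauses. With respect to a linear order $<$ of the variables, a clause $c$ straddles a clause $c'$ if there are $x,y\in\mathrm{var}(c)$ and $z\in\mathrm{var}(c')$ with $x<z<y$. $F$ is nested if there is a linear order of $\mathrm{var}(F)$ for which no two distinct clauses of $F$ straddle each other. $B$ is a strong Nested-backdoor set of $F$ if $F[\tau]$ is nested for every $\tau: B\to\{0,1\}$. The incidence graph $\mathrm{inc}(F)$ is the bipartite graph on $\mathrm{var}(F)\cup F$ in which a variable $x$ and a clause $c$ are adjacent iff $x\in\mathrm{var}(c)$. The $r$-grid is the graph on $\{1,\dots,r\}^2$ in which $(i,j)$ and $(i',j')$ are adjacent iff $|i-i'|+|j-j'|=1$. A model of a graph $H$ as a minor of a graph $G$ is a family of pairwise disjoint non-empty connected vertex sets $C_u$ of $G$, one for each vertex $u$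 of $H$, such that $G$ has an edge between $C_u$ and $C_v$ whenever $uv$ is an edge of $H$. Put $\mathrm{same}(k)=15\cdot 2^{2k+2}$, $\mathrm{obs}(k)=2^k\,\mathrm{same}(k)+k$ and $\mathrm{grid}(k)=\left\lceil 4\sqrt{\mathrm{obs}(k)+1}\,\right\rceil$. Lemma. There are a single deterministic algorithm (a program for a uniform-cost random access machine with addition and subtraction), a computable function $f$ and constants $d, A$ such that the following holds. Given a positive integer $k$, a CNF formula $F$, and a model of the $\mathrm{grid}(k)$-grid as a minor of $\mathrm{inc}(F)$, the algorithm halts after at most $f(k)\cdot n^{d}$ steps, where $n$ is the length of the input (that is, it is an FPT algorithm with parameter $k$), and outputs a set $S^*\subseteq \mathrm{var}(F)$ with $|S^*|\le 2^{A k^{10}}$ such that every strong Nested-backdoor set of $F$ of size at most $k$ contains a variable of $S^*$. -/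

import Mathlib

namespace NestedSat

/-! ## CNF formulas -/

/-- A literal: a variable (named by a natural number) with a sign, `true` for the positive literal
`x` and `false` for the negative literal `¬x`. -/
abbrev Literal := ℕ × Bool

/-- A clause is a finite set of literals. -/
abbrev Clause := Finset Literal

/-- A formula in conjunctive normal form is a finite set of clauses. -/
abbrev CNF := Finset Clause

/-- The variables that occur in a clause. -/
def Clause.vars (c : Clause) : Finset ℕ := c.image Prod.fst

/-- The variables that occur in a formula. -/
def CNF.vars (F : CNF) : Finset ℕ := F.biUnion Clause.vars

/-- No clause contains a complementary pair of literals. -/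
def CNF.Proper (F : CNF) : Prop :=
  ∀ c ∈ F, ∀ x : ℕ, ¬((x, true) ∈ c ∧ (x, false) ∈ c)

/-- The reduced formula `F[τ]` for the truth assignment `τ` restricted to `X`: clauses with a
literal set to true by `τ` are removed, and the literals set to false are removed from the other
clauses. The values of `τ` outside `X` are not used. -/
def CNF.reduce (F : CNF) (X : Finset ℕ) (τ : ℕ → Bool) : CNF :=
  (F.filter fun c => ∀ l ∈ c, l.1 ∈ X → τ l.1 ≠ l.2).image
    fun c => c.filter fun l => l.1 ∉ X

/-! ## Nested formulas and strong backdoor sets -/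

/-- The clause `c` straddles the clause `c'` with respect to the order `lt` of the variables. -/
def Straddles (lt : ℕ → ℕ → Prop) (c c' : Clause) : Prop :=
  ∃ x ∈ c.vars, ∃ y ∈ c.vars, ∃ z ∈ c'.vars, lt x z ∧ lt z y

/-- Two clauses overlap if they straddle each other. -/
def Overlap (lt : ℕ → ℕ → Prop) (c c' : Clause) : Prop :=
  Straddles lt c c' ∧ Straddles lt c' c

/-- A formula is nested if, for some (strict) linear order of the variables, no two distinct
clauses overlap. Only the restriction of the order to the variables of `F` matters, and every
linear order of those extends to all variable names. -/
def CNF.Nested (F : CNF) : Prop :=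
  ∃ lt : ℕ → ℕ → Prop, IsStrictTotalOrder ℕ lt ∧
    ∀ c ∈ F, ∀ c' ∈ F, c ≠ c' → ¬ Overlap lt c c'

/-- `B` is a strong backdoor set of `F` with respect to the class of nested formulas. -/
def IsStrongNestedBackdoor (F : CNF) (B : Finset ℕ) : Prop :=
  ∀ τ : ℕ → Bool, (F.reduce B τ).Nested

/-! ## Incidence graph and grid minors -/

/-- The vertices of the incidence graph: the variables and the clauses of `F`. -/
abbrev IncVertex (F : CNF) := {x : ℕ // x ∈ F.vars} ⊕ {c : Clause // c ∈ F}

/-- The incidence graph of `F`. -/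
def inc (F : CNF) : SimpleGraph (IncVertex F) where
  Adj
    | Sum.inl x, Sum.inr c => x.1 ∈ c.1.vars
    | Sum.inr c, Sum.inl x => x.1 ∈ c.1.vars
    | _, _ => False
  symm := ⟨by rintro (x | c) (y | d) h <;> exact h⟩
  loopless := ⟨by rintro (x | c) h <;> exact h⟩

/-- The `r`-grid. -/
def gridGraph (r : ℕ) : SimpleGraph (Fin r × Fin r) where
  Adj p q := |((p.1 : ℕ) : ℤ) - ((q.1 : ℕ) : ℤ)| + |((p.2 : ℕ) : ℤ) - ((q.2 : ℕ) : ℤ)| = 1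
  symm := ⟨fun p q h => by rw [abs_sub_comm, abs_sub_comm ((q.2 : ℕ) : ℤ)]; exact h⟩
  loopless := ⟨fun p h => by simp at h⟩

/-- A model of `H` as a minor of `G`: pairwise disjoint connected vertex sets of `G`, one for each
vertex of `H`, with an edge of `G` between the sets of any two adjacent vertices of `H`.
(`SimpleGraph.Connected` includes that the vertex set is non-empty.) -/
structure IsMinorModel {W V : Type*} (H : SimpleGraph W) (G : SimpleGraph V)
    (C : W → Finset V) : Prop where
  connected : ∀ u, (G.induce (C u : Set V)).Connected
  disjoint : ∀ u v, u ≠ v → Disjoint (C u) (C v)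
  edge : ∀ u v, H.Adj u v → ∃ a ∈ C u, ∃ b ∈ C v, G.Adj a b

/-- The parameter `same(k) = 15 * 2^(2k+2)`. -/
def same (k : ℕ) : ℕ := 15 * 2 ^ (2 * k + 2)

/-- The parameter `obs(k) = 2^k * same(k) + k`. -/
def obs (k : ℕ) : ℕ := 2 ^ k * same k + k

/-- The grid size `4 * √(obs(k) + 1)`, rounded up to an integer. -/
noncomputable def gridSize (k : ℕ) : ℕ := ⌈4 * Real.sqrt ((obs k : ℝ) + 1)⌉₊

/-! ## The machine model

Random access machines with uniform cost: finitely many registers, an unbounded memory of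
natural numbers with indirect addressing, addition and truncated subtraction (no multiplication),
and structured control flow. -/

/-- Arithmetic expressions over the registers and the memory. -/
inductive Expr where
  | const (n : ℕ)
  | reg (i : ℕ)
  | mem (a : Expr)
  | add (a b : Expr)
  | sub (a b : Expr)

/-- The contents of the registers and of the memory. -/
structure MachineState where
  reg : ℕ → ℕ
  mem : ℕ → ℕ

/-- The value of an expression. Subtraction is truncated at `0`. -/
def Expr.eval (s : MachineState) : Expr → ℕ
  | .const n => n
  | .reg i => s.reg i
  | .mem a => s.mem (a.eval s)
  | .add a b => a.eval s + b.eval s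
  | .sub a b => a.eval s - b.eval s

/-- The number of operations that the evaluation of an expression takes. -/
def Expr.cost : Expr → ℕ
  | .const _ => 1
  | .reg _ => 1
  | .mem a => a.cost + 1
  | .add a b => a.cost + b.cost + 1
  | .sub a b => a.cost + b.cost + 1

/-- Programs. A condition counts as true if its value is not `0`. -/
inductive Prog where
  | skip
  | assign (i : ℕ) (e : Expr)
  | store (a e : Expr)
  | seq (p q : Prog)
  | ite (e : Expr) (p q : Prog)
  | loop (e : Expr) (p : Prog)

/-- `Runs p s t s'`: the program `p`, started in the state `s`, halts after `t` steps in the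
state `s'`. -/
inductive Runs : Prog → MachineState → ℕ → MachineState → Prop where
  | skip (s : MachineState) : Runs .skip s 1 s
  | assign (i : ℕ) (e : Expr) (s : MachineState) :
      Runs (.assign i e) s (e.cost + 1) ⟨Function.update s.reg i (e.eval s), s.mem⟩
  | store (a e : Expr) (s : MachineState) :
      Runs (.store a e) s (a.cost + e.cost + 1)
        ⟨s.reg, Function.update s.mem (a.eval s) (e.eval s)⟩
  | seq {p q : Prog} {s s' s'' : MachineState} {t t' : ℕ} :
      Runs p s t s' → Runs q s' t' s'' → Runs (.seq p q) s (t + t') s''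
  | ite_true {e : Expr} {p q : Prog} {s s' : MachineState} {t : ℕ} :
      e.eval s ≠ 0 → Runs p s t s' → Runs (.ite e p q) s (e.cost + 1 + t) s'
  | ite_false {e : Expr} {p q : Prog} {s s' : MachineState} {t : ℕ} :
      e.eval s = 0 → Runs q s t s' → Runs (.ite e p q) s (e.cost + 1 + t) s'
  | loop_stop {e : Expr} {p : Prog} {s : MachineState} :
      e.eval s = 0 → Runs (.loop e p) s (e.cost + 1) s
  | loop_step {e : Expr} {p : Prog} {s s' s'' : MachineState} {t t' : ℕ} :
      e.eval s ≠ 0 → Runs p s t s' → Runs (.loop e p) s' t' s'' →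
        Runs (.loop e p) s (e.cost + 1 + t + t') s''

/-- The initial state on the input word `w`: the word stands in the memory cells
`0, 1, …, w.length - 1`, and everything else is `0`. -/
def initialState (w : List ℕ) : MachineState := ⟨fun _ => 0, fun i => w.getD i 0⟩

/-- The output, a finite set of naturals: cell `0` holds the number of entries, and the entries
are in the cells that follow. -/
def outputSet (s : MachineState) : Finset ℕ :=
  (Finset.range (s.mem 0)).image fun i => s.mem (i + 1)

/-- The size of an input word: the total number of binary digits, and one more for each entry. -/
def wordSize (w : List ℕ) : ℕ := (w.map fun a => Nat.size a + 1).sum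

/-! ## Encoding of the input -/

/-- The length of a list, followed by the codes of its entries. -/
def encodeList {α : Type} (enc : α → List ℕ) (l : List α) : List ℕ :=
  l.length :: l.flatMap enc

/-- A literal is written as its variable, then `1` if it is positive and `0` if negative. -/
def encodeLiteral (l : Literal) : List ℕ := [l.1, if l.2 then 1 else 0]

/-- A vertex of the incidence graph is written as `0, x` if it is the variable `x`, and as `1, j`
if it is the clause at position `j` (from `0`) in the list of clauses. -/
def encodeVertex : ℕ ⊕ ℕ → List ℕ
  | .inl x => [0, x]
  | .inr j => [1, j]

/-- `cs` is a list of the clauses of `F`, each as a list of its literals, without repetitions. -/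
def ListsFormula (cs : List (List Literal)) (F : CNF) : Prop :=
  (∀ l ∈ cs, l.Nodup) ∧ (cs.map List.toFinset).Nodup ∧ (cs.map List.toFinset).toFinset = F

/-- The name of a vertex of the incidence graph: a variable stands for itself, a clause is named
by its position in the list of clauses. -/
def vertexName (cs : List (List Literal)) {F : CNF} : IncVertex F → ℕ ⊕ ℕ
  | .inl x => .inl x.1
  | .inr c => .inr ((cs.map List.toFinset).idxOf c.1)

/-- `bag` is a list of the names of the vertices in `A`, without repetitions. -/
def ListsVertices (cs : List (List Literal)) {F : CNF} (bag : List (ℕ ⊕ ℕ))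
    (A : Finset (IncVertex F)) : Prop :=
  bag.Nodup ∧ bag.toFinset = A.image (vertexName cs)

/-- The word `w` is an encoding of the parameter `k`, the formula `F` and the family `C` of vertex
sets of its incidence graph indexed by the vertices of the `r`-grid (listed row by row). -/
def EncodesInput (w : List ℕ) (k : ℕ) (F : CNF) (r : ℕ)
    (C : Fin r × Fin r → Finset (IncVertex F)) : Prop :=
  ∃ (cs : List (List Literal)) (bag : Fin r × Fin r → List (ℕ ⊕ ℕ)),
    ListsFormula cs F ∧ (∀ p, ListsVertices cs (bag p) (C p)) ∧
    w = k :: (encodeList (encodeList encodeLiteral) cs ++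
      encodeList (encodeList encodeVertex)
        (((List.finRange r).product (List.finRange r)).map bag))

end NestedSat

open NestedSat

/-!
# A small set of variables that meets all small strong backdoor sets

Let `q = 8 * k * 4 ^ k` (`quota`). The grid has at least `49 * k ^ 2 * 4 ^ k` disjoint `4 × 4`
blocks (`le_card_blocks`). The incidence graph of a nested formula has no `4 × 3` grid as a minor
(`GridBlock.exists_cross`): connected sets of vertices can be contracted to clauses without creating
a crossing (`not_cross_of_joined_of_joined`), and in such a grid the first and the last row,
together with parts of the columns, would become two clauses with three common variables. So every
strong backdoor set `B` with at most `k` elements has a variable in a clause of each block, and one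
of its variables is in clauses of a `k`-th part of the blocks (`Forest.exists_touches_many`). If
fewer than `q` variables are as frequent as this, they are the output.

Otherwise, let `Q` be a set of `q` of them. Suppose that `B` avoids `Q`. The blocks are divided into
smaller connected pieces, each with three variables of `Q` in its clauses: going up a spanning
forest of the blocks, a piece is cut off as soon as it has collected three variables of `Q`
(`Refinement`). Disjoint connected pieces whose clauses avoid `B` behave like clauses of a nested
formula, and all but `2 * q` of them contain at most two variables of `Q` (`card_pieces_le`). So `B`
touches all but `2 * q` of the new pieces (`Refinement.le_card_touchedBy`), and some variable of `B`
touches a `k`-th part of those. This leads to a new selection of frequent variables, and the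
argument is repeated with the new pieces. A round ends the algorithm either if fewer than `q`
variables are frequent, or if the number of pieces does not grow; so the number of rounds is at most
the number of vertices. The output consists of the variables selected in the last two rounds.

It remains to see that the number of pieces grows if `B` avoids `Q`. The variables in `Q` are
frequent, so that there are many incidences of `Q` with pieces. In the first round, the number of
blocks is so large that a count of these incidences suffices (`Refinement.lt_of_first`). Later, a
vertex has at most three children in its piece, since it needs only one child for each of the three
variables that it collects (`Refinement.card_children_le`). Then all but few incidences of `Q` with
old pieces come from clauses at which a new piece has been cut off. But `m` clauses have at most
`4 ^ k * q + 2 * m` incidences with `Q`, as they are distributed over `4 ^ k` nested formulas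
according to their literals over `B` (`IsStrongNestedBackdoor.sum_card_inter_le`). A comparison shows that the
number of new pieces exceeds the number of old ones (`Refinement.lt_of_later`).

The algorithm is written as an `ArrProg`, in a language with arrays and loops of a fixed number of
iterations, and compiled to the random access machine (`ArrProg.runs_compile`, `exists_prog`). All
loops run `N` times, where `N` is the length of the input plus `q`. This bounds the running time by
a polynomial in `N`, so that only the effect of the array programs has to be analysed
(`run_algorithm`).
-/

namespace NestedSat

/-! ### A language of array programs -/

/-- Data that an array program may read but not change: the input word, the common number `size`
of iterations of every loop, and one further parameter `quota`. -/
structure ArrEnv where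
  word : List ℕ
  size : ℕ
  quota : ℕ

/-- The names of the arrays and scalars of the algorithm. -/
inductive Arr where
  -- positions, lengths and loop variables
  | pos | len | row | col | slot | pass | edge | vert | label | round
  -- the incidences of the formula, as pairs of a clause number and a variable
  | numEdges | edgeClause | edgeVar
  -- the blocks of the grid: for each vertex code, the name of its block
  | numBags | side | square | rowRem | colRem | rowBase | bagNum | blockName | block
  -- a spanning forest of the blocks, and the division of its vertices into pieces
  | fst | snd | seeded | order | parent | piece | index | numVerts
  -- the selection of candidates
  | lastSeen | count | chosen | numChosen | choice | threshold
  -- the refinement of the pieces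
  | open1 | open2 | open3 | host | cand | changed | link | closed | numClosed | prevPieces
  | done | prevChoice | numPrev | out | numOut
  deriving DecidableEq

/-- All names of arrays. -/
def Arr.all : List Arr :=
  [.pos, .len, .row, .col, .slot, .pass, .edge, .vert, .label, .round, .numEdges, .edgeClause,
    .edgeVar, .numBags, .side, .square, .rowRem, .colRem, .rowBase, .bagNum, .blockName, .block,
    .fst, .snd, .seeded, .order, .parent, .piece, .index, .numVerts, .lastSeen, .count, .chosen,
    .numChosen, .choice, .threshold, .open1, .open2, .open3, .host, .cand, .changed, .link,
    .closed, .numClosed, .prevPieces, .done, .prevChoice, .numPrev, .out, .numOut]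

theorem Arr.mem_all (a : Arr) : a ∈ Arr.all := by
  cases a <;> simp [Arr.all]

/-- The number of an array. -/
def Arr.num (a : Arr) : ℕ := Arr.all.idxOf a

theorem Arr.num_lt (a : Arr) : a.num < 64 :=
  (List.idxOf_lt_length_of_mem a.mem_all).trans (by decide)

theorem Arr.num_inj {a b : Arr} (h : a.num = b.num) : a = b :=
  (List.idxOf_inj a.mem_all).1 h

/-- The state of an array program: the value `σ a i` of the entry `i` of the array `a`. Scalars are
kept in the entry `0` of an array. -/
abbrev ArrState := Arr → ℕ → ℕ

/-- The state `σ` with entry `i` of array `a` replaced by `v`. -/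
def ArrState.upd (σ : ArrState) (a : Arr) (i v : ℕ) : ArrState :=
  Function.update σ a (Function.update (σ a) i v)

/-- The entry of the input word at a position, and `0` beyond its end. -/
def ArrEnv.read (E : ArrEnv) (i : ℕ) : ℕ := E.word.getD i 0

/-- Expressions of array programs. -/
inductive ArrExpr where
  | const (n : ℕ)
  | size
  | quota
  | inp (e : ArrExpr)
  | arr (a : Arr) (e : ArrExpr)
  | add (e₁ e₂ : ArrExpr)
  | sub (e₁ e₂ : ArrExpr)

/-- The value of an expression of an array program. -/
@[simp]
def ArrExpr.val (E : ArrEnv) (σ : ArrState) : ArrExpr → ℕ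
  | .const n => n
  | .size => E.size
  | .quota => E.quota
  | .inp e => E.read (e.val E σ)
  | .arr a e => σ a (e.val E σ)
  | .add e₁ e₂ => e₁.val E σ + e₂.val E σ
  | .sub e₁ e₂ => e₁.val E σ - e₂.val E σ

/-- Array programs. The loop `rep a c` runs `c` exactly `size` times, with the number of the
iteration (from `0`) in the scalar `a` before each iteration; so every array program halts, after
a number of steps polynomial in `size`. -/
inductive ArrProg where
  | skip
  | store (a : Arr) (i e : ArrExpr)
  | seq (c₁ c₂ : ArrProg)
  | ite (e : ArrExpr) (c₁ c₂ : ArrProg)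
  | rep (a : Arr) (c : ArrProg)

/-- The effect of an array program. -/
def ArrProg.run (E : ArrEnv) : ArrProg → ArrState → ArrState
  | .skip, σ => σ
  | .store a i e, σ => σ.upd a (i.val E σ) (e.val E σ)
  | .seq c₁ c₂, σ => c₂.run E (c₁.run E σ)
  | .ite e c₁ c₂, σ => if e.val E σ ≠ 0 then c₁.run E σ else c₂.run E σ
  | .rep a c, σ => Nat.rec σ (fun t ρ => c.run E (ρ.upd a 0 t)) E.size

/-- The arrays that a program may change. -/
def ArrProg.mods : ArrProg → List Arr
  | .skip => []
  | .store a _ _ => [a]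
  | .seq c₁ c₂ => c₁.mods ++ c₂.mods
  | .ite _ c₁ c₂ => c₁.mods ++ c₂.mods
  | .rep a c => a :: c.mods

theorem ArrState.upd_of_ne (σ : ArrState) {a b : Arr} (h : b ≠ a) (i v : ℕ) : σ.upd a i v b = σ b := by
  simp [ArrState.upd, h]

@[simp]
theorem ArrState.upd_apply (σ : ArrState) (a : Arr) (i v : ℕ) (b : Arr) (j : ℕ) :
    σ.upd a i v b j = if b = a ∧ j = i then v else σ b j := by
  unfold ArrState.upd
  by_cases h : b = a
  · subst h; simp [Function.update_apply]
  · simp [h]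

/-- Invariant rule for loops. -/
theorem ArrProg.rep_induction {E : ArrEnv} {a : Arr} {c : ArrProg} {σ : ArrState}
    (I : ℕ → ArrState → Prop) (h0 : I 0 σ)
    (hs : ∀ t < E.size, ∀ ρ, I t ρ → I (t + 1) (c.run E (ρ.upd a 0 t))) :
    I E.size ((ArrProg.rep a c).run E σ) := by
  have : ∀ n ≤ E.size, I n (Nat.rec σ (fun t ρ => c.run E (ρ.upd a 0 t)) n) := by
    intro n
    induction n with
    | zero => intro _; exact h0
    | succ n ih => intro hn; exact hs n (by omega) _ (ih (by omega))
  exact this _ le_rfl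

theorem ArrProg.run_frame {E : ArrEnv} (c : ArrProg) (σ : ArrState) {b : Arr} (hb : b ∉ c.mods) :
    c.run E σ b = σ b := by
  induction c generalizing σ with
  | skip => rfl
  | store a i e =>
    simp only [ArrProg.mods, List.mem_singleton] at hb
    simp only [ArrProg.run]; exact ArrState.upd_of_ne _ hb _ _
  | seq c₁ c₂ h₁ h₂ =>
    simp only [ArrProg.mods, List.mem_append, not_or] at hb
    simp only [ArrProg.run]; rw [h₂ _ hb.2, h₁ _ hb.1]
  | ite e c₁ c₂ h₁ h₂ =>
    simp only [ArrProg.mods, List.mem_append, not_or] at hb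
    simp only [ArrProg.run]; split_ifs
    · exact h₁ _ hb.1
    · exact h₂ _ hb.2
  | rep a c h =>
    simp only [ArrProg.mods, List.mem_cons, not_or] at hb
    refine ArrProg.rep_induction (fun _ ρ => ρ b = σ b) rfl ?_
    intro t _ ρ hρ
    rw [h _ hb.2, ArrState.upd_of_ne _ hb.1, hρ]

/-- Invariant rule for loops, with the information that the loop does not change other arrays. -/
theorem ArrProg.rep_induction_frame {E : ArrEnv} {a : Arr} {c : ArrProg} {σ : ArrState}
    (I : ℕ → ArrState → Prop) (h0 : I 0 σ)
    (hs : ∀ t < E.size, ∀ ρ, (∀ b, b ∉ (ArrProg.rep a c).mods → ρ b = σ b) → I t ρ →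
      I (t + 1) (c.run E (ρ.upd a 0 t))) :
    I E.size ((ArrProg.rep a c).run E σ) := by
  refine (ArrProg.rep_induction
    (fun t ρ => (∀ b, b ∉ (ArrProg.rep a c).mods → ρ b = σ b) ∧ I t ρ) ⟨fun _ _ => rfl, h0⟩ ?_).2
  rintro t ht ρ ⟨h1, h2⟩
  refine ⟨fun b hb => ?_, hs t ht ρ h1 h2⟩
  have hb' := hb
  simp only [ArrProg.mods, List.mem_cons, not_or] at hb'
  rw [ArrProg.run_frame c _ hb'.2, ArrState.upd_of_ne _ hb'.1, h1 b hb]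

/-! ### Compilation of array programs -/

/-- `64 * e`, by six doublings. -/
def Expr.shift (e : Expr) : Expr :=
  let d : Expr → Expr := fun x => .add x x
  d (d (d (d (d (d e)))))

theorem Expr.eval_shift (s : MachineState) (e : Expr) : e.shift.eval s = 64 * e.eval s := by
  simp only [Expr.shift, Expr.eval]; ring

/-- The address of entry `i` of array `a`; register `0` holds the first address of the arrays. -/
def Expr.cell (a : Arr) (i : Expr) : Expr := .add (.add (.reg 0) i.shift) (.const a.num)

/-- Translation of expressions. The cell below the arrays is `0`, and it stands for all positions
beyond the end of the input. -/
def ArrExpr.compile : ArrExpr → Expr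
  | .const n => .const n
  | .size => .reg 1
  | .quota => .reg 2
  | .inp e => .mem (.sub e.compile (.sub e.compile (.sub (.reg 0) (.const 1))))
  | .arr a e => .mem (Expr.cell a e.compile)
  | .add e₁ e₂ => .add e₁.compile e₂.compile
  | .sub e₁ e₂ => .sub e₁.compile e₂.compile

/-- Translation of programs. A loop at nesting depth `h` counts down in the register `3 + h`. -/
def ArrProg.compile : ℕ → ArrProg → Prog
  | _, .skip => .skip
  | _, .store a i e => .store (Expr.cell a i.compile) e.compile
  | h, .seq c₁ c₂ => .seq (c₁.compile h) (c₂.compile h)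
  | h, .ite e c₁ c₂ => .ite e.compile (c₁.compile h) (c₂.compile h)
  | h, .rep a c => .seq (.assign (3 + h) (.reg 1)) (.loop (.reg (3 + h))
      (.seq (.store (Expr.cell a (.const 0)) (.sub (.reg 1) (.reg (3 + h))))
        (.seq (c.compile (h + 1)) (.assign (3 + h) (.sub (.reg (3 + h)) (.const 1))))))

/-- The machine state `s` represents the state `σ` of an array program, with the arrays above the
address `D`. -/
structure Represents (E : ArrEnv) (D : ℕ) (σ : ArrState) (s : MachineState) : Prop where
  base : s.reg 0 = D
  size : s.reg 1 = E.size
  quota : s.reg 2 = E.quota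
  low : ∀ i < D, s.mem i = E.word.getD i 0
  cell : ∀ (a : Arr) i, s.mem (D + 64 * i + a.num) = σ a i

theorem ArrExpr.eval_compile {E : ArrEnv} {D : ℕ} {σ : ArrState} {s : MachineState}
    (hD : E.word.length < D) (hs : Represents E D σ s) (e : ArrExpr) :
    e.compile.eval s = e.val E σ := by
  induction e with
  | const n => rfl
  | size => exact hs.size
  | quota => exact hs.quota
  | inp e ih =>
    simp only [ArrExpr.compile, Expr.eval, ArrExpr.val, ih, hs.base, ArrEnv.read]
    rw [hs.low _ (by omega)]
    by_cases h : e.val E σ < D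
    · congr 1; omega
    · rw [List.getD_eq_default, List.getD_eq_default] <;> omega
  | arr a e ih =>
    simp only [ArrExpr.compile, Expr.cell, Expr.eval, Expr.eval_shift, ArrExpr.val, ih, hs.base]
    exact hs.cell a _
  | add e₁ e₂ h₁ h₂ => simp only [ArrExpr.compile, Expr.eval, ArrExpr.val, h₁, h₂]
  | sub e₁ e₂ h₁ h₂ => simp only [ArrExpr.compile, Expr.eval, ArrExpr.val, h₁, h₂]

theorem Represents.store {E : ArrEnv} {D : ℕ} {σ : ArrState} {s : MachineState}
    (hs : Represents E D σ s) {a : Arr} {i v : ℕ} :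
    Represents E D (σ.upd a i v) ⟨s.reg, Function.update s.mem (D + 64 * i + a.num) v⟩ where
  base := hs.base
  size := hs.size
  quota := hs.quota
  low j hj := by
    simp only [Function.update_apply]
    rw [if_neg (by omega)]; exact hs.low j hj
  cell b j := by
    simp only [Function.update_apply, ArrState.upd_apply]
    have ha := a.num_lt
    have hb := b.num_lt
    by_cases h : b = a ∧ j = i
    · rw [if_pos h, if_pos (by rw [h.1, h.2])]
    · rw [if_neg h, if_neg]
      · exact hs.cell b j
      · intro h'
        exact h ⟨Arr.num_inj (by omega), by omega⟩

theorem Represents.assign {E : ArrEnv} {D : ℕ} {σ : ArrState} {s : MachineState}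
    (hs : Represents E D σ s) {r v : ℕ} (hr : 3 ≤ r) :
    Represents E D σ ⟨Function.update s.reg r v, s.mem⟩ where
  base := by simp only [Function.update_apply]; rw [if_neg (by omega)]; exact hs.base
  size := by simp only [Function.update_apply]; rw [if_neg (by omega)]; exact hs.size
  quota := by simp only [Function.update_apply]; rw [if_neg (by omega)]; exact hs.quota
  low := hs.low
  cell := hs.cell

/-- A bound for the number of steps of the translated program, in terms of `size`. -/
def ArrProg.time : ArrProg → ℕ → ℕ
  | .skip, _ => 1
  | .store a i e, _ => (Expr.cell a i.compile).cost + e.compile.cost + 1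
  | .seq c₁ c₂, N => c₁.time N + c₂.time N
  | .ite e c₁ c₂, N => e.compile.cost + 1 + (c₁.time N + c₂.time N)
  | .rep a c, N => 4 + N * (c.time N + ((Expr.cell a (.const 0)).cost + 20))

theorem ArrProg.runs_compile {E : ArrEnv} {D : ℕ} (hD : E.word.length < D) (c : ArrProg)
    (h : ℕ) (σ : ArrState) (s : MachineState) (hs : Represents E D σ s) :
    ∃ t s', Runs (c.compile h) s t s' ∧ t ≤ c.time E.size ∧ Represents E D (c.run E σ) s' ∧
      ∀ r < 3 + h, s'.reg r = s.reg r := by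
  induction c generalizing h σ s with
  | skip => exact ⟨1, s, .skip s, le_rfl, hs, fun _ _ => rfl⟩
  | store a i e =>
    refine ⟨_, _, .store _ _ s, le_rfl, ?_, fun _ _ => rfl⟩
    have h1 : (Expr.cell a i.compile).eval s = D + 64 * i.val E σ + a.num := by
      simp only [Expr.cell, Expr.eval, Expr.eval_shift, ArrExpr.eval_compile hD hs i, hs.base]
    rw [h1, ArrExpr.eval_compile hD hs e]
    exact hs.store
  | seq c₁ c₂ h₁ h₂ =>
    obtain ⟨t₁, s₁, r₁, b₁, q₁, g₁⟩ := h₁ h σ s hs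
    obtain ⟨t₂, s₂, r₂, b₂, q₂, g₂⟩ := h₂ h _ s₁ q₁
    exact ⟨_, s₂, .seq r₁ r₂, add_le_add b₁ b₂, q₂, fun r hr => (g₂ r hr).trans (g₁ r hr)⟩
  | ite e c₁ c₂ h₁ h₂ =>
    have he := ArrExpr.eval_compile hD hs e
    by_cases hv : e.val E σ = 0
    · obtain ⟨t₂, s₂, r₂, b₂, q₂, g₂⟩ := h₂ h σ s hs
      refine ⟨_, s₂, .ite_false (he.trans hv) r₂, ?_, ?_, g₂⟩
      · simp only [ArrProg.time]; omega
      · simp only [ArrProg.run, hv]; exact q₂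
    · obtain ⟨t₁, s₁, r₁, b₁, q₁, g₁⟩ := h₁ h σ s hs
      refine ⟨_, s₁, .ite_true (by rw [he]; exact hv) r₁, ?_, ?_, g₁⟩
      · simp only [ArrProg.time]; omega
      · simp only [ArrProg.run, ne_eq, hv, not_false_eq_true, if_true]; exact q₁
  | rep a c ih =>
    have key : ∀ m n, m + n = E.size → ∀ s : MachineState, s.reg (3 + h) = m →
        Represents E D (Nat.rec σ (fun t ρ => c.run E (ρ.upd a 0 t)) n) s →
        ∃ t s', Runs (.loop (.reg (3 + h))
          (.seq (.store (Expr.cell a (.const 0)) (.sub (.reg 1) (.reg (3 + h))))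
            (.seq (c.compile (h + 1)) (.assign (3 + h) (.sub (.reg (3 + h)) (.const 1)))))) s t s' ∧
          t ≤ 2 + m * (c.time E.size + ((Expr.cell a (.const 0)).cost + 20)) ∧
          Represents E D (Nat.rec σ (fun t ρ => c.run E (ρ.upd a 0 t)) E.size) s' ∧
          ∀ r < 3 + h, s'.reg r = s.reg r := by
      intro m
      induction m with
      | zero =>
        intro n hn s hr hs
        have hn' : n = E.size := by omega
        subst hn'
        refine ⟨_, s, Runs.loop_stop (by simpa [Expr.eval] using hr), ?_, hs, fun _ _ => rfl⟩
        simp [Expr.cost]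
      | succ m ihm =>
        intro n hn s hr hs
        have hs1 := hs.store (a := a) (i := 0) (v := n)
        have e1 : (Expr.cell a (.const 0)).eval s = D + 64 * 0 + a.num := by
          simp only [Expr.cell, Expr.eval, Expr.eval_shift, hs.base]
        have e2 : (Expr.sub (.reg 1) (.reg (3 + h))).eval s = n := by
          simp only [Expr.eval, hs.size, hr]; omega
        obtain ⟨t₂, s₂, r₂, b₂, q₂, g₂⟩ := ih (h + 1) _ _ hs1
        have q3 := q₂.assign (r := 3 + h) (v := m) (by omega)
        obtain ⟨t₄, s₄, r₄, b₄, q₄, g₄⟩ := ihm (n + 1) (by omega)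
          ⟨Function.update s₂.reg (3 + h) m, s₂.mem⟩ (by simp) q3
        have ra := Runs.store (Expr.cell a (.const 0)) (.sub (.reg 1) (.reg (3 + h))) s
        rw [e1, e2] at ra
        have rb := Runs.assign (3 + h) (.sub (.reg (3 + h)) (.const 1)) s₂
        have e3 : (Expr.sub (.reg (3 + h)) (.const 1)).eval s₂ = m := by
          simp only [Expr.eval]
          rw [g₂ (3 + h) (by omega)]
          show s.reg (3 + h) - 1 = m
          omega
        rw [e3] at rb
        refine ⟨_, s₄, .loop_step (by simp only [Expr.eval]; omega) (.seq ra (.seq r₂ rb)) r₄,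
          ?_, q₄, ?_⟩
        · simp only [Expr.cost]
          rw [Nat.add_mul]
          omega
        · intro r hr'
          rw [g₄ r hr']
          simp only [Function.update_apply]
          rw [if_neg (by omega), g₂ r (by omega)]
    have h1 := hs.assign (r := 3 + h) (v := E.size) (by omega)
    obtain ⟨t, s', r, b, q, g⟩ := key E.size 0 (by omega) _ (by simp) h1
    have ra := Runs.assign (3 + h) (.reg 1) s
    have e1 : (Expr.reg 1).eval s = E.size := hs.size
    rw [e1] at ra
    refine ⟨_, s', .seq ra r, ?_, q, ?_⟩
    · simp only [ArrProg.time, Expr.cost]; omega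
    · intro r hr
      rw [g r hr]
      simp only [Function.update_apply]
      rw [if_neg (by omega)]

theorem ArrProg.time_le (c : ArrProg) : ∃ A d, ∀ N, c.time N ≤ A * (N + 1) ^ d := by
  induction c with
  | skip => exact ⟨1, 0, fun N => by simp [ArrProg.time]⟩
  | store a i e => exact ⟨_, 0, fun N => by simp only [ArrProg.time, pow_zero, mul_one]; exact le_rfl⟩
  | seq c₁ c₂ h₁ h₂ =>
    obtain ⟨A, d, hA⟩ := h₁
    obtain ⟨B, e, hB⟩ := h₂
    refine ⟨A + B, d + e, fun N => ?_⟩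
    have h1 : (N + 1) ^ d ≤ (N + 1) ^ (d + e) := Nat.pow_le_pow_right (by omega) (by omega)
    have h2 : (N + 1) ^ e ≤ (N + 1) ^ (d + e) := Nat.pow_le_pow_right (by omega) (by omega)
    calc c₁.time N + c₂.time N ≤ A * (N + 1) ^ d + B * (N + 1) ^ e := add_le_add (hA N) (hB N)
      _ ≤ A * (N + 1) ^ (d + e) + B * (N + 1) ^ (d + e) := by gcongr
      _ = _ := by ring
  | ite x c₁ c₂ h₁ h₂ =>
    obtain ⟨A, d, hA⟩ := h₁
    obtain ⟨B, e, hB⟩ := h₂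
    refine ⟨x.compile.cost + 1 + (A + B), d + e, fun N => ?_⟩
    have h1 : (N + 1) ^ d ≤ (N + 1) ^ (d + e) := Nat.pow_le_pow_right (by omega) (by omega)
    have h2 : (N + 1) ^ e ≤ (N + 1) ^ (d + e) := Nat.pow_le_pow_right (by omega) (by omega)
    have h3 : 1 ≤ (N + 1) ^ (d + e) := Nat.one_le_pow _ _ (by omega)
    calc x.compile.cost + 1 + (c₁.time N + c₂.time N)
        ≤ (x.compile.cost + 1) * 1 + (A * (N + 1) ^ d + B * (N + 1) ^ e) := by
          rw [mul_one]; exact Nat.add_le_add_left (add_le_add (hA N) (hB N)) _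
      _ ≤ (x.compile.cost + 1) * (N + 1) ^ (d + e) +
          (A * (N + 1) ^ (d + e) + B * (N + 1) ^ (d + e)) := by gcongr
      _ = _ := by ring
  | rep a c h =>
    obtain ⟨A, d, hA⟩ := h
    set K := (Expr.cell a (.const 0)).cost + 20 with hK
    refine ⟨4 + (A + K), d + 1, fun N => ?_⟩
    have h3 : 1 ≤ (N + 1) ^ (d + 1) := Nat.one_le_pow _ _ (by omega)
    have h4 : 1 ≤ (N + 1) ^ d := Nat.one_le_pow _ _ (by omega)
    calc 4 + N * (c.time N + K) ≤ 4 * 1 + (N + 1) * (A * (N + 1) ^ d + K * 1) := by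
          rw [mul_one, mul_one]
          exact Nat.add_le_add_left (Nat.mul_le_mul (by omega) (Nat.add_le_add_right (hA N) _)) _
      _ ≤ 4 * (N + 1) ^ (d + 1) + (N + 1) * (A * (N + 1) ^ d + K * (N + 1) ^ d) := by gcongr
      _ = _ := by ring

/-! ### From array programs to machine programs -/

/-- The bound for the number of candidates that are selected in a round. -/
def quota (k : ℕ) : ℕ := 8 * k * 4 ^ k

theorem runs_assign {i : ℕ} {e : Expr} {s : MachineState} {v : ℕ} (h : e.eval s = v) :
    Runs (.assign i e) s (e.cost + 1) ⟨Function.update s.reg i v, s.mem⟩ :=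
  h ▸ Runs.assign i e s

/-- A list that is headed by half the number of its remaining entries. -/
def Headed (l : List ℕ) : Prop := ∃ m t, l = m :: t ∧ t.length = 2 * m

/-- With the number of lists in register `3`, and the position of the first of them in register
`4`, moves register `4` behind the last of these lists. -/
def skipLists : Prog :=
  .loop (.reg 3) (.seq
    (.assign 4 (.add (.add (.reg 4) (.add (.mem (.reg 4)) (.mem (.reg 4)))) (.const 1)))
    (.assign 3 (.sub (.reg 3) (.const 1))))

theorem runs_skipLists (L : List (List ℕ)) (hL : ∀ l ∈ L, Headed l) (rest : List ℕ)
    (s : MachineState) (h3 : s.reg 3 = L.length)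
    (hm : ∀ i, s.mem (s.reg 4 + i) = (L.flatten ++ rest).getD i 0) :
    ∃ t s', Runs skipLists s t s' ∧ t ≤ 2 + 20 * L.length ∧ s'.mem = s.mem ∧
      s'.reg 4 = s.reg 4 + L.flatten.length := by
  induction L generalizing s with
  | nil =>
    exact ⟨_, s, Runs.loop_stop (by simpa [Expr.eval] using h3), by simp [Expr.cost], rfl, by simp⟩
  | cons l L ih =>
    obtain ⟨m, u, rfl, hu⟩ := hL l (by simp)
    have hm0 : s.mem (s.reg 4) = m := by simpa using hm 0
    have ra := Runs.assign 4
      (.add (.add (.reg 4) (.add (.mem (.reg 4)) (.mem (.reg 4)))) (.const 1)) s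
    set s1 : MachineState := ⟨Function.update s.reg 4 (s.reg 4 + (m + m) + 1), s.mem⟩ with hs1
    have e1 : (Expr.add (.add (.reg 4) (.add (.mem (.reg 4)) (.mem (.reg 4)))) (.const 1)).eval s
        = s.reg 4 + (m + m) + 1 := by simp [Expr.eval, hm0]
    rw [e1] at ra
    have rb := Runs.assign 3 (.sub (.reg 3) (.const 1)) s1
    set s2 : MachineState := ⟨Function.update s1.reg 3 L.length, s.mem⟩ with hs2
    have e2 : (Expr.sub (.reg 3) (.const 1)).eval s1 = L.length := by
      simp [Expr.eval, hs1, h3]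
    rw [e2] at rb
    obtain ⟨t, s', r, ht, q1, q2⟩ := ih (fun l hl => hL l (by simp [hl])) s2 (by simp [hs2]) (by
      intro i
      have := hm (m + m + 1 + i)
      have e4 : s2.reg 4 = s.reg 4 + (m + m) + 1 := by simp [hs2, hs1]
      rw [e4, show s.reg 4 + (m + m) + 1 + i = s.reg 4 + (m + m + 1 + i) by omega]
      rw [show s2.mem = s.mem from rfl, this]
      rw [List.flatten_cons, List.append_assoc, List.getD_append_right _ _ _ _ (by simp; omega)]
      congr 1
      simp; omega)
    refine ⟨_, s', .loop_step (by simp [Expr.eval, h3]) (.seq ra rb) r, ?_, q1, ?_⟩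
    · simp only [Expr.cost, List.length_cons]; omega
    · rw [q2]
      simp [hs2, hs1]; omega

/-- Computes the length of the input word into register `4`. -/
def measureInput : Prog :=
  .seq (.assign 3 (.mem (.const 1))) (.seq (.assign 4 (.const 2)) (.seq skipLists
    (.seq (.assign 3 (.mem (.reg 4))) (.seq (.assign 4 (.add (.reg 4) (.const 1))) skipLists))))

/-- The words on which `measureInput` finds the length: the parameter and two lists of lists. -/
def WellShaped (k : ℕ) (w : List ℕ) : Prop :=
  ∃ L L' : List (List ℕ), (∀ l ∈ L, Headed l) ∧ (∀ l ∈ L', Headed l) ∧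
    w = k :: ((L.length :: L.flatten) ++ (L'.length :: L'.flatten))

theorem length_le_flatten (L : List (List ℕ)) (hL : ∀ l ∈ L, Headed l) :
    L.length ≤ L.flatten.length := by
  induction L with
  | nil => simp
  | cons l L ih =>
    obtain ⟨m, u, rfl, hu⟩ := hL l (by simp)
    have := ih (fun l hl => hL l (by simp [hl]))
    simp only [List.length_cons, List.flatten_cons, List.length_append]; omega

theorem runs_measureInput {k : ℕ} {w : List ℕ} (hw : WellShaped k w) :
    ∃ t s, Runs measureInput (initialState w) t s ∧ t ≤ 20 + 20 * w.length ∧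
      s.mem = (initialState w).mem ∧ s.reg 4 = w.length := by
  obtain ⟨L, L', hL, hL', rfl⟩ := hw
  set w := k :: ((L.length :: L.flatten) ++ (L'.length :: L'.flatten)) with hw
  set m := (initialState w).mem with hm
  have hmw : ∀ i, m i = w.getD i 0 := fun i => rfl
  have r1 := Runs.assign 3 (.mem (.const 1)) (initialState w)
  have r2 := Runs.assign 4 (.const 2)
    ⟨Function.update (initialState w).reg 3 ((Expr.mem (.const 1)).eval (initialState w)), m⟩
  set s2 : MachineState := ⟨Function.update (Function.update (initialState w).reg 3
    ((Expr.mem (.const 1)).eval (initialState w))) 4 2, m⟩ with hs2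
  have e1 : (Expr.mem (.const 1)).eval (initialState w) = L.length := by
    simp only [Expr.eval]; rw [← hm, hmw, hw]; simp
  obtain ⟨t3, s3, r3, b3, m3, p3⟩ := runs_skipLists L hL (L'.length :: L'.flatten) s2
    (by simp [hs2, e1]) (by
      intro i
      have : s2.reg 4 = 2 := by simp [hs2]
      rw [this]
      show m (2 + i) = _
      rw [hmw, hw, add_comm 2 i]
      rfl)
  have p3' : s3.reg 4 = 2 + L.flatten.length := by rw [p3]; simp [hs2]
  have m3' : s3.mem = m := m3
  have r4 := Runs.assign 3 (.mem (.reg 4)) s3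
  have e4 : (Expr.mem (.reg 4)).eval s3 = L'.length := by
    simp only [Expr.eval]; rw [m3', hmw, p3', hw, add_comm 2]
    show (L.flatten ++ _).getD _ _ = _
    rw [List.getD_append_right _ _ _ _ le_rfl]
    simp
  rw [e4] at r4
  have r5 := Runs.assign 4 (.add (.reg 4) (.const 1))
    ⟨Function.update s3.reg 3 L'.length, s3.mem⟩
  have e5 : (Expr.add (.reg 4) (.const 1)).eval ⟨Function.update s3.reg 3 L'.length, s3.mem⟩ =
      3 + L.flatten.length := by
    simp [Expr.eval, p3']; omega
  rw [e5] at r5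
  obtain ⟨t6, s6, r6, b6, m6, p6⟩ := runs_skipLists L' hL' []
    ⟨Function.update (Function.update s3.reg 3 L'.length) 4 (3 + L.flatten.length), s3.mem⟩
    (by simp) (by
      intro i
      show s3.mem _ = _
      rw [m3', hmw, hw]
      simp only [Function.update_self]
      rw [show 3 + L.flatten.length + i = (L.flatten.length + (i + 1)) + 1 + 1 by omega]
      show (L.flatten ++ _).getD _ _ = _
      rw [List.getD_append_right _ _ _ _ (by omega)]
      simp)
  refine ⟨_, s6, .seq r1 (.seq r2 (.seq r3 (.seq r4 (.seq r5 r6)))), ?_, by rw [m6]; exact m3', ?_⟩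
  · have := length_le_flatten L hL
    have := length_le_flatten L' hL'
    have : w.length = 3 + L.flatten.length + L'.flatten.length := by simp [hw]; omega
    simp only [Expr.cost]; omega
  · rw [p6, hw]; simp; omega

/-- Computes the quota into register `2` and sets up the registers `0` and `1`. -/
def setup : Prog :=
  .seq (.assign 3 (.mem (.const 0))) (.seq
    (.assign 2 (.add (.add (.add (.reg 3) (.reg 3)) (.add (.reg 3) (.reg 3)))
      (.add (.add (.reg 3) (.reg 3)) (.add (.reg 3) (.reg 3)))))
    (.seq (.loop (.reg 3) (.seq
        (.assign 2 (.add (.add (.reg 2) (.reg 2)) (.add (.reg 2) (.reg 2))))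
        (.assign 3 (.sub (.reg 3) (.const 1)))))
      (.seq (.assign 1 (.add (.reg 4) (.reg 2)))
        (.assign 0 (.add (.add (.reg 1) (.reg 2)) (.const 1))))))

theorem runs_quadruple (m : ℕ) (s : MachineState) (h3 : s.reg 3 = m) :
    ∃ t s', Runs (.loop (.reg 3) (.seq
        (.assign 2 (.add (.add (.reg 2) (.reg 2)) (.add (.reg 2) (.reg 2))))
        (.assign 3 (.sub (.reg 3) (.const 1))))) s t s' ∧ t ≤ 2 + 20 * m ∧ s'.mem = s.mem ∧
      s'.reg 2 = s.reg 2 * 4 ^ m ∧ s'.reg 4 = s.reg 4 := by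
  induction m generalizing s with
  | zero =>
    exact ⟨_, s, Runs.loop_stop (by simpa [Expr.eval] using h3), by simp [Expr.cost], rfl, by simp, rfl⟩
  | succ m ih =>
    have ra := runs_assign (i := 2) (e := .add (.add (.reg 2) (.reg 2)) (.add (.reg 2) (.reg 2)))
      (s := s) (v := 4 * s.reg 2) (by simp only [Expr.eval]; ring)
    have rb := runs_assign (i := 3) (e := .sub (.reg 3) (.const 1)) (v := m)
      (s := ⟨Function.update s.reg 2 (4 * s.reg 2), s.mem⟩) (by simp [Expr.eval, h3])
    obtain ⟨t, s', r, ht, q1, q2, q3⟩ :=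
      ih ⟨Function.update (Function.update s.reg 2 (4 * s.reg 2)) 3 m, s.mem⟩ (by simp)
    refine ⟨_, s', .loop_step (by simp [Expr.eval, h3]) (.seq ra rb) r, ?_, q1, ?_, ?_⟩
    · simp only [Expr.cost]; omega
    · rw [q2]
      simp
      ring
    · rw [q3]; simp

theorem runs_setup {w : List ℕ} (s : MachineState) (hm : s.mem = (initialState w).mem)
    (h4 : s.reg 4 = w.length) :
    ∃ t s', Runs setup s t s' ∧ t ≤ 50 + 20 * w.getD 0 0 ∧ s'.mem = s.mem ∧
      s'.reg 2 = quota (w.getD 0 0) ∧ s'.reg 1 = w.length + quota (w.getD 0 0) ∧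
      s'.reg 0 = w.length + 2 * quota (w.getD 0 0) + 1 := by
  set k := w.getD 0 0 with hk
  have r1 := Runs.assign 3 (.mem (.const 0)) s
  have e1 : (Expr.mem (.const 0)).eval s = k := by simp only [Expr.eval]; rw [hm]; rfl
  rw [e1] at r1
  have r2 := runs_assign (i := 2) (v := 8 * k)
      (e := .add (.add (.add (.reg 3) (.reg 3)) (.add (.reg 3) (.reg 3)))
        (.add (.add (.reg 3) (.reg 3)) (.add (.reg 3) (.reg 3))))
      (s := ⟨Function.update s.reg 3 k, s.mem⟩) (by simp [Expr.eval]; ring)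
  obtain ⟨t3, s3, r3, b3, m3, p3, p4⟩ := runs_quadruple k
    ⟨Function.update (Function.update s.reg 3 k) 2 (8 * k), s.mem⟩ (by simp)
  have q2 : s3.reg 2 = quota k := by
    rw [p3]; simp [quota]
  have q4 : s3.reg 4 = w.length := by rw [p4]; simp [h4]
  have r4 := Runs.assign 1 (.add (.reg 4) (.reg 2)) s3
  have e4 : (Expr.add (.reg 4) (.reg 2)).eval s3 = w.length + quota k := by
    simp only [Expr.eval, q2, q4]
  rw [e4] at r4
  have r5 := Runs.assign 0 (.add (.add (.reg 1) (.reg 2)) (.const 1))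
    ⟨Function.update s3.reg 1 (w.length + quota k), s3.mem⟩
  refine ⟨_, _, .seq r1 (.seq r2 (.seq r3 (.seq r4 r5))), ?_, ?_, ?_, ?_, ?_⟩
  · simp only [Expr.cost]; omega
  · exact m3
  · simp [q2]
  · simp
  · simp [Expr.eval, q2]; omega

/-- Writes the output: `cnt 0` entries, from the array `out`. -/
def writeOutput (out cnt : Arr) : Prog :=
  .seq (.assign 3 (.mem (Expr.cell cnt (.const 0)))) (.seq (.store (.const 0) (.reg 3))
    (.seq (.assign 4 (.const 0))
      (.loop (.sub (.reg 3) (.reg 4)) (.seq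
        (.store (.add (.reg 4) (.const 1)) (.mem (Expr.cell out (.reg 4))))
        (.assign 4 (.add (.reg 4) (.const 1)))))))

theorem runs_copyOutput {D n : ℕ} {out : Arr} (f : ℕ → ℕ) (hn : n < D) (m j : ℕ) (hj : m + j = n)
    (s : MachineState) (h0 : s.reg 0 = D) (h3 : s.reg 3 = n) (h4 : s.reg 4 = j)
    (hf : ∀ i, s.mem (D + 64 * i + out.num) = f i) (hc : s.mem 0 = n)
    (hd : ∀ i < j, s.mem (i + 1) = f i) :
    ∃ t s', Runs (.loop (.sub (.reg 3) (.reg 4)) (.seq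
        (.store (.add (.reg 4) (.const 1)) (.mem (Expr.cell out (.reg 4))))
        (.assign 4 (.add (.reg 4) (.const 1))))) s t s' ∧
      t ≤ 4 + m * ((Expr.cell out (.reg 4)).cost + 20) ∧ s'.mem 0 = n ∧
      ∀ i < n, s'.mem (i + 1) = f i := by
  induction m generalizing j s with
  | zero =>
    refine ⟨_, s, Runs.loop_stop (by simp [Expr.eval, h3, h4]; omega), by simp [Expr.cost], hc, ?_⟩
    intro i hi; exact hd i (by omega)
  | succ m ih =>
    have ra := Runs.store (.add (.reg 4) (.const 1)) (.mem (Expr.cell out (.reg 4))) s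
    have e1 : (Expr.mem (Expr.cell out (.reg 4))).eval s = f j := by
      simp only [Expr.eval, Expr.cell, Expr.eval_shift, h0, h4, hf]
    have e2 : (Expr.add (.reg 4) (.const 1)).eval s = j + 1 := by simp [Expr.eval, h4]
    rw [e1, e2] at ra
    have rb := runs_assign (i := 4) (e := .add (.reg 4) (.const 1)) (v := j + 1)
      (s := ⟨s.reg, Function.update s.mem (j + 1) (f j)⟩) (by simp [Expr.eval, h4])
    obtain ⟨t, s', r, ht, q1, q2⟩ := ih (j + 1) (by omega)
      ⟨Function.update s.reg 4 (j + 1), Function.update s.mem (j + 1) (f j)⟩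
      (by simp [h0])
      (by simp [h3])
      (by simp)
      (by
        intro i
        show Function.update s.mem (j + 1) (f j) _ = _
        rw [Function.update_apply, if_neg (by omega)]; exact hf i)
      (by simp [hc])
      (by
        intro i hi
        show Function.update s.mem (j + 1) (f j) _ = _
        rw [Function.update_apply]
        by_cases hij : i = j
        · rw [if_pos (by omega), hij]
        · rw [if_neg (by omega)]; exact hd i (by omega))
    refine ⟨_, s', .loop_step (by simp [Expr.eval, h3, h4]; omega) (.seq ra rb) r, ?_, q1, q2⟩
    simp only [Expr.cost]
    rw [Nat.add_mul]
    omega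

/-- Every array program yields a machine program which prints the contents of one of the arrays,
in a number of steps that is polynomial in the length of the input and the quota. -/
theorem exists_prog (c : ArrProg) (out cnt : Arr) :
    ∃ (P : Prog) (A d : ℕ), ∀ (k : ℕ) (w : List ℕ), WellShaped k w →
      ∀ σ, σ = c.run ⟨w, w.length + quota k, quota k⟩ (fun _ _ => 0) →
      σ cnt 0 ≤ 2 * quota k →
      ∃ t s, Runs P (initialState w) t s ∧ t ≤ A * (w.length + quota k + 1) ^ d ∧
        outputSet s = (Finset.range (σ cnt 0)).image (σ out) := by
  obtain ⟨A, d, hA⟩ := c.time_le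
  set K := (Expr.cell out (.reg 4)).cost + 20 with hK
  set K' := (Expr.cell cnt (.const 0)).cost with hK'
  refine ⟨.seq measureInput (.seq setup (.seq (c.compile 0) (writeOutput out cnt))),
    A + (200 + K' + 2 * K), d + 1, ?_⟩
  intro k w hw σ hσ hle
  have hk : w.getD 0 0 = k := by obtain ⟨L, L', -, -, rfl⟩ := hw; rfl
  obtain ⟨t1, s1, r1, b1, m1, p1⟩ := runs_measureInput hw
  obtain ⟨t2, s2, r2, b2, m2, p2, p3, p4⟩ := runs_setup s1 m1 p1
  rw [hk] at b2 p2 p3 p4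
  set E : ArrEnv := ⟨w, w.length + quota k, quota k⟩ with hE
  have hm2 : ∀ i, s2.mem i = w.getD i 0 := by intro i; rw [m2, m1]; rfl
  have hrep : Represents E (w.length + 2 * quota k + 1) (fun _ _ => 0) s2 :=
    ⟨p4, p3, p2, fun i _ => hm2 i, fun a i => by
      rw [hm2, List.getD_eq_default]; omega⟩
  obtain ⟨t3, s3, r3, b3, q3, -⟩ := c.runs_compile (E := E) (by simp only [hE]; omega) 0 _ s2 hrep
  rw [← hσ] at q3
  have r4 := Runs.assign 3 (.mem (Expr.cell cnt (.const 0))) s3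
  have e4 : (Expr.mem (Expr.cell cnt (.const 0))).eval s3 = σ cnt 0 := by
    simp only [Expr.cell, Expr.eval, Expr.eval_shift, q3.base]
    exact q3.cell cnt 0
  rw [e4] at r4
  set n := σ cnt 0 with hn
  have r5 := Runs.store (.const 0) (.reg 3) ⟨Function.update s3.reg 3 n, s3.mem⟩
  have e5 : (Expr.reg 3).eval ⟨Function.update s3.reg 3 n, s3.mem⟩ = n := by simp [Expr.eval]
  rw [e5] at r5
  have r6 := Runs.assign 4 (.const 0)
    ⟨Function.update s3.reg 3 n, Function.update s3.mem 0 n⟩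
  obtain ⟨t7, s7, r7, b7, q7, q8⟩ := runs_copyOutput (D := w.length + 2 * quota k + 1) (out := out)
    (n := n) (σ out) (by omega) n 0 (by omega)
    ⟨Function.update (Function.update s3.reg 3 n) 4 0, Function.update s3.mem 0 n⟩
    (by simp [q3.base]) (by simp) (by simp)
    (by
      intro i
      show Function.update s3.mem 0 n _ = _
      rw [Function.update_apply, if_neg (by omega)]; exact q3.cell out i)
    (by simp) (by intro i hi; omega)
  refine ⟨_, s7, .seq r1 (.seq r2 (.seq r3 (.seq r4 (.seq r5 (.seq r6 r7))))), ?_, ?_⟩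
  · have hkq : k ≤ quota k := by
      unfold quota
      have : 1 ≤ 4 ^ k := Nat.one_le_pow _ _ (by omega)
      nlinarith
    set N := w.length + quota k with hN
    have hb3 : t3 ≤ A * (N + 1) ^ d := b3.trans (hA N)
    have h4 : 1 ≤ (N + 1) ^ d := Nat.one_le_pow _ _ (by omega)
    have hb7 : n * K ≤ 2 * (N + 1) * K := Nat.mul_le_mul_right _ (by omega)
    have hb : t1 + t2 ≤ 120 * (N + 1) := by omega
    have hA' : A * (N + 1) ^ d ≤ A * (N + 1) ^ (d + 1) :=
      Nat.mul_le_mul_left _ (Nat.pow_le_pow_right (by omega) (by omega))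
    have hKN : K' ≤ K' * (N + 1) := Nat.le_mul_of_pos_right _ (by omega)
    have hfin : (200 + K' + 2 * K) * (N + 1) ≤ (200 + K' + 2 * K) * (N + 1) ^ (d + 1) := by
      apply Nat.mul_le_mul_left
      rw [pow_succ]; exact Nat.le_mul_of_pos_left _ h4
    have e : (200 + K' + 2 * K) * (N + 1) = 200 * (N + 1) + K' * (N + 1) + 2 * (N + 1) * K := by
      ring
    have hb7' : t7 ≤ 4 + n * K := b7
    have e' : (Expr.mem (Expr.cell cnt (.const 0))).cost = K' + 1 := rfl
    rw [e', Nat.add_mul]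
    simp only [Expr.cost]
    omega
  · ext x
    simp only [outputSet, q7, Finset.mem_image, Finset.mem_range]
    constructor
    · rintro ⟨i, hi, rfl⟩; exact ⟨i, hi, (q8 i hi).symm⟩
    · rintro ⟨i, hi, rfl⟩; exact ⟨i, hi, q8 i hi⟩

/-! ### Non-crossing families of sets -/

/-- The set `e` straddles the set `d`; see `Straddles`. -/
def SetStraddles (lt : ℕ → ℕ → Prop) (e d : Finset ℕ) : Prop :=
  ∃ x ∈ e, ∃ y ∈ e, ∃ z ∈ d, lt x z ∧ lt z y

/-- Two sets straddle each other. -/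
def Cross (lt : ℕ → ℕ → Prop) (e d : Finset ℕ) : Prop :=
  SetStraddles lt e d ∧ SetStraddles lt d e

theorem SetStraddles.mono {lt : ℕ → ℕ → Prop} {e e' d d' : Finset ℕ} (h : SetStraddles lt e d)
    (he : e ⊆ e') (hd : d ⊆ d') : SetStraddles lt e' d' := by
  obtain ⟨x, hx, y, hy, z, hz, h⟩ := h
  exact ⟨x, he hx, y, he hy, z, hd hz, h⟩

theorem Cross.mono {lt : ℕ → ℕ → Prop} {e e' d d' : Finset ℕ} (h : Cross lt e d)
    (he : e ⊆ e') (hd : d ⊆ d') : Cross lt e' d' :=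
  ⟨h.1.mono he hd, h.2.mono hd he⟩

/-- Among three elements there is one between two others. -/
theorem exists_between_of_two_lt_card {lt : ℕ → ℕ → Prop} (hlt : IsStrictTotalOrder ℕ lt)
    {e : Finset ℕ} (he : 2 < e.card) : ∃ x ∈ e, ∃ y ∈ e, ∃ z ∈ e, lt x z ∧ lt z y := by
  obtain ⟨a, b, c, ha, hb, hc, hab, hac, hbc⟩ := Finset.two_lt_card_iff.1 he
  rcases trichotomous_of lt a b with h1 | h1 | h1
  · rcases trichotomous_of lt b c with h2 | h2 | h2
    · exact ⟨a, ha, c, hc, b, hb, h1, h2⟩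
    · exact absurd h2 hbc
    · rcases trichotomous_of lt a c with h3 | h3 | h3
      · exact ⟨a, ha, b, hb, c, hc, h3, h2⟩
      · exact absurd h3 hac
      · exact ⟨c, hc, b, hb, a, ha, h3, h1⟩
  · exact absurd h1 hab
  · rcases trichotomous_of lt a c with h2 | h2 | h2
    · exact ⟨b, hb, c, hc, a, ha, h1, h2⟩
    · exact absurd h2 hac
    · rcases trichotomous_of lt b c with h3 | h3 | h3
      · exact ⟨b, hb, a, ha, c, hc, h3, h2⟩
      · exact absurd h3 hbc
      · exact ⟨c, hc, a, ha, b, hb, h3, h1⟩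

/-- A variable lies strictly inside at most one of the sets that contain it, and all but two
elements of a set lie strictly inside. -/
theorem sum_card_le_of_not_cross {ι : Type*} {lt : ℕ → ℕ → Prop} (hlt : IsStrictTotalOrder ℕ lt)
    (J : Finset ι) (e : ι → Finset ℕ) (Q : Finset ℕ) (hQ : ∀ j ∈ J, e j ⊆ Q)
    (hJ : ∀ i ∈ J, ∀ j ∈ J, i ≠ j → ¬ Cross lt (e i) (e j)) :
    ∑ j ∈ J, (e j).card ≤ Q.card + 2 * J.card := by
  classical
  set I : ι → Finset ℕ := fun j => (e j).filter fun z => ∃ x ∈ e j, ∃ y ∈ e j, lt x z ∧ lt z y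
    with hI
  have h1 : ∀ j ∈ J, (e j).card ≤ (I j).card + 2 := by
    intro j _
    rw [← Finset.card_filter_add_card_filter_not (s := e j)
      (fun z => ∃ x ∈ e j, ∃ y ∈ e j, lt x z ∧ lt z y)]
    refine Nat.add_le_add_left ?_ _
    by_contra hcon
    obtain ⟨x, hx, y, hy, z, hz, h⟩ := exists_between_of_two_lt_card hlt (not_le.1 hcon)
    rw [Finset.mem_filter] at hx hy hz
    exact hz.2 ⟨x, hx.1, y, hy.1, h⟩
  have h2 : ∑ j ∈ J, (I j).card = (J.biUnion I).card := by
    symm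
    apply Finset.card_biUnion
    intro i hi j hj hij
    refine Finset.disjoint_left.2 ?_
    intro z hzi hzj
    rw [hI, Finset.mem_filter] at hzi hzj
    obtain ⟨hz1, x, hx, y, hy, h⟩ := hzi
    obtain ⟨hz2, x', hx', y', hy', h'⟩ := hzj
    exact hJ i hi j hj hij ⟨⟨x, hx, y, hy, z, hz2, h⟩, ⟨x', hx', y', hy', z, hz1, h'⟩⟩
  have h3 : (J.biUnion I).card ≤ Q.card := by
    apply Finset.card_le_card
    intro z hz
    obtain ⟨j, hj, hz⟩ := Finset.mem_biUnion.1 hz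
    exact hQ j hj (Finset.mem_filter.1 hz).1
  calc ∑ j ∈ J, (e j).card ≤ ∑ j ∈ J, ((I j).card + 2) := Finset.sum_le_sum h1
    _ = ∑ j ∈ J, (I j).card + 2 * J.card := by
      rw [Finset.sum_add_distrib, Finset.sum_const, smul_eq_mul, mul_comm]
    _ ≤ _ := by omega

/-! ### Connected pieces of an incidence graph -/

/-- Adjacency in the incidence graph of the sets `H j`; the set with number `j` has the code
`2 * j + 1`, and the variable `x` has the code `2 * x`. -/
def IncAdj (H : ℕ → Finset ℕ) (a b : ℕ) : Prop :=
  ∃ j, ∃ x ∈ H j, (a = 2 * j + 1 ∧ b = 2 * x) ∨ (a = 2 * x ∧ b = 2 * j + 1)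

theorem IncAdj.symm {H : ℕ → Finset ℕ} {a b : ℕ} (h : IncAdj H a b) : IncAdj H b a := by
  obtain ⟨j, x, hx, ⟨rfl, rfl⟩ | ⟨rfl, rfl⟩⟩ := h
  · exact ⟨j, x, hx, Or.inr ⟨rfl, rfl⟩⟩
  · exact ⟨j, x, hx, Or.inl ⟨rfl, rfl⟩⟩

/-- There is a walk from `a` to `b` inside the vertex set `S`. -/
def LinkedIn (H : ℕ → Finset ℕ) (S : Set ℕ) : ℕ → ℕ → Prop :=
  Relation.ReflTransGen fun u v => u ∈ S ∧ v ∈ S ∧ IncAdj H u v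

/-- The vertex set `S` is connected or empty. -/
def Joined (H : ℕ → Finset ℕ) (S : Set ℕ) : Prop :=
  ∀ a ∈ S, ∀ b ∈ S, LinkedIn H S a b

/-- The variable `x` occurs in one of the clauses in the vertex set `S`. -/
def Touches (H : ℕ → Finset ℕ) (S : Set ℕ) (x : ℕ) : Prop :=
  ∃ j, 2 * j + 1 ∈ S ∧ x ∈ H j

theorem LinkedIn.symm {H : ℕ → Finset ℕ} {S : Set ℕ} {a b : ℕ} (h : LinkedIn H S a b) :
    LinkedIn H S b a := by
  induction h with
  | refl => exact .refl
  | tail _ h ih => exact Relation.ReflTransGen.head ⟨h.2.1, h.1, h.2.2.symm⟩ ih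

theorem LinkedIn.mono {H : ℕ → Finset ℕ} {S T : Set ℕ} {a b : ℕ} (h : LinkedIn H S a b)
    (hST : S ⊆ T) : LinkedIn H T a b :=
  Relation.ReflTransGen.mono (fun _ _ h => ⟨hST h.1, hST h.2.1, h.2.2⟩) _ _ h

theorem Joined.of_root {H : ℕ → Finset ℕ} {S : Set ℕ} (r : ℕ) (h : ∀ a ∈ S, LinkedIn H S a r) :
    Joined H S :=
  fun a ha b hb => (h a ha).trans (h b hb).symm

/-- If a set `d` crosses none of the clauses of a connected piece, and contains none of its
variables, then `d` does not cross the union of these clauses. -/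
theorem not_cross_of_joined {lt : ℕ → ℕ → Prop} (hlt : IsStrictTotalOrder ℕ lt)
    {H : ℕ → Finset ℕ} {S : Set ℕ} (hS : Joined H S) {d E : Finset ℕ}
    (hd : ∀ x ∈ d, 2 * x ∉ S) (hc : ∀ j, 2 * j + 1 ∈ S → ¬ Cross lt (H j) d)
    (hE : ∀ x ∈ E, Touches H S x) : ¬ Cross lt E d := by
  rintro ⟨⟨x, hx, y, hy, w, hw, hxw, hwy⟩, ⟨a, ha, b, hb, v, hv, hav, hvb⟩⟩
  obtain ⟨j₀, hj₀, hv₀⟩ := hE v hv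
  obtain ⟨j₁, hj₁, hx₁⟩ := hE x hx
  obtain ⟨j₂, hj₂, hy₂⟩ := hE y hy
  have tr : ∀ {p q r : ℕ}, lt p q → lt q r → lt p r := fun h h' => _root_.trans h h'
  -- Going through the piece, every clause and every variable has a part strictly inside `d`.
  have inside : ∀ u, LinkedIn H S (2 * j₀ + 1) u →
      (∀ j, u = 2 * j + 1 → SetStraddles lt d (H j)) ∧
      (∀ z, u = 2 * z → ∃ a ∈ d, ∃ b ∈ d, lt a z ∧ lt z b) := by
    intro u hu
    induction hu with
    | refl =>
      refine ⟨fun j hj => ?_, fun z hz => by omega⟩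
      obtain rfl : j₀ = j := by omega
      exact ⟨a, ha, b, hb, v, hv₀, hav, hvb⟩
    | tail _ h ih =>
      obtain ⟨hb, hc', j, z, hz, ⟨rfl, rfl⟩ | ⟨rfl, rfl⟩⟩ := h
      · refine ⟨fun j hj => by omega, fun z' hz' => ?_⟩
        obtain rfl : z = z' := by omega
        have hs := ih.1 j rfl
        have ht : ¬ SetStraddles lt (H j) d := fun h => hc j hb ⟨h, hs⟩
        obtain ⟨a, ha, b, hb, v, hv, hav, hvb⟩ := hs
        refine ⟨a, ha, b, hb, ?_, ?_⟩
        · rcases trichotomous_of lt a z with h | h | h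
          · exact h
          · exact absurd hc' (hd z (h ▸ ha))
          · exact absurd ⟨z, hz, v, hv, a, ha, h, hav⟩ ht
        · rcases trichotomous_of lt z b with h | h | h
          · exact h
          · exact absurd hc' (hd z (h ▸ hb))
          · exact absurd ⟨v, hv, z, hz, b, hb, hvb, h⟩ ht
      · refine ⟨fun j' hj' => ?_, fun z' hz' => by omega⟩
        obtain rfl : j = j' := by omega
        obtain ⟨a, ha, b, hb, h1, h2⟩ := ih.2 z rfl
        exact ⟨a, ha, b, hb, z, hz, h1, h2⟩
  have thin : ∀ j, 2 * j + 1 ∈ S → ¬ SetStraddles lt (H j) d := fun j hj h =>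
    hc j hj ⟨h, (inside _ (hS _ hj₀ _ hj)).1 j rfl⟩
  -- So no element of `d` separates the elements of a clause, nor those of neighbouring clauses.
  have gap : ∀ u, LinkedIn H S (2 * j₁ + 1) u →
      (∀ j, u = 2 * j + 1 → ∀ y ∈ H j, ∀ w ∈ d, ¬ (lt x w ∧ lt w y) ∧ ¬ (lt y w ∧ lt w x)) ∧
      (∀ z, u = 2 * z → ∀ w ∈ d, ¬ (lt x w ∧ lt w z) ∧ ¬ (lt z w ∧ lt w x)) := by
    intro u hu
    induction hu with
    | refl =>
      refine ⟨fun j hj y hy w hw => ?_, fun z hz => by omega⟩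
      obtain rfl : j₁ = j := by omega
      exact ⟨fun h => thin _ hj₁ ⟨x, hx₁, y, hy, w, hw, h⟩,
        fun h => thin _ hj₁ ⟨y, hy, x, hx₁, w, hw, h⟩⟩
    | tail _ h ih =>
      obtain ⟨hb, hc', j, z, hz, ⟨rfl, rfl⟩ | ⟨rfl, rfl⟩⟩ := h
      · refine ⟨fun j hj => by omega, fun z' hz' => ?_⟩
        obtain rfl : z = z' := by omega
        exact ih.1 j rfl z hz
      · refine ⟨fun j' hj' y hy w hw => ?_, fun z' hz' => by omega⟩
        obtain rfl : j = j' := by omega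
        have h1 := ih.2 z rfl w hw
        have h2 : ¬ (lt z w ∧ lt w y) := fun h => thin _ hc' ⟨z, hz, y, hy, w, hw, h⟩
        have h3 : ¬ (lt y w ∧ lt w z) := fun h => thin _ hc' ⟨y, hy, z, hz, w, hw, h⟩
        have h4 : w ≠ z := fun h => hd w hw (h ▸ hb)
        rcases trichotomous_of lt w z with h | h | h
        · exact ⟨fun h' => h1.1 ⟨h'.1, h⟩, fun h' => h3 ⟨h'.1, h⟩⟩
        · exact absurd h h4
        · exact ⟨fun h' => h2 ⟨h, h'.2⟩, fun h' => h1.2 ⟨h, h'.2⟩⟩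
  exact ((gap _ (hS _ hj₁ _ hj₂)).1 j₂ rfl y hy₂ w hw).1 ⟨hxw, hwy⟩

/-- Contracting two disjoint connected pieces to single clauses does not produce a crossing. -/
theorem not_cross_of_joined_of_joined {lt : ℕ → ℕ → Prop} (hlt : IsStrictTotalOrder ℕ lt)
    {H : ℕ → Finset ℕ} {S₁ S₂ : Set ℕ} (h₁ : Joined H S₁) (h₂ : Joined H S₂)
    (hdisj : Disjoint S₁ S₂)
    (hc : ∀ i j, 2 * i + 1 ∈ S₁ → 2 * j + 1 ∈ S₂ → ¬ Cross lt (H i) (H j))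
    {E₁ E₂ : Finset ℕ} (hE₁ : ∀ x ∈ E₁, Touches H S₁ x ∧ 2 * x ∉ S₂)
    (hE₂ : ∀ x ∈ E₂, Touches H S₂ x ∧ 2 * x ∉ S₁) : ¬ Cross lt E₁ E₂ := by
  classical
  have step : ∀ j, 2 * j + 1 ∈ S₂ → ¬ Cross lt E₁ ((H j).filter fun x => 2 * x ∉ S₁) := by
    intro j hj
    refine not_cross_of_joined hlt h₁ (fun x hx => (Finset.mem_filter.1 hx).2) (fun i hi h => ?_)
      (fun x hx => (hE₁ x hx).1)
    exact hc i j hi hj (h.mono le_rfl (Finset.filter_subset _ _))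
  set H' : ℕ → Finset ℕ := fun j => (H j).filter fun x => 2 * x ∉ S₁ with hH'
  have h₂' : Joined H' S₂ := by
    intro a ha b hb
    refine Relation.ReflTransGen.mono (fun u v h => ?_) _ _ (h₂ a ha b hb)
    obtain ⟨hu, hv, j, x, hx, ⟨rfl, rfl⟩ | ⟨rfl, rfl⟩⟩ := h
    · exact ⟨hu, hv, j, x, Finset.mem_filter.2 ⟨hx, fun h => Set.disjoint_left.1 hdisj h hv⟩,
        Or.inl ⟨rfl, rfl⟩⟩
    · exact ⟨hu, hv, j, x, Finset.mem_filter.2 ⟨hx, fun h => Set.disjoint_left.1 hdisj h hu⟩,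
        Or.inr ⟨rfl, rfl⟩⟩
  have := not_cross_of_joined hlt h₂' (d := E₁) (E := E₂) (fun x hx => (hE₁ x hx).2)
    (fun j hj h => step j hj ⟨h.2, h.1⟩) (fun x hx => by
      obtain ⟨⟨j, hj, hxj⟩, hx'⟩ := hE₂ x hx
      exact ⟨j, hj, Finset.mem_filter.2 ⟨hxj, hx'⟩⟩)
  exact fun h => this ⟨h.2, h.1⟩

/-- At most `2 * Q.card` disjoint connected pieces of a nested formula can contain clauses with
three of the variables in `Q`. -/
theorem card_pieces_le {ι : Type*} {lt : ℕ → ℕ → Prop} (hlt : IsStrictTotalOrder ℕ lt)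
    {H : ℕ → Finset ℕ} (L : Finset ι) (S : ι → Set ℕ) (hS : ∀ l ∈ L, Joined H (S l))
    (hdisj : ∀ l ∈ L, ∀ l' ∈ L, l ≠ l' → Disjoint (S l) (S l'))
    (hc : ∀ l ∈ L, ∀ l' ∈ L, l ≠ l' → ∀ i j, 2 * i + 1 ∈ S l → 2 * j + 1 ∈ S l' →
      ¬ Cross lt (H i) (H j))
    (Q : Finset ℕ) (T : ι → Finset ℕ) (hTQ : ∀ l ∈ L, T l ⊆ Q) (hT3 : ∀ l ∈ L, 3 ≤ (T l).card)
    (hT : ∀ l ∈ L, ∀ x ∈ T l, Touches H (S l) x) : L.card ≤ 2 * Q.card := by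
  classical
  rw [← Finset.card_filter_add_card_filter_not (s := L) (fun l => ∃ x ∈ Q, 2 * x ∈ S l)]
  have h1 : (L.filter fun l => ∃ x ∈ Q, 2 * x ∈ S l).card ≤ Q.card := by
    have hch : ∀ l : ι, ∃ x, (∃ x ∈ Q, 2 * x ∈ S l) → x ∈ Q ∧ 2 * x ∈ S l := by
      intro l
      by_cases h : ∃ x ∈ Q, 2 * x ∈ S l
      · obtain ⟨x, hx⟩ := h; exact ⟨x, fun _ => hx⟩
      · exact ⟨0, fun h' => absurd h' h⟩
    choose g hg using hch
    refine Finset.card_le_card_of_injOn g (fun l hl => ?_) (fun l hl l' hl' h => ?_)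
    · exact (hg l (Finset.mem_filter.1 hl).2).1
    · by_contra hne
      rw [Finset.mem_coe, Finset.mem_filter] at hl hl'
      exact Set.disjoint_left.1 (hdisj l hl.1 l' hl'.1 hne) (hg l hl.2).2 (h ▸ (hg l' hl'.2).2)
  set L' := L.filter fun l => ¬ ∃ x ∈ Q, 2 * x ∈ S l with hL'
  have hmem : ∀ l ∈ L', l ∈ L ∧ ∀ x ∈ Q, 2 * x ∉ S l := by
    intro l hl
    rw [hL', Finset.mem_filter] at hl
    exact ⟨hl.1, fun x hx h => hl.2 ⟨x, hx, h⟩⟩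
  have h2 := sum_card_le_of_not_cross hlt L' T Q (fun l hl => hTQ l (hmem l hl).1)
    (fun l hl l' hl' hne => by
      refine not_cross_of_joined_of_joined hlt (hS l (hmem l hl).1) (hS l' (hmem l' hl').1)
        (hdisj l (hmem l hl).1 l' (hmem l' hl').1 hne)
        (hc l (hmem l hl).1 l' (hmem l' hl').1 hne) (fun x hx => ?_) (fun x hx => ?_)
      · exact ⟨hT l (hmem l hl).1 x hx, (hmem l' hl').2 x (hTQ l (hmem l hl).1 hx)⟩
      · exact ⟨hT l' (hmem l' hl').1 x hx, (hmem l hl).2 x (hTQ l' (hmem l' hl').1 hx)⟩)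
  have h3 : L'.card * 3 ≤ ∑ l ∈ L', (T l).card := by
    rw [← smul_eq_mul]
    exact Finset.card_nsmul_le_sum _ _ _ fun l hl => hT3 l (hmem l hl).1
  omega

/-! ### Connected sets: decomposition -/

theorem Joined.union {H : ℕ → Finset ℕ} {S T : Set ℕ} (hS : Joined H S) (hT : Joined H T)
    {s t : ℕ} (hs : s ∈ S) (ht : t ∈ T) (h : IncAdj H s t ∨ s = t) : Joined H (S ∪ T) := by
  have e : LinkedIn H (S ∪ T) t s := by
    rcases h with h | rfl
    · exact .single ⟨Or.inr ht, Or.inl hs, h.symm⟩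
    · exact .refl
  refine Joined.of_root s ?_
  rintro a (ha | ha)
  · exact (hS a ha s hs).mono Set.subset_union_left
  · exact ((hT a ha t ht).mono Set.subset_union_right).trans e

/-- The component of `b` after the removal of `a` from a connected set. -/
theorem Joined.exists_component {H : ℕ → Finset ℕ} {S : Set ℕ} (hS : Joined H S) {a b : ℕ}
    (ha : a ∈ S) (hb : b ∈ S) (hab : a ≠ b) :
    ∃ K ⊆ S, Joined H K ∧ b ∈ K ∧ a ∉ K ∧ ∃ z ∈ K, IncAdj H z a := by
  refine ⟨{u | LinkedIn H (S \ {a}) b u}, ?_, ?_, .refl, ?_, ?_⟩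
  · intro u hu
    rcases Relation.ReflTransGen.cases_tail hu with rfl | ⟨v, -, h⟩
    · exact hb
    · exact h.2.1.1
  · refine Joined.of_root b fun u hu => ?_
    induction hu with
    | refl => exact .refl
    | tail h1 h ih => exact .head ⟨h1.tail h, h1, h.2.2.symm⟩ ih
  · intro hu
    rcases Relation.ReflTransGen.cases_tail hu with h | ⟨v, -, h⟩
    · exact hab h
    · exact h.2.1.2 rfl
  · have : ∀ u, LinkedIn H S b u → LinkedIn H (S \ {a}) b u ∨
        ∃ z, LinkedIn H (S \ {a}) b z ∧ IncAdj H z a := by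
      intro u hu
      induction hu with
      | refl => exact Or.inl .refl
      | @tail u v h1 h ih =>
        rcases ih with ih | ih
        · by_cases hv : v = a
          · exact Or.inr ⟨u, ih, hv ▸ h.2.2⟩
          · refine Or.inl (ih.tail ⟨⟨h.1, ?_⟩, ⟨h.2.1, hv⟩, h.2.2⟩)
            rintro rfl
            rcases Relation.ReflTransGen.cases_tail ih with h | ⟨w, -, h⟩
            · exact hab h
            · exact h.2.1.2 rfl
        · exact Or.inr ih
    rcases this a (hS b hb a ha) with h | h
    · exfalso
      rcases Relation.ReflTransGen.cases_tail h with h | ⟨v, -, h⟩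
      · exact hab h
      · exact h.2.1.2 rfl
    · exact h

/-- In a connected set with two given vertices `a ≠ b` there is a variable that can be reached from
`a` and from `b` by disjoint connected sets. -/
theorem Joined.exists_middle {H : ℕ → Finset ℕ} {S : Set ℕ} (hS : Joined H S) {a b : ℕ}
    (ha : a ∈ S) (hb : b ∈ S) (hab : a ≠ b) :
    ∃ z, ∃ P ⊆ S, ∃ R ⊆ S, 2 * z ∈ S ∧ 2 * z ∉ P ∧ 2 * z ∉ R ∧ Disjoint P R ∧
      (∀ X x, Joined H X → x ∈ X → IncAdj H x a →
        Joined H (X ∪ P) ∧ ∃ u ∈ X ∪ P, IncAdj H u (2 * z)) ∧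
      (∀ X x, Joined H X → x ∈ X → IncAdj H x b →
        Joined H (X ∪ R) ∧ ∃ u ∈ X ∪ R, IncAdj H u (2 * z)) := by
  obtain ⟨K, hKS, hK, hbK, haK, z, hzK, hza⟩ := hS.exists_component ha hb hab
  rcases Nat.even_or_odd' a with ⟨x, rfl | rfl⟩
  · -- The vertex `a` is a variable.
    refine ⟨x, ∅, Set.empty_subset _, K, hKS, ha, fun h => h, haK, Set.empty_disjoint _, ?_, ?_⟩
    · intro X u hX hu h
      rw [Set.union_empty]; exact ⟨hX, u, hu, h⟩
    · intro X u hX hu h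
      exact ⟨hX.union hK hu hbK (Or.inl h), z, Or.inr hzK, hza⟩
  · -- The vertex `a` is a clause, so its neighbour `z` is a variable.
    obtain ⟨y, rfl⟩ : ∃ y, z = 2 * y := by
      obtain ⟨j, y, hy, h | h⟩ := hza
      · omega
      · exact ⟨y, h.1⟩
    have hP : Joined H {2 * x + 1} := by
      rintro u hu v hv
      rw [Set.mem_singleton_iff] at hu hv
      subst hu; subst hv; exact .refl
    have hX : ∀ X u, Joined H X → u ∈ X → IncAdj H u (2 * x + 1) →
        Joined H (X ∪ {2 * x + 1}) ∧ ∃ u ∈ X ∪ {2 * x + 1}, IncAdj H u (2 * y) :=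
      fun X u hX hu h => ⟨hX.union hP hu rfl (Or.inl h), _, Or.inr rfl, hza.symm⟩
    by_cases hyb : 2 * y = b
    · refine ⟨y, {2 * x + 1}, by simpa using ha, ∅, Set.empty_subset _, hKS hzK, ?_, fun h => h,
        Set.disjoint_empty _, hX, ?_⟩
      · rw [Set.mem_singleton_iff]; omega
      · intro X u hX hu h
        rw [Set.union_empty]; exact ⟨hX, u, hu, hyb ▸ h⟩
    · obtain ⟨M, hMK, hM, hbM, hyM, v, hvM, hv⟩ := hK.exists_component hzK hbK hyb
      refine ⟨y, {2 * x + 1}, by simpa using ha, M, hMK.trans hKS, hKS hzK, ?_, hyM, ?_, hX, ?_⟩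
      · rw [Set.mem_singleton_iff]; omega
      · rw [Set.disjoint_singleton_left]; exact fun h => haK (hMK h)
      · intro X u hX hu h
        exact ⟨hX.union hM hu hbM (Or.inl h), v, Or.inr hvM, hv⟩

/-- A model of the `4 × 3` grid in the incidence graph of a family of sets. -/
structure GridBlock (H : ℕ → Finset ℕ) (bag : ℕ → ℕ → Set ℕ) : Prop where
  joined : ∀ i < 4, ∀ j < 3, Joined H (bag i j)
  disjoint : ∀ i < 4, ∀ j < 3, ∀ i' < 4, ∀ j' < 3, (i, j) ≠ (i', j') →
    Disjoint (bag i j) (bag i' j')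
  right : ∀ i < 4, ∀ j, j + 1 < 3 → ∃ a ∈ bag i j, ∃ b ∈ bag i (j + 1), IncAdj H a b
  down : ∀ i, i + 1 < 4 → ∀ j < 3, ∃ a ∈ bag i j, ∃ b ∈ bag (i + 1) j, IncAdj H a b

/-- The incidence graph of a nested formula has no `4 × 3` grid as a minor: the first and the last
row could be contracted to two clauses with three variables in common. -/
theorem GridBlock.exists_cross {lt : ℕ → ℕ → Prop} (hlt : IsStrictTotalOrder ℕ lt)
    {H : ℕ → Finset ℕ} {bag : ℕ → ℕ → Set ℕ} (h : GridBlock H bag) :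
    ∃ i j, i ≠ j ∧ (∃ p < 4, ∃ q < 3, 2 * i + 1 ∈ bag p q) ∧
      (∃ p < 4, ∃ q < 3, 2 * j + 1 ∈ bag p q) ∧ Cross lt (H i) (H j) := by
  by_contra hcon
  push Not at hcon
  have row : ∀ i < 4, Joined H (bag i 0 ∪ bag i 1 ∪ bag i 2) := by
    intro i hi
    obtain ⟨a, ha, b, hb, hab⟩ := h.right i hi 0 (by omega)
    obtain ⟨a', ha', b', hb', hab'⟩ := h.right i hi 1 (by omega)
    exact ((h.joined i hi 0 (by omega)).union (h.joined i hi 1 (by omega)) ha hb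
      (Or.inl hab)).union (h.joined i hi 2 (by omega)) (Or.inr ha') hb' (Or.inl hab')
  have col : ∀ q, q < 3 → ∃ z, ∃ P ⊆ bag 1 q ∪ bag 2 q, ∃ R ⊆ bag 1 q ∪ bag 2 q,
      2 * z ∈ bag 1 q ∪ bag 2 q ∧ 2 * z ∉ P ∧ 2 * z ∉ R ∧ Disjoint P R ∧
      (∀ X, Joined H X → bag 0 q ⊆ X →
        Joined H (X ∪ P) ∧ ∃ u ∈ X ∪ P, IncAdj H u (2 * z)) ∧
      (∀ X, Joined H X → bag 3 q ⊆ X →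
        Joined H (X ∪ R) ∧ ∃ u ∈ X ∪ R, IncAdj H u (2 * z)) := by
    intro q hq
    obtain ⟨x, hx, a, ha, hxa⟩ := h.down 0 (by omega) q hq
    obtain ⟨u, hu, v, hv, huv⟩ := h.down 1 (by omega) q hq
    obtain ⟨b, hb, y, hy, hby⟩ := h.down 2 (by omega) q hq
    have hS := (h.joined 1 (by omega) q hq).union (h.joined 2 (by omega) q hq) hu hv (Or.inl huv)
    have hab : a ≠ b := by
      rintro rfl
      exact Set.disjoint_left.1 (h.disjoint 1 (by omega) q hq 2 (by omega) q hq (by simp)) ha hb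
    obtain ⟨z, P, hP, R, hR, hz, hzP, hzR, hPR, h1, h2⟩ :=
      hS.exists_middle (Or.inl ha) (Or.inr hb) hab
    exact ⟨z, P, hP, R, hR, hz, hzP, hzR, hPR, fun X hX hs => h1 X x hX (hs hx) hxa,
      fun X hX hs => h2 X y hX (hs hy) hby.symm⟩
  have mem_disj : ∀ i < 4, ∀ j < 3, ∀ i' < 4, ∀ j' < 3, ∀ v, v ∈ bag i j → v ∈ bag i' j' →
      i = i' ∧ j = j' := by
    intro i hi j hj i' hi' j' hj' v hv hv'
    by_contra hne
    refine Set.disjoint_left.1 (h.disjoint i hi j hj i' hi' j' hj' ?_) hv hv'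
    intro he
    rw [Prod.mk.injEq] at he
    exact hne he
  choose z P hP R hR hz hzP hzR hPR h1 h2 using col
  -- The first row with its parts of the columns, and the last row with its parts.
  set X := bag 0 0 ∪ bag 0 1 ∪ bag 0 2 with hX
  set Y := bag 3 0 ∪ bag 3 1 ∪ bag 3 2 with hY
  have sub : ∀ i, ∀ q < 3, bag i q ⊆ bag i 0 ∪ bag i 1 ∪ bag i 2 := by
    intro i q hq v hv
    interval_cases q
    · exact Or.inl (Or.inl hv)
    · exact Or.inl (Or.inr hv)
    · exact Or.inr hv
  obtain ⟨x0, hx0⟩ : ∃ x, x ∈ X := by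
    obtain ⟨a, ha, -⟩ := h.right 0 (by omega) 0 (by omega)
    exact ⟨a, Or.inl (Or.inl ha)⟩
  obtain ⟨y0, hy0⟩ : ∃ y, y ∈ Y := by
    obtain ⟨a, ha, -⟩ := h.right 3 (by omega) 0 (by omega)
    exact ⟨a, Or.inl (Or.inl ha)⟩
  set S₁ := (X ∪ P 0 (by omega)) ∪ (X ∪ P 1 (by omega)) ∪ (X ∪ P 2 (by omega)) with hS₁
  set S₂ := (Y ∪ R 0 (by omega)) ∪ (Y ∪ R 1 (by omega)) ∪ (Y ∪ R 2 (by omega)) with hS₂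
  have m₁ : ∀ v ∈ S₁, (∃ q < 3, v ∈ bag 0 q) ∨ ∃ q, ∃ hq : q < 3, v ∈ P q hq := by
    rintro v (((hv | hv) | (hv | hv)) | (hv | hv))
    any_goals (rcases hv with (hv | hv) | hv <;> exact Or.inl ⟨_, by omega, hv⟩)
    all_goals exact Or.inr ⟨_, _, hv⟩
  have m₂ : ∀ v ∈ S₂, (∃ q < 3, v ∈ bag 3 q) ∨ ∃ q, ∃ hq : q < 3, v ∈ R q hq := by
    rintro v (((hv | hv) | (hv | hv)) | (hv | hv))
    any_goals (rcases hv with (hv | hv) | hv <;> exact Or.inl ⟨_, by omega, hv⟩)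
    all_goals exact Or.inr ⟨_, _, hv⟩
  have pos₁ : ∀ v ∈ S₁, ∃ p < 4, ∃ q < 3, v ∈ bag p q := by
    intro v hv
    rcases m₁ v hv with ⟨q, hq, h'⟩ | ⟨q, hq, h'⟩
    · exact ⟨0, by omega, q, hq, h'⟩
    · rcases hP q hq h' with h' | h'
      · exact ⟨1, by omega, q, hq, h'⟩
      · exact ⟨2, by omega, q, hq, h'⟩
  have pos₂ : ∀ v ∈ S₂, ∃ p < 4, ∃ q < 3, v ∈ bag p q := by
    intro v hv
    rcases m₂ v hv with ⟨q, hq, h'⟩ | ⟨q, hq, h'⟩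
    · exact ⟨3, by omega, q, hq, h'⟩
    · rcases hR q hq h' with h' | h'
      · exact ⟨1, by omega, q, hq, h'⟩
      · exact ⟨2, by omega, q, hq, h'⟩
  have in_mid : ∀ q, q < 3 → ∀ v, v ∈ bag 1 q ∪ bag 2 q → ∃ p, 1 ≤ p ∧ p < 3 ∧ v ∈ bag p q := by
    rintro q hq v (hv | hv)
    · exact ⟨1, by omega, by omega, hv⟩
    · exact ⟨2, by omega, by omega, hv⟩
  have hdisj : Disjoint S₁ S₂ := by
    rw [Set.disjoint_left]
    intro v hv hv'
    rcases m₁ v hv with ⟨q, hq, h'⟩ | ⟨q, hq, h'⟩ <;>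
      rcases m₂ v hv' with ⟨q', hq', h''⟩ | ⟨q', hq', h''⟩
    · have := mem_disj 0 (by omega) q hq 3 (by omega) q' hq' v h' h''
      omega
    · obtain ⟨p, hp1, hp2, hp⟩ := in_mid q' hq' v (hR q' hq' h'')
      have := mem_disj 0 (by omega) q hq p (by omega) q' hq' v h' hp
      omega
    · obtain ⟨p, hp1, hp2, hp⟩ := in_mid q hq v (hP q hq h')
      have := mem_disj p (by omega) q hq 3 (by omega) q' hq' v hp h''
      omega
    · obtain ⟨p, hp1, hp2, hp⟩ := in_mid q hq v (hP q hq h')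
      obtain ⟨p', hp1', hp2', hp'⟩ := in_mid q' hq' v (hR q' hq' h'')
      obtain ⟨-, rfl⟩ := mem_disj p (by omega) q hq p' (by omega) q' hq' v hp hp'
      exact Set.disjoint_left.1 (hPR q hq) h' h''
  have zS₁ : ∀ q (hq : q < 3), 2 * z q hq ∉ S₁ := by
    intro q hq hv
    obtain ⟨p, hp1, hp2, hp⟩ := in_mid q hq _ (hz q hq)
    rcases m₁ _ hv with ⟨q', hq', h'⟩ | ⟨q', hq', h'⟩
    · have := mem_disj p (by omega) q hq 0 (by omega) q' hq' _ hp h'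
      omega
    · obtain ⟨p', hp1', hp2', hp'⟩ := in_mid q' hq' _ (hP q' hq' h')
      obtain ⟨-, rfl⟩ := mem_disj p (by omega) q hq p' (by omega) q' hq' _ hp hp'
      exact hzP q hq h'
  have zS₂ : ∀ q (hq : q < 3), 2 * z q hq ∉ S₂ := by
    intro q hq hv
    obtain ⟨p, hp1, hp2, hp⟩ := in_mid q hq _ (hz q hq)
    rcases m₂ _ hv with ⟨q', hq', h'⟩ | ⟨q', hq', h'⟩
    · have := mem_disj p (by omega) q hq 3 (by omega) q' hq' _ hp h'
      omega
    · obtain ⟨p', hp1', hp2', hp'⟩ := in_mid q' hq' _ (hR q' hq' h')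
      obtain ⟨-, rfl⟩ := mem_disj p (by omega) q hq p' (by omega) q' hq' _ hp hp'
      exact hzR q hq h'
  have zne : ∀ q (hq : q < 3) q' (hq' : q' < 3), q ≠ q' → z q hq ≠ z q' hq' := by
    intro q hq q' hq' hne he
    obtain ⟨p, hp1, hp2, hp⟩ := in_mid q hq _ (hz q hq)
    obtain ⟨p', hp1', hp2', hp'⟩ := in_mid q' hq' _ (hz q' hq')
    rw [he] at hp
    exact hne (mem_disj p (by omega) q hq p' (by omega) q' hq' _ hp hp').2
  have touch : ∀ (T : Set ℕ) x u, u ∈ T → IncAdj H u (2 * x) → Touches H T x := by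
    rintro T x u hu ⟨j, y, hy, ⟨rfl, h'⟩ | ⟨rfl, h'⟩⟩
    · exact ⟨j, hu, by rwa [show x = y by omega]⟩
    · omega
  have hX' := row 0 (by omega)
  have hY' := row 3 (by omega)
  have J₁ : Joined H S₁ :=
    (((h1 0 (by omega) X hX' (sub 0 0 (by omega))).1.union
      (h1 1 (by omega) X hX' (sub 0 1 (by omega))).1 (Or.inl hx0) (Or.inl hx0)
      (Or.inr rfl))).union (h1 2 (by omega) X hX' (sub 0 2 (by omega))).1
      (Or.inl (Or.inl hx0)) (Or.inl hx0) (Or.inr rfl)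
  have J₂ : Joined H S₂ :=
    (((h2 0 (by omega) Y hY' (sub 3 0 (by omega))).1.union
      (h2 1 (by omega) Y hY' (sub 3 1 (by omega))).1 (Or.inl hy0) (Or.inl hy0)
      (Or.inr rfl))).union (h2 2 (by omega) Y hY' (sub 3 2 (by omega))).1
      (Or.inl (Or.inl hy0)) (Or.inl hy0) (Or.inr rfl)
  have part₁ : ∀ q (hq : q < 3), X ∪ P q hq ⊆ S₁ := by
    intro q hq v hv
    interval_cases q
    · exact Or.inl (Or.inl hv)
    · exact Or.inl (Or.inr hv)
    · exact Or.inr hv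
  have part₂ : ∀ q (hq : q < 3), Y ∪ R q hq ⊆ S₂ := by
    intro q hq v hv
    interval_cases q
    · exact Or.inl (Or.inl hv)
    · exact Or.inl (Or.inr hv)
    · exact Or.inr hv
  have T₁ : ∀ q (hq : q < 3), Touches H S₁ (z q hq) := by
    intro q hq
    obtain ⟨u, hu, hadj⟩ := (h1 q hq X hX' (sub 0 q hq)).2
    exact touch _ _ u (part₁ q hq hu) hadj
  have T₂ : ∀ q (hq : q < 3), Touches H S₂ (z q hq) := by
    intro q hq
    obtain ⟨u, hu, hadj⟩ := (h2 q hq Y hY' (sub 3 q hq)).2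
    exact touch _ _ u (part₂ q hq hu) hadj
  set E : Finset ℕ := {z 0 (by omega), z 1 (by omega), z 2 (by omega)} with hE
  have hEm : ∀ x ∈ E, ∃ q, ∃ hq : q < 3, x = z q hq := by
    intro x hx
    rw [hE] at hx
    simp only [Finset.mem_insert, Finset.mem_singleton] at hx
    rcases hx with h | h | h
    · exact ⟨0, _, h⟩
    · exact ⟨1, _, h⟩
    · exact ⟨2, _, h⟩
  have hEc : 2 < E.card := by
    rw [hE, Finset.card_eq_three.2 ⟨_, _, _, zne 0 (by omega) 1 (by omega) (by omega),
      zne 0 (by omega) 2 (by omega) (by omega), zne 1 (by omega) 2 (by omega) (by omega), rfl⟩]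
    omega
  refine not_cross_of_joined_of_joined hlt J₁ J₂ hdisj (E₁ := E) (E₂ := E) ?_ ?_ ?_ ?_
  · intro i j hi hj hcr
    refine hcon i j ?_ (pos₁ _ hi) (pos₂ _ hj) hcr
    rintro rfl
    exact Set.disjoint_left.1 hdisj hi hj
  · intro x hx
    obtain ⟨q, hq, rfl⟩ := hEm x hx
    exact ⟨T₁ q hq, zS₂ q hq⟩
  · intro x hx
    obtain ⟨q, hq, rfl⟩ := hEm x hx
    exact ⟨T₂ q hq, zS₁ q hq⟩
  · exact ⟨exists_between_of_two_lt_card hlt hEc, exists_between_of_two_lt_card hlt hEc⟩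

/-! ### Strong backdoor sets -/

/-- The clauses without a variable of a strong backdoor set form a nested formula. -/
theorem IsStrongNestedBackdoor.exists_order {F : CNF} {B : Finset ℕ}
    (hB : IsStrongNestedBackdoor F B) :
    ∃ lt : ℕ → ℕ → Prop, IsStrictTotalOrder ℕ lt ∧ ∀ c ∈ F, ∀ c' ∈ F, c ≠ c' →
      Disjoint c.vars B → Disjoint c'.vars B → ¬ Cross lt c.vars c'.vars := by
  obtain ⟨lt, hlt, h⟩ := hB fun _ => true
  have key : ∀ c ∈ F, Disjoint c.vars B → c ∈ F.reduce B fun _ => true := by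
    intro c hc hd
    have hv : ∀ l ∈ c, l.1 ∉ B := fun l hl =>
      Finset.disjoint_left.1 hd (Finset.mem_image_of_mem _ hl)
    refine Finset.mem_image.2 ⟨c, Finset.mem_filter.2 ⟨hc, fun l hl hlB => absurd hlB (hv l hl)⟩, ?_⟩
    exact Finset.filter_true_of_mem hv
  exact ⟨lt, hlt, fun c hc c' hc' hne hd hd' => h c (key c hc hd) c' (key c' hc' hd') hne⟩

/-- Clauses have few incidences with a set of variables that avoids a strong backdoor set. Clauses
with the same literals over the backdoor set remain in the formula together, and remain distinct,
under a suitable assignment. -/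
theorem IsStrongNestedBackdoor.sum_card_inter_le {F : CNF} (hF : F.Proper) {B : Finset ℕ}
    (hB : IsStrongNestedBackdoor F B) {J : Finset Clause} (hJ : J ⊆ F) {Q : Finset ℕ}
    (hQB : Disjoint Q B) :
    ∑ c ∈ J, (c.vars ∩ Q).card ≤ 4 ^ B.card * Q.card + 2 * J.card := by
  classical
  set β : Clause → Finset Literal := fun c => c.filter fun l => l.1 ∈ B with hβ
  set U : Finset (Finset Literal) := (B ×ˢ (Finset.univ : Finset Bool)).powerset with hU
  have hmap : ∀ c ∈ J, β c ∈ U := by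
    intro c _
    rw [hU, Finset.mem_powerset]
    intro l hl
    rw [hβ, Finset.mem_filter] at hl
    exact Finset.mem_product.2 ⟨hl.2, Finset.mem_univ _⟩
  have hUc : U.card = 4 ^ B.card := by
    rw [hU, Finset.card_powerset, Finset.card_product]
    simp only [Finset.card_univ, Fintype.card_bool]
    rw [mul_comm, pow_mul]; norm_num
  have hfib : ∀ b ∈ U, ∑ c ∈ J.filter (fun c => β c = b), (c.vars ∩ Q).card ≤
      Q.card + 2 * (J.filter fun c => β c = b).card := by
    intro b _
    set J' := J.filter fun c => β c = b with hJ'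
    obtain ⟨lt, hlt, h⟩ := hB fun x => decide ((x, true) ∉ b)
    have hred : ∀ c ∈ J', c.filter (fun l => l.1 ∉ B) ∈
        F.reduce B fun x => decide ((x, true) ∉ b) := by
      intro c hc
      rw [hJ', Finset.mem_filter] at hc
      refine Finset.mem_image.2 ⟨c, Finset.mem_filter.2 ⟨hJ hc.1, ?_⟩, rfl⟩
      rintro ⟨x, s⟩ hl hlB
      rw [← hc.2]
      cases s with
      | true =>
        have : (x, true) ∈ β c := Finset.mem_filter.2 ⟨hl, hlB⟩
        simp [this]
      | false =>
        have : (x, true) ∉ β c := fun hx => hF c (hJ hc.1) x ⟨(Finset.mem_filter.1 hx).1, hl⟩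
        simp [this]
    refine sum_card_le_of_not_cross hlt J' (fun c => c.vars ∩ Q) Q
      (fun c _ => Finset.inter_subset_right) ?_
    intro c hc d hd hne hcr
    have hsub : ∀ c : Clause, c.vars ∩ Q ⊆ Clause.vars (c.filter fun l => l.1 ∉ B) := by
      intro c x hx
      rw [Finset.mem_inter] at hx
      obtain ⟨l, hl, rfl⟩ := Finset.mem_image.1 hx.1
      exact Finset.mem_image_of_mem _ (Finset.mem_filter.2 ⟨hl, Finset.disjoint_left.1 hQB hx.2⟩)
    refine h _ (hred c hc) _ (hred d hd) ?_ (hcr.mono (hsub c) (hsub d))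
    intro he
    apply hne
    have h1 : β c = β d :=
      (Finset.mem_filter.1 hc).2.trans (Finset.mem_filter.1 hd).2.symm
    rw [← Finset.filter_union_filter_not_eq (fun l : Literal => l.1 ∈ B) c,
      ← Finset.filter_union_filter_not_eq (fun l : Literal => l.1 ∈ B) d, he]
    exact congrArg (· ∪ _) h1
  rw [← Finset.sum_fiberwise_of_maps_to hmap]
  have hcard : J.card = ∑ b ∈ U, (J.filter fun c => β c = b).card :=
    Finset.card_eq_sum_card_fiberwise hmap
  calc ∑ b ∈ U, ∑ c ∈ J.filter (fun c => β c = b), (c.vars ∩ Q).card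
      ≤ ∑ b ∈ U, (Q.card + 2 * (J.filter fun c => β c = b).card) := Finset.sum_le_sum hfib
    _ = _ := by
      rw [Finset.sum_add_distrib, Finset.sum_const, smul_eq_mul, hUc, ← Finset.mul_sum, hcard]

/-! ### Building blocks of array programs -/

/-- The value of a scalar. -/
abbrev ArrExpr.sc (a : Arr) : ArrExpr := .arr a (.const 0)

open ArrExpr

namespace ArrProg

/-- Assignment to a scalar. -/
def set (a : Arr) (e : ArrExpr) : ArrProg := .store a (.const 0) e

/-- Runs `c` if `e < e'`. -/
def whenLt (e e' : ArrExpr) (c : ArrProg) : ArrProg := .ite (.sub e' e) c .skip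

/-- Runs `c` if `e = e'`. -/
def whenEq (e e' : ArrExpr) (c : ArrProg) : ArrProg := .ite (.add (.sub e e') (.sub e' e)) .skip c

/-- Runs `c` if `e ≠ e'`. -/
def whenNe (e e' : ArrExpr) (c : ArrProg) : ArrProg := .ite (.add (.sub e e') (.sub e' e)) c .skip

/-- Runs the programs of a list, one after the other. -/
def seqs : List ArrProg → ArrProg
  | [] => .skip
  | c :: l => .seq c (seqs l)

variable (E : ArrEnv) (σ : ArrState)

theorem run_set (a : Arr) (e : ArrExpr) : (set a e).run E σ = σ.upd a 0 (e.val E σ) := rfl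

theorem run_store (a : Arr) (i e : ArrExpr) :
    (store a i e).run E σ = σ.upd a (i.val E σ) (e.val E σ) := rfl

variable {E σ}

theorem run_whenLt_pos {e e' : ArrExpr} (h : e.val E σ < e'.val E σ) (c : ArrProg) :
    (whenLt e e' c).run E σ = c.run E σ :=
  if_pos (by simp only [val]; omega)

theorem run_whenLt_neg {e e' : ArrExpr} (h : ¬ e.val E σ < e'.val E σ) (c : ArrProg) :
    (whenLt e e' c).run E σ = σ :=
  if_neg (by simp only [val]; omega)

theorem run_whenEq_pos {e e' : ArrExpr} (h : e.val E σ = e'.val E σ) (c : ArrProg) :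
    (whenEq e e' c).run E σ = c.run E σ :=
  if_neg (by simp only [val]; omega)

theorem run_whenEq_neg {e e' : ArrExpr} (h : e.val E σ ≠ e'.val E σ) (c : ArrProg) :
    (whenEq e e' c).run E σ = σ :=
  if_pos (by simp only [val]; omega)

theorem run_whenNe_pos {e e' : ArrExpr} (h : e.val E σ ≠ e'.val E σ) (c : ArrProg) :
    (whenNe e e' c).run E σ = c.run E σ :=
  if_pos (by simp only [val]; omega)

theorem run_whenNe_neg {e e' : ArrExpr} (h : e.val E σ = e'.val E σ) (c : ArrProg) :
    (whenNe e e' c).run E σ = σ :=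
  if_neg (by simp only [val]; omega)

theorem run_ite_pos {e : ArrExpr} (h : e.val E σ ≠ 0) (c c' : ArrProg) :
    (ArrProg.ite e c c').run E σ = c.run E σ :=
  if_pos h

theorem run_ite_neg {e : ArrExpr} (h : e.val E σ = 0) (c c' : ArrProg) :
    (ArrProg.ite e c c').run E σ = c'.run E σ :=
  if_neg (not_not.2 h)

variable (E σ)

theorem run_seqs_nil : (seqs []).run E σ = σ := rfl

theorem run_seqs_cons (c : ArrProg) (l : List ArrProg) :
    (seqs (c :: l)).run E σ = (seqs l).run E (c.run E σ) := rfl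

end ArrProg

open ArrProg

/-! ### Reading the formula -/

theorem drop_eq_cons {E : ArrEnv} {l : List ℕ} {p a : ℕ} (h : E.word.drop p = a :: l) :
    E.read p = a ∧ E.word.drop (p + 1) = l := by
  constructor
  · rw [ArrEnv.read, List.getD_eq_getElem?_getD, ← Nat.add_zero p, ← List.getElem?_drop, h]; rfl
  · rw [← List.drop_drop, h]; rfl

theorem drop_eq_pairs {α : Type} {E : ArrEnv} {rest : List ℕ} (f g : α → ℕ) (l : List α) {p : ℕ}
    (h : E.word.drop p = l.flatMap (fun a => [f a, g a]) ++ rest) :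
    (∀ i, ∀ hi : i < l.length, E.read (p + 2 * i) = f l[i] ∧ E.read (p + 2 * i + 1) = g l[i]) ∧
      E.word.drop (p + 2 * l.length) = rest := by
  induction l generalizing p with
  | nil => exact ⟨fun i hi => absurd hi (by simp), by simpa using h⟩
  | cons a l ih =>
    rw [List.flatMap_cons, List.append_assoc] at h
    obtain ⟨h1, h2⟩ := drop_eq_cons h
    obtain ⟨h3, h4⟩ := drop_eq_cons h2
    obtain ⟨h5, h6⟩ := ih h4
    refine ⟨fun i hi => ?_, ?_⟩
    · cases i with
      | zero => exact ⟨h1, h3⟩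
      | succ i =>
        have := h5 i (by simpa using hi)
        rw [show p + 2 * (i + 1) = p + 1 + 1 + 2 * i by omega]
        exact this
    · rw [List.length_cons, show p + 2 * (l.length + 1) = p + 1 + 1 + 2 * l.length by omega]
      exact h6

/-- The incidences stored in the state `σ` are the pairs that satisfy `R`. -/
def EdgesAre (σ : ArrState) (R : ℕ → ℕ → Prop) : Prop :=
  ∀ j x, R j x ↔ ∃ e < σ .numEdges 0, σ .edgeClause e = j ∧ σ .edgeVar e = x

/-- Reads a clause; its number is in `row`. -/
def readClause : ArrProg :=
  seqs [set .len (.inp (sc .pos)), set .pos (.add (sc .pos) (.const 1)),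
    .rep .slot (whenLt (sc .slot) (sc .len) (seqs [
      .store .edgeClause (sc .numEdges) (sc .row),
      .store .edgeVar (sc .numEdges) (.inp (sc .pos)),
      set .pos (.add (sc .pos) (.const 2)),
      set .numEdges (.add (sc .numEdges) (.const 1))]))]

theorem run_readClause (E : ArrEnv) (σ : ArrState) (lits : List Literal) (rest : List ℕ)
    (hc : lits.length ≤ E.size)
    (hd : E.word.drop (σ .pos 0) = encodeList encodeLiteral lits ++ rest)
    {R : ℕ → ℕ → Prop} (hR : EdgesAre σ R) :
    E.word.drop (readClause.run E σ .pos 0) = rest ∧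
      readClause.run E σ .numEdges 0 = σ .numEdges 0 + lits.length ∧
      EdgesAre (readClause.run E σ)
        fun j x => R j x ∨ j = σ .row 0 ∧ x ∈ lits.map Prod.fst := by
  unfold readClause
  simp only [run_seqs_cons, run_seqs_nil, run_set]
  obtain ⟨h1, h2⟩ := drop_eq_cons hd
  obtain ⟨h3, h4⟩ := drop_eq_pairs (fun l : Literal => l.1) (fun l => if l.2 then 1 else 0) lits h2
  set ρ : ArrState := (σ.upd .len 0 _).upd .pos 0 _ with hρ
  refine (?_ : _ ∧ _ ∧ _)
  have key := ArrProg.rep_induction_frame (E := E) (a := .slot) (σ := ρ)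
    (c := whenLt (sc .slot) (sc .len) (seqs [
      .store .edgeClause (sc .numEdges) (sc .row),
      .store .edgeVar (sc .numEdges) (.inp (sc .pos)),
      set .pos (.add (sc .pos) (.const 2)),
      set .numEdges (.add (sc .numEdges) (.const 1))]))
    (fun t τ => τ .pos 0 = σ .pos 0 + 1 + 2 * (lits.take t).length ∧
      τ .numEdges 0 = σ .numEdges 0 + (lits.take t).length ∧
      EdgesAre τ fun j x => R j x ∨ j = σ .row 0 ∧ x ∈ (lits.take t).map Prod.fst)
    ?_ ?_
  · rw [List.take_of_length_le hc] at key
    exact ⟨by rw [key.1]; exact h4, key.2.1, key.2.2⟩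
  · refine ⟨by simp [hρ], by simp [hρ], ?_⟩
    intro j x
    simpa [hρ] using hR j x
  · rintro t - τ hf ⟨i1, i2, i3⟩
    have hlen : τ .len 0 = lits.length := by
      rw [hf .len (by decide)]; simp [hρ, h1]
    have hrow : τ .row 0 = σ .row 0 := by
      rw [hf .row (by decide)]; simp [hρ]
    by_cases ht : t < lits.length
    · rw [run_whenLt_pos (by simpa [hlen] using ht)]
      simp only [run_seqs_cons, run_seqs_nil, run_set, run_store]
      have htk : lits.take (t + 1) = lits.take t ++ [lits[t]] := by
        rw [List.take_add_one]; simp [ht]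
      have hl : (lits.take t).length = t := by simp; omega
      rw [htk]
      refine ⟨by simp [i1]; omega, by simp [i2]; omega, ?_⟩
      intro j x
      have := i3 j x
      beta_reduce at this
      simp only [ArrState.upd_apply, reduceCtorEq, false_and, if_false, true_and, if_true, val,
        and_true, and_false]
      rw [i1, hl, (h3 t ht).1, List.map_append, List.mem_append, and_or_left, ← or_assoc, this,
        hrow]
      simp only [List.map_cons, List.map_nil, List.mem_singleton]
      constructor
      · rintro (⟨e, he, h5, h6⟩ | ⟨rfl, rfl⟩)
        · exact ⟨e, by omega, by rw [if_neg (by omega)]; exact h5,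
            by rw [if_neg (by omega)]; exact h6⟩
        · exact ⟨τ .numEdges 0, by omega, by rw [if_pos rfl], by rw [if_pos rfl]⟩
      · rintro ⟨e, he, h5, h6⟩
        by_cases hee : e = τ .numEdges 0
        · rw [if_pos hee] at h5 h6
          exact Or.inr ⟨h5.symm, h6.symm⟩
        · rw [if_neg hee] at h5 h6
          exact Or.inl ⟨e, by omega, h5, h6⟩
    · rw [run_whenLt_neg (by simpa [hlen] using ht)]
      have e : lits.take (t + 1) = lits.take t := by
        rw [List.take_of_length_le (by omega), List.take_of_length_le (by omega)]
      rw [e]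
      refine ⟨by simpa using i1, by simpa using i2, ?_⟩
      intro j x
      simpa using i3 j x

theorem length_flatMap_pair {α : Type} (f : α → List ℕ) (hf : ∀ a, (f a).length = 2)
    (l : List α) : (l.flatMap f).length = 2 * l.length := by
  induction l with
  | nil => rfl
  | cons a l ih => rw [List.flatMap_cons, List.length_append, ih, hf]; simp; omega

theorem length_flatMap_encodeList {α : Type} (f : α → List ℕ) (hf : ∀ a, (f a).length = 2)
    (ls : List (List α)) :
    (ls.flatMap (encodeList f)).length = ls.length + 2 * (ls.map List.length).sum := by
  induction ls with
  | nil => rfl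
  | cons l ls ih =>
    rw [List.flatMap_cons, List.length_append, ih]
    simp only [encodeList, List.length_cons, length_flatMap_pair f hf, List.map_cons, List.sum_cons]
    omega

/-- Reads the clauses, and stores their incidences. -/
def readFormula : ArrProg :=
  seqs [set .pos (.const 2), .rep .row (whenLt (sc .row) (.inp (.const 1)) readClause)]

theorem run_readFormula (E : ArrEnv) (σ : ArrState) (k : ℕ) (cs : List (List Literal))
    (rest : List ℕ) (hw : E.word = k :: (encodeList (encodeList encodeLiteral) cs ++ rest))
    (hN : E.word.length ≤ E.size) (h0 : σ .numEdges 0 = 0) :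
    E.word.drop (readFormula.run E σ .pos 0) = rest ∧
      readFormula.run E σ .numEdges 0 ≤ E.word.length ∧
      EdgesAre (readFormula.run E σ) fun j x => ∃ c, cs[j]? = some c ∧ x ∈ c.map Prod.fst := by
  have hwl : E.word.length = 2 + (cs.length + 2 * (cs.map List.length).sum) + rest.length := by
    rw [hw, ← length_flatMap_encodeList encodeLiteral (fun _ => rfl)]; simp [encodeList]; omega
  have hmem : ∀ c ∈ cs, c.length ≤ (cs.map List.length).sum := fun c hc =>
    List.single_le_sum (fun _ _ => Nat.zero_le _) _ (List.mem_map_of_mem hc)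
  have hn : E.read 1 = cs.length := by rw [ArrEnv.read, hw]; rfl
  unfold readFormula
  simp only [run_seqs_cons, run_seqs_nil, run_set]
  have key := ArrProg.rep_induction_frame (E := E) (a := .row) (σ := σ.upd .pos 0 2)
    (c := whenLt (sc .row) (.inp (.const 1)) readClause)
    (fun t τ => E.word.drop (τ .pos 0) = (cs.drop t).flatMap (encodeList encodeLiteral) ++ rest ∧
      τ .numEdges 0 = ((cs.take t).map List.length).sum ∧
      EdgesAre τ fun j x => j < t ∧ ∃ c, cs[j]? = some c ∧ x ∈ c.map Prod.fst)
    ?_ ?_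
  · have hle : cs.length ≤ E.size := by omega
    rw [List.drop_of_length_le hle, List.take_of_length_le hle] at key
    refine ⟨key.1, key.2.1.trans_le (by omega), ?_⟩
    intro j x
    refine Iff.trans ⟨?_, fun h => h.2⟩ (key.2.2 j x)
    rintro ⟨c, hc, hx⟩
    have := (List.getElem?_eq_some_iff.1 hc).1
    exact ⟨by omega, c, hc, hx⟩
  · refine ⟨?_, by simpa using h0, ?_⟩
    · simp [hw, encodeList]
    · intro j x
      simp [h0]
  · rintro t ht τ hf ⟨i1, i2, i3⟩
    by_cases htl : t < cs.length
    · rw [run_whenLt_pos (by simpa [hn] using htl)]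
      have hdr : cs.drop t = cs[t] :: cs.drop (t + 1) := List.drop_eq_getElem_cons htl
      have hR : EdgesAre (τ.upd .row 0 t) fun j x =>
          j < t ∧ ∃ c, cs[j]? = some c ∧ x ∈ c.map Prod.fst := by
        intro j x
        simpa using i3 j x
      have := run_readClause E (τ.upd .row 0 t) cs[t]
        ((cs.drop (t + 1)).flatMap (encodeList encodeLiteral) ++ rest)
        ((hmem _ (List.getElem_mem htl)).trans (by omega))
        (by
          rw [hdr, List.flatMap_cons, List.append_assoc] at i1
          simpa using i1) hR
      refine ⟨this.1, ?_, ?_⟩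
      · rw [this.2.1, List.take_add_one]
        simp [htl, i2]
      · intro j x
        refine Iff.trans ?_ (this.2.2 j x)
        simp only [ArrState.upd_apply, and_self, if_true]
        constructor
        · rintro ⟨hj, c, hc, hx⟩
          rcases Nat.lt_succ_iff_lt_or_eq.1 hj with hj | rfl
          · exact Or.inl ⟨hj, c, hc, hx⟩
          · rw [List.getElem?_eq_getElem htl, Option.some.injEq] at hc
            exact Or.inr ⟨rfl, hc ▸ hx⟩
        · rintro (⟨hj, c, hc, hx⟩ | ⟨rfl, hx⟩)
          · exact ⟨by omega, c, hc, hx⟩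
          · exact ⟨by omega, cs[j], List.getElem?_eq_getElem htl, hx⟩
    · rw [run_whenLt_neg (by simpa [hn] using htl)]
      have e1 : cs.drop (t + 1) = cs.drop t := by
        rw [List.drop_of_length_le (by omega), List.drop_of_length_le (by omega)]
      have e2 : cs.take (t + 1) = cs.take t := by
        rw [List.take_of_length_le (by omega), List.take_of_length_le (by omega)]
      rw [e1, e2]
      refine ⟨by simpa using i1, by simpa using i2, ?_⟩
      intro j x
      have := i3 j x
      simp only [ArrState.upd_apply, reduceCtorEq, false_and, if_false]
      rw [← this]
      constructor
      · rintro ⟨-, c, hc, hx⟩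
        have := (List.getElem?_eq_some_iff.1 hc).1
        exact ⟨by omega, c, hc, hx⟩
      · rintro ⟨hj, c, hc, hx⟩
        exact ⟨by omega, c, hc, hx⟩

/-! ### Reading the model of the grid -/

/-- Reads the number of the bags, and computes its square root. -/
def readSide : ArrProg :=
  seqs [set .numBags (.inp (sc .pos)), set .pos (.add (sc .pos) (.const 1)),
    .rep .row (seqs [set .square (.add (sc .square) (.add (.add (sc .row) (sc .row)) (.const 1))),
      whenLt (sc .square) (.add (sc .numBags) (.const 1))
        (set .side (.add (sc .row) (.const 1)))])]

theorem run_readSide (E : ArrEnv) (σ : ArrState) (r : ℕ) (rest : List ℕ)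
    (hd : E.word.drop (σ .pos 0) = r * r :: rest) (hr : r * r ≤ E.size)
    (h0 : σ .square 0 = 0) (h1 : σ .side 0 = 0) :
    E.word.drop (readSide.run E σ .pos 0) = rest ∧ readSide.run E σ .side 0 = r := by
  obtain ⟨h2, h3⟩ := drop_eq_cons hd
  unfold readSide
  simp only [run_seqs_cons, run_seqs_nil, run_set]
  set ρ : ArrState := (σ.upd .numBags 0 _).upd .pos 0 _ with hρ
  refine (?_ : _ ∧ _)
  have key := ArrProg.rep_induction_frame (E := E) (a := .row) (σ := ρ)
    (c := seqs [set .square (.add (sc .square) (.add (.add (sc .row) (sc .row)) (.const 1))),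
      whenLt (sc .square) (.add (sc .numBags) (.const 1))
        (set .side (.add (sc .row) (.const 1)))])
    (fun t τ => τ .square 0 = t * t ∧ τ .side 0 = min t r) ?_ ?_
  · refine ⟨?_, ?_⟩
    · rw [ArrProg.run_frame _ _ (by decide)]
      simpa [hρ] using h3
    · rw [key.2]
      have : r ≤ r * r := Nat.le_mul_self r
      omega
  · exact ⟨by simp [hρ, h0], by simp [hρ, h1]⟩
  · rintro t - τ hf ⟨i1, i2⟩
    have hn : τ .numBags 0 = r * r := by
      rw [hf .numBags (by decide)]; simp [hρ, h2]
    simp only [run_seqs_cons, run_seqs_nil, run_set]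
    have hsq : t * t + (t + t + 1) = (t + 1) * (t + 1) := by ring
    by_cases ht : t < r
    · rw [run_whenLt_pos]
      · rw [run_set]
        refine ⟨by simp [i1, hsq], ?_⟩
        simp
        omega
      · have : (t + 1) * (t + 1) ≤ r * r := Nat.mul_le_mul ht ht
        simp [i1, hn, hsq]
        omega
    · rw [run_whenLt_neg]
      · refine ⟨by simp [i1, hsq], ?_⟩
        simp [i2]
        omega
      · have : r * r < (t + 1) * (t + 1) := Nat.mul_self_lt_mul_self (by omega)
        simp [i1, hn, hsq]
        omega

/-- The code of a named vertex: even for variables and odd for clauses; see `IncAdj`. -/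
def vertexCode : ℕ ⊕ ℕ → ℕ
  | .inl x => 2 * x
  | .inr j => 2 * j + 1

theorem vertexCode_injective : Function.Injective vertexCode := by
  rintro (x | x) (y | y) h <;> simp only [vertexCode] at h
  · congr 1; omega
  · omega
  · omega
  · congr 1; omega

/-- Reads a bag, and stores `blockName` as the name of the block of all its vertices. -/
def readBag : ArrProg :=
  seqs [set .len (.inp (sc .pos)), set .pos (.add (sc .pos) (.const 1)),
    .rep .slot (whenLt (sc .slot) (sc .len) (seqs [
      .store .block (.add (.add (.inp (.add (sc .pos) (.const 1)))
        (.inp (.add (sc .pos) (.const 1)))) (.inp (sc .pos))) (sc .blockName),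
      set .pos (.add (sc .pos) (.const 2))]))]

theorem run_readBag (E : ArrEnv) (σ : ArrState) (bag : List (ℕ ⊕ ℕ)) (rest : List ℕ)
    (hc : bag.length ≤ E.size)
    (hd : E.word.drop (σ .pos 0) = encodeList encodeVertex bag ++ rest) :
    E.word.drop (readBag.run E σ .pos 0) = rest ∧
      ∀ u, readBag.run E σ .block u =
        if ∃ v ∈ bag, vertexCode v = u then σ .blockName 0 else σ .block u := by
  classical
  unfold readBag
  simp only [run_seqs_cons, run_seqs_nil, run_set]
  obtain ⟨h1, h2⟩ := drop_eq_cons hd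
  set f : ℕ ⊕ ℕ → ℕ := Sum.elim (fun _ => 0) (fun _ => 1) with hf
  set g : ℕ ⊕ ℕ → ℕ := Sum.elim id id with hg
  have hfg : encodeVertex = fun v => [f v, g v] := by
    funext v; rcases v with x | j <;> rfl
  rw [hfg] at h2
  obtain ⟨h3, h4⟩ := drop_eq_pairs f g bag h2
  have hcode : ∀ v, g v + g v + f v = vertexCode v := by
    rintro (x | j) <;> simp [hf, hg, vertexCode] <;> omega
  set ρ : ArrState := (σ.upd .len 0 _).upd .pos 0 _ with hρ
  refine (?_ : _ ∧ _)
  have key := ArrProg.rep_induction_frame (E := E) (a := .slot) (σ := ρ)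
    (c := whenLt (sc .slot) (sc .len) (seqs [
      .store .block (.add (.add (.inp (.add (sc .pos) (.const 1)))
        (.inp (.add (sc .pos) (.const 1)))) (.inp (sc .pos))) (sc .blockName),
      set .pos (.add (sc .pos) (.const 2))]))
    (fun t τ => τ .pos 0 = σ .pos 0 + 1 + 2 * (bag.take t).length ∧
      ∀ u, τ .block u =
        if ∃ v ∈ bag.take t, vertexCode v = u then σ .blockName 0 else σ .block u) ?_ ?_
  · rw [List.take_of_length_le hc] at key
    exact ⟨by rw [key.1]; exact h4, key.2⟩
  · refine ⟨by simp [hρ], fun u => by simp [hρ]⟩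
  · rintro t - τ hf' ⟨i1, i2⟩
    have hlen : τ .len 0 = bag.length := by
      rw [hf' .len (by decide)]; simp [hρ, h1]
    have hbl : τ .blockName 0 = σ .blockName 0 := by
      rw [hf' .blockName (by decide)]; simp [hρ]
    by_cases ht : t < bag.length
    · rw [run_whenLt_pos (by simpa [hlen] using ht)]
      simp only [run_seqs_cons, run_seqs_nil, run_set, run_store]
      have htk : bag.take (t + 1) = bag.take t ++ [bag[t]] := by
        rw [List.take_add_one]; simp [ht]
      have hl : (bag.take t).length = t := by simp; omega
      rw [htk]
      refine ⟨by simp [i1]; omega, fun u => ?_⟩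
      have := i2 u
      simp only [ArrState.upd_apply, reduceCtorEq, false_and, if_false, true_and, val, and_false]
      rw [i1, hl, (h3 t ht).1, (h3 t ht).2, hcode, hbl, this]
      by_cases hu : u = vertexCode bag[t]
      · rw [if_pos hu, if_pos ⟨bag[t], List.mem_append_right _ (List.mem_singleton.2 rfl), hu.symm⟩]
      · rw [if_neg hu]
        congr 1
        simp only [List.mem_append, List.mem_singleton, eq_iff_iff]
        constructor
        · rintro ⟨v, hv, h⟩; exact ⟨v, Or.inl hv, h⟩
        · rintro ⟨v, hv | rfl, h⟩
          · exact ⟨v, hv, h⟩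
          · exact absurd h.symm hu
    · rw [run_whenLt_neg (by simpa [hlen] using ht)]
      have e : bag.take (t + 1) = bag.take t := by
        rw [List.take_of_length_le (by omega), List.take_of_length_le (by omega)]
      rw [e]
      exact ⟨by simpa using i1, fun u => by simpa using i2 u⟩

/-- The name of the block of the bag at position `(i, j)` of the `r`-grid: one plus the number of
its first bag. The name is `0` if the `4 × 4` block sticks out of the grid. -/
def blockLabel (r i j : ℕ) : ℕ :=
  if i - i % 4 + 3 < r ∧ j - j % 4 + 3 < r then (i - i % 4) * r + (j - j % 4) + 1 else 0

/-- The blocks of the vertices in the first `b` bags are stored. -/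
def BlocksAre (σ : ArrState) (r : ℕ) (bags : List (List (ℕ ⊕ ℕ))) (b : ℕ) : Prop :=
  (∀ m < b, ∀ l, bags[m]? = some l → ∀ v ∈ l,
    σ .block (vertexCode v) = blockLabel r (m / r) (m % r)) ∧
  ∀ u, σ .block u ≠ 0 → ∃ m < b, ∃ l, bags[m]? = some l ∧ ∃ v ∈ l, vertexCode v = u

/-- Reads the next bag, which is at position `(row, col)`. -/
def readNextBag : ArrProg :=
  seqs [set .blockName (.const 0),
    whenLt (.add (.sub (sc .row) (sc .rowRem)) (.const 3)) (sc .side)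
      (whenLt (.add (.sub (sc .col) (sc .colRem)) (.const 3)) (sc .side)
        (set .blockName (.add (.add (sc .rowBase) (.sub (sc .col) (sc .colRem))) (.const 1)))),
    readBag,
    set .bagNum (.add (sc .bagNum) (.const 1)),
    set .colRem (.add (sc .colRem) (.const 1)),
    whenEq (sc .colRem) (.const 4) (set .colRem (.const 0))]

theorem run_readNextBag (E : ArrEnv) (σ : ArrState) {r : ℕ} {bags : List (List (ℕ ⊕ ℕ))} {i j : ℕ}
    (hN : ∀ l ∈ bags, l.length ≤ E.size) (hlen : bags.length = r * r) (hi : i < r) (hj : j < r)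
    (hdisj : ∀ (m m' : ℕ) l l' v, bags[m]? = some l → bags[m']? = some l' → v ∈ l → v ∈ l' → m = m')
    (hd : E.word.drop (σ .pos 0) = (bags.drop (i * r + j)).flatMap (encodeList encodeVertex))
    (hB : BlocksAre σ r bags (i * r + j)) (hrow : σ .row 0 = i) (hcol : σ .col 0 = j)
    (hrr : σ .rowRem 0 = i % 4) (hcr : σ .colRem 0 = j % 4) (hside : σ .side 0 = r)
    (hbase : σ .rowBase 0 = (i - i % 4) * r) (hnum : σ .bagNum 0 = i * r + j) :
    E.word.drop (readNextBag.run E σ .pos 0) =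
        (bags.drop (i * r + j + 1)).flatMap (encodeList encodeVertex) ∧
      BlocksAre (readNextBag.run E σ) r bags (i * r + j + 1) ∧
      readNextBag.run E σ .colRem 0 = (j + 1) % 4 ∧
      readNextBag.run E σ .bagNum 0 = i * r + j + 1 := by
  have hm : i * r + j < bags.length := by
    rw [hlen]; calc i * r + j < i * r + r := by omega
      _ = (i + 1) * r := by ring
      _ ≤ r * r := Nat.mul_le_mul_right _ hi
  set m := i * r + j with hmdef
  have hdiv : m / r = i := by
    rw [hmdef, Nat.add_comm, Nat.add_mul_div_right _ _ (by omega), Nat.div_eq_of_lt hj, zero_add]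
  have hmod : m % r = j := by
    rw [hmdef, Nat.add_comm, Nat.add_mul_mod_self_right, Nat.mod_eq_of_lt hj]
  unfold readNextBag
  simp only [run_seqs_cons, run_seqs_nil, run_set]
  -- The state before the bag is read.
  obtain ⟨ρ, hρ, hname, hρo⟩ : ∃ ρ : ArrState, (whenLt (.add (.sub (sc .row) (sc .rowRem)) (.const 3))
      (sc .side) (whenLt (.add (.sub (sc .col) (sc .colRem)) (.const 3)) (sc .side)
        (set .blockName (.add (.add (sc .rowBase) (.sub (sc .col) (sc .colRem)))
          (.const 1))))).run E (σ.upd .blockName 0 ((ArrExpr.const 0).val E σ)) = ρ ∧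
      ρ .blockName 0 = blockLabel r i j ∧ ∀ a, a ≠ .blockName → ρ a = σ a := by
    refine ⟨_, rfl, ?_, ?_⟩
    · unfold blockLabel
      by_cases h1 : i - i % 4 + 3 < r
      · rw [run_whenLt_pos (by simpa [hrow, hrr, hside] using h1)]
        by_cases h2 : j - j % 4 + 3 < r
        · rw [run_whenLt_pos (by simpa [hcol, hcr, hside] using h2), if_pos ⟨h1, h2⟩]
          simp [run_set, hbase, hcol, hcr]
        · rw [run_whenLt_neg (by simpa [hcol, hcr, hside] using h2), if_neg (fun h => h2 h.2)]
          simp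
      · rw [run_whenLt_neg (by simpa [hrow, hrr, hside] using h1), if_neg (fun h => h1 h.1)]
        simp
    · intro a ha
      rw [ArrProg.run_frame _ _ (by simpa [whenLt, ArrProg.set, mods] using ha), ArrState.upd_of_ne _ ha]
  rw [hρ]
  have hdr : bags.drop m = bags[m] :: bags.drop (m + 1) := List.drop_eq_getElem_cons hm
  obtain ⟨b1, b2⟩ := run_readBag E ρ bags[m] ((bags.drop (m + 1)).flatMap (encodeList encodeVertex))
    (hN _ (List.getElem_mem hm)) (by
      rw [hρo .pos (by decide), hd, hdr, List.flatMap_cons])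
  set τ := readBag.run E ρ with hτ
  have hτf : ∀ a, a ∉ readBag.mods → a ≠ .blockName → τ a = σ a := fun a h h' => by
    rw [hτ, ArrProg.run_frame _ _ h, hρo a h']
  have hcr' : τ .colRem 0 = j % 4 := by rw [hτf _ (by decide) (by decide), hcr]
  have hnum' : τ .bagNum 0 = m := by rw [hτf _ (by decide) (by decide), hnum]
  have hblock : ∀ u, τ .block u =
      if ∃ v ∈ bags[m], vertexCode v = u then blockLabel r i j else σ .block u := by
    intro u; rw [b2, hname, hρo .block (by decide)]
  have hBl : BlocksAre τ r bags (m + 1) := by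
    refine ⟨fun m' hm' l hl v hv => ?_, fun u hu => ?_⟩
    · rw [hblock]
      rcases Nat.lt_succ_iff_lt_or_eq.1 hm' with hm'' | rfl
      · rw [if_neg, hB.1 m' hm'' l hl v hv]
        rintro ⟨v', hv', he⟩
        have := hdisj m' m l _ v hl (List.getElem?_eq_getElem hm) hv
          (by rw [← vertexCode_injective he]; exact hv')
        omega
      · rw [List.getElem?_eq_getElem hm, Option.some.injEq] at hl
        rw [if_pos ⟨v, hl ▸ hv, rfl⟩, hdiv, hmod]
    · rw [hblock] at hu
      by_cases h : ∃ v ∈ bags[m], vertexCode v = u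
      · exact ⟨m, by omega, bags[m], List.getElem?_eq_getElem hm, h⟩
      · rw [if_neg h] at hu
        obtain ⟨m', hm', h'⟩ := hB.2 u hu
        exact ⟨m', by omega, h'⟩
  have fin : ∀ τ' : ArrState, τ' .pos = τ .pos → τ' .block = τ .block →
      τ' .colRem 0 = (j + 1) % 4 → τ' .bagNum 0 = m + 1 →
      E.word.drop (τ' .pos 0) = (bags.drop (m + 1)).flatMap (encodeList encodeVertex) ∧
      BlocksAre τ' r bags (m + 1) ∧ τ' .colRem 0 = (j + 1) % 4 ∧ τ' .bagNum 0 = m + 1 := by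
    intro τ' e1 e2 e3 e4
    refine ⟨by rw [e1]; exact b1, ?_, e3, e4⟩
    unfold BlocksAre
    rw [e2]; exact hBl
  by_cases h4 : j % 4 + 1 = 4
  · rw [run_whenEq_pos (by simpa [hcr'] using h4), run_set]
    apply fin
    · exact (ArrState.upd_of_ne _ (by decide) _ _).trans
        ((ArrState.upd_of_ne _ (by decide) _ _).trans (ArrState.upd_of_ne _ (by decide) _ _))
    · exact (ArrState.upd_of_ne _ (by decide) _ _).trans
        ((ArrState.upd_of_ne _ (by decide) _ _).trans (ArrState.upd_of_ne _ (by decide) _ _))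
    · simp; omega
    · simp [hnum']
  · rw [run_whenEq_neg (by simpa [hcr'] using h4)]
    apply fin
    · exact (ArrState.upd_of_ne _ (by decide) _ _).trans (ArrState.upd_of_ne _ (by decide) _ _)
    · exact (ArrState.upd_of_ne _ (by decide) _ _).trans (ArrState.upd_of_ne _ (by decide) _ _)
    · simp [hcr']; omega
    · simp [hnum']

/-- Reads all bags. -/
def readBags : ArrProg :=
  .rep .row (whenLt (sc .row) (sc .side) (seqs [
    whenEq (sc .rowRem) (.const 0) (set .rowBase (sc .bagNum)),
    set .colRem (.const 0),
    .rep .col (whenLt (sc .col) (sc .side) readNextBag),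
    set .rowRem (.add (sc .rowRem) (.const 1)),
    whenEq (sc .rowRem) (.const 4) (set .rowRem (.const 0))]))

theorem BlocksAre.congr {σ τ : ArrState} {r : ℕ} {bags : List (List (ℕ ⊕ ℕ))} {b : ℕ}
    (h : BlocksAre σ r bags b) (e : τ .block = σ .block) : BlocksAre τ r bags b := by
  unfold BlocksAre; rw [e]; exact h

theorem run_readBags (E : ArrEnv) (σ : ArrState) {r : ℕ} {bags : List (List (ℕ ⊕ ℕ))}
    (hN : ∀ l ∈ bags, l.length ≤ E.size) (hlen : bags.length = r * r) (hr : r ≤ E.size)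
    (hdisj : ∀ (m m' : ℕ) l l' v, bags[m]? = some l → bags[m']? = some l' → v ∈ l → v ∈ l' → m = m')
    (hd : E.word.drop (σ .pos 0) = bags.flatMap (encodeList encodeVertex))
    (hblock : ∀ u, σ .block u = 0) (hrr : σ .rowRem 0 = 0) (hside : σ .side 0 = r)
    (hnum : σ .bagNum 0 = 0) : BlocksAre (readBags.run E σ) r bags (r * r) := by
  have key := ArrProg.rep_induction_frame (E := E) (a := .row) (σ := σ)
    (c := whenLt (sc .row) (sc .side) (seqs [
      whenEq (sc .rowRem) (.const 0) (set .rowBase (sc .bagNum)),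
      set .colRem (.const 0),
      .rep .col (whenLt (sc .col) (sc .side) readNextBag),
      set .rowRem (.add (sc .rowRem) (.const 1)),
      whenEq (sc .rowRem) (.const 4) (set .rowRem (.const 0))]))
    (fun t τ => E.word.drop (τ .pos 0) =
        (bags.drop (min t r * r)).flatMap (encodeList encodeVertex) ∧
      BlocksAre τ r bags (min t r * r) ∧ τ .rowRem 0 = min t r % 4 ∧
      (min t r % 4 ≠ 0 → τ .rowBase 0 = (min t r - min t r % 4) * r) ∧
      τ .bagNum 0 = min t r * r) ?_ ?_
  · rw [min_eq_right hr] at key; exact key.2.1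
  · refine ⟨by simpa using hd, ⟨fun m hm => by simp at hm, fun u hu => absurd (hblock u) hu⟩,
      by simpa using hrr, by simp, by simpa using hnum⟩
  · rintro i - τ hf ⟨i1, i2, i3, i4, i5⟩
    have hside' : τ .side 0 = r := by rw [hf .side (by decide), hside]
    by_cases hi : i < r
    swap
    · rw [run_whenLt_neg (by simpa [hside'] using hi)]
      rw [min_eq_right (by omega)] at i1 i2 i3 i4 i5
      rw [min_eq_right (by omega)]
      exact ⟨by simpa using i1, i2.congr (ArrState.upd_of_ne _ (by decide) _ _), by simpa using i3,
        by simpa using i4, by simpa using i5⟩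
    rw [run_whenLt_pos (by simpa [hside'] using hi)]
    rw [min_eq_left (by omega)] at i1 i2 i3 i4 i5
    rw [min_eq_left (by omega)]
    simp only [run_seqs_cons, run_seqs_nil, run_set]
    obtain ⟨ρ, hρ, hbase, hρo⟩ : ∃ ρ : ArrState, (whenEq (sc .rowRem) (.const 0)
        (set .rowBase (sc .bagNum))).run E (τ.upd .row 0 i) = ρ ∧
        ρ .rowBase 0 = (i - i % 4) * r ∧ ∀ a, a ≠ .rowBase → ρ a = τ.upd .row 0 i a := by
      refine ⟨_, rfl, ?_, ?_⟩
      · by_cases h : i % 4 = 0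
        · rw [run_whenEq_pos (by simpa [i3] using h)]
          simp [run_set, i5, h]
        · rw [run_whenEq_neg (by simpa [i3] using h)]
          simpa using i4 h
      · intro a ha
        rw [ArrProg.run_frame _ _ (by simpa [whenEq, ArrProg.set, mods] using ha)]
    rw [hρ]
    set ρ' := ρ.upd .colRem 0 ((ArrExpr.const 0).val E ρ) with hρ'
    have hρo' : ∀ a, a ≠ .rowBase → a ≠ .colRem → a ≠ .row → ρ' a = τ a := fun a h1 h2 h3 => by
      rw [hρ', ArrState.upd_of_ne _ h2, hρo a h1, ArrState.upd_of_ne _ h3]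
    have keyc := ArrProg.rep_induction_frame (E := E) (a := .col) (σ := ρ')
      (c := whenLt (sc .col) (sc .side) readNextBag)
      (fun t τ => E.word.drop (τ .pos 0) =
          (bags.drop (i * r + min t r)).flatMap (encodeList encodeVertex) ∧
        BlocksAre τ r bags (i * r + min t r) ∧ τ .colRem 0 = min t r % 4 ∧
        τ .bagNum 0 = i * r + min t r) ?_ ?_
    · rw [min_eq_right hr, show i * r + r = (i + 1) * r by ring] at keyc
      set κ := (ArrProg.rep .col (whenLt (sc .col) (sc .side) readNextBag)).run E ρ' with hκ
      have hκf : ∀ a, a ∉ (ArrProg.rep .col (whenLt (sc .col) (sc .side) readNextBag)).mods →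
          κ a = ρ' a := fun a h => ArrProg.run_frame _ _ h
      have hrem : κ .rowRem 0 = i % 4 := by
        rw [hκf _ (by decide), hρo' _ (by decide) (by decide) (by decide), i3]
      have hbs : κ .rowBase 0 = (i - i % 4) * r := by
        rw [hκf _ (by decide), hρ']; simpa using hbase
      by_cases h4 : i % 4 + 1 = 4
      · rw [run_whenEq_pos (by simpa [hrem] using h4), run_set]
        refine ⟨by simpa using keyc.1, keyc.2.1.congr ?_, by simp; omega,
          fun h => absurd (by omega : (i + 1) % 4 = 0) h, by simpa using keyc.2.2.2⟩
        exact (ArrState.upd_of_ne _ (by decide) _ _).trans (ArrState.upd_of_ne _ (by decide) _ _)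
      · rw [run_whenEq_neg (by simpa [hrem] using h4)]
        refine ⟨by simpa using keyc.1, keyc.2.1.congr ?_, by simp [hrem]; omega,
          fun h => ?_, by simpa using keyc.2.2.2⟩
        · exact ArrState.upd_of_ne _ (by decide) _ _
        · have : i + 1 - (i + 1) % 4 = i - i % 4 := by omega
          rw [this]; simpa using hbs
    · refine ⟨?_, ?_, by simp [hρ'], ?_⟩
      · rw [hρo' _ (by decide) (by decide) (by decide)]; simpa using i1
      · refine BlocksAre.congr ?_ (hρo' _ (by decide) (by decide) (by decide))
        simpa using i2
      · rw [hρo' _ (by decide) (by decide) (by decide)]; simpa using i5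
    · rintro j - κ hκ ⟨j1, j2, j3, j4⟩
      have hs : κ .side 0 = r := by
        rw [hκ _ (by decide), hρo' _ (by decide) (by decide) (by decide), hside']
      by_cases hj : j < r
      · rw [run_whenLt_pos (by simpa [hs] using hj)]
        rw [min_eq_left (by omega)] at j1 j2 j3 j4
        rw [min_eq_left (by omega)]
        refine run_readNextBag E (κ.upd .col 0 j) hN hlen hi hj hdisj (by simpa using j1)
          (j2.congr (ArrState.upd_of_ne _ (by decide) _ _)) ?_ (by simp) ?_ (by simpa using j3)
          (by simpa using hs) ?_ (by simpa using j4)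
        · rw [ArrState.upd_of_ne _ (by decide), hκ _ (by decide), hρ',
            ArrState.upd_of_ne _ (by decide), hρo _ (by decide)]
          simp
        · rw [ArrState.upd_of_ne _ (by decide), hκ _ (by decide),
            hρo' _ (by decide) (by decide) (by decide), i3]
        · rw [ArrState.upd_of_ne _ (by decide), hκ _ (by decide), hρ']
          simpa using hbase
      · rw [run_whenLt_neg (by simpa [hs] using hj)]
        rw [min_eq_right (by omega)] at j1 j2 j3 j4
        rw [min_eq_right (by omega)]
        exact ⟨by simpa using j1, j2.congr (ArrState.upd_of_ne _ (by decide) _ _),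
          by simpa using j3, by simpa using j4⟩

/-! ### Forests in the incidence graph, and their division into pieces -/

/-- A forest in the incidence graph of the sets `H j`: the vertex number `i < n` has the code
`node i`, and its parent has the number `parent i`. The roots are their own parents. -/
structure Forest (H : ℕ → Finset ℕ) where
  n : ℕ
  node : ℕ → ℕ
  parent : ℕ → ℕ
  inj : ∀ i < n, ∀ j < n, node i = node j → i = j
  parent_le : ∀ i < n, parent i ≤ i
  adj : ∀ i < n, parent i ≠ i → IncAdj H (node i) (node (parent i))

/-- The set with the code `u`; it is empty if `u` is the code of a variable. -/
def clauseAt (H : ℕ → Finset ℕ) (u : ℕ) : Finset ℕ := if u % 2 = 1 then H (u / 2) else ∅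

theorem clauseAt_clause (H : ℕ → Finset ℕ) (j : ℕ) : clauseAt H (2 * j + 1) = H j := by
  unfold clauseAt
  rw [if_pos (by omega), show (2 * j + 1) / 2 = j by omega]

theorem exists_of_mem_clauseAt {H : ℕ → Finset ℕ} {u x : ℕ} (h : x ∈ clauseAt H u) :
    ∃ j, u = 2 * j + 1 ∧ x ∈ H j := by
  unfold clauseAt at h
  split_ifs at h with h1
  · exact ⟨u / 2, by omega, h⟩
  · exact absurd h (Finset.notMem_empty _)

namespace Forest

variable {H : ℕ → Finset ℕ} (T : Forest H)

/-- The codes of the vertices in the piece with label `l`. -/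
def part (piece : ℕ → ℕ) (l : ℕ) : Set ℕ := {u | ∃ i < T.n, piece i = l ∧ T.node i = u}

/-- The vertex number `i` is the top of its piece. -/
def IsTop (piece : ℕ → ℕ) (i : ℕ) : Prop := T.parent i = i ∨ piece (T.parent i) ≠ piece i

/-- The labelling `piece` of the vertices by natural numbers divides the forest into connected
pieces: every piece has only one top. Vertices with the label `0` are in no piece. -/
def Divides (piece : ℕ → ℕ) : Prop :=
  ∀ i < T.n, ∀ j < T.n, piece i ≠ 0 → piece i = piece j → T.IsTop piece i → T.IsTop piece j → i = j

/-- The labels of the pieces. -/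
def labels (piece : ℕ → ℕ) : Finset ℕ := ((Finset.range T.n).image piece).erase 0

theorem mem_labels {piece : ℕ → ℕ} {l : ℕ} :
    l ∈ T.labels piece ↔ l ≠ 0 ∧ ∃ i < T.n, piece i = l := by
  simp [labels]

theorem exists_top (piece : ℕ → ℕ) {i : ℕ} (hi : i < T.n) :
    ∃ t < T.n, piece t = piece i ∧ T.IsTop piece t ∧
      LinkedIn H (T.part piece (piece i)) (T.node i) (T.node t) := by
  induction i using Nat.strong_induction_on with
  | _ i ih =>
    by_cases h : T.IsTop piece i
    · exact ⟨i, hi, rfl, h, .refl⟩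
    · unfold IsTop at h
      push Not at h
      have hlt : T.parent i < i := lt_of_le_of_ne (T.parent_le i hi) h.1
      obtain ⟨t, ht, h1, h2, h3⟩ := ih _ hlt (hlt.trans hi)
      rw [h.2] at h1 h3
      exact ⟨t, ht, h1, h2, Relation.ReflTransGen.head
        ⟨⟨i, hi, rfl, rfl⟩, ⟨_, hlt.trans hi, h.2, rfl⟩, T.adj i hi h.1⟩ h3⟩

variable {T}

theorem Divides.joined {piece : ℕ → ℕ} (h : T.Divides piece) {l : ℕ} (hl : l ≠ 0) :
    Joined H (T.part piece l) := by
  rintro _ ⟨i, hi, rfl, rfl⟩ _ ⟨j, hj, hij, rfl⟩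
  obtain ⟨t, ht, h1, h2, h3⟩ := T.exists_top piece hi
  obtain ⟨t', ht', h1', h2', h3'⟩ := T.exists_top piece hj
  obtain rfl := h t ht t' ht' (h1 ▸ hl) (by rw [h1, h1', hij]) h2 h2'
  rw [hij] at h3'
  exact h3.trans h3'.symm

theorem part_disjoint (piece : ℕ → ℕ) {l l' : ℕ} (h : l ≠ l') :
    Disjoint (T.part piece l) (T.part piece l') := by
  rw [Set.disjoint_left]
  rintro _ ⟨i, hi, rfl, rfl⟩ ⟨j, hj, rfl, hij⟩
  exact h (by rw [T.inj j hj i hi hij])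

theorem mem_labels_of_touches {piece : ℕ → ℕ} {l x : ℕ} (hl : l ≠ 0)
    (h : Touches H (T.part piece l) x) : l ∈ T.labels piece := by
  obtain ⟨j, ⟨i, hi, h1, -⟩, -⟩ := h
  exact T.mem_labels.2 ⟨hl, i, hi, h1⟩

end Forest

/-! ### Refinement of a division -/

/-- The result of a refinement of the division `piece` of the forest `T`, with respect to a set `Q`
of variables. The vertices with numbers at least `w` have been processed, in descending order.
Every vertex `v` has collected a set `O v` of at most three variables of `Q` from the clauses in the
subtree of its piece below `v`. A vertex that is processed when it has three variables is closed,
and the closed vertices are numbered from `1` to `m`. Other vertices pass their variables on to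
their parents; those for which the parent had use are linked to it. -/
structure Refinement {H : ℕ → Finset ℕ} (T : Forest H) (piece : ℕ → ℕ) (Q : Finset ℕ)
    (O : ℕ → Finset ℕ) (link : ℕ → Prop) (closed : ℕ → ℕ) (m w : ℕ) : Prop where
  card_le : ∀ v, (O v).card ≤ 3
  subset : ∀ v, O v ⊆ Q
  closed_iff : ∀ v, w ≤ v → v < T.n → piece v ≠ 0 → (closed v ≠ 0 ↔ (O v).card = 3)
  closed_spec : ∀ v, closed v ≠ 0 → w ≤ v ∧ v < T.n ∧ piece v ≠ 0 ∧ closed v ≤ m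
  closed_inj : ∀ u v, closed u ≠ 0 → closed u = closed v → u = v
  closed_surj : ∀ c, c ≠ 0 → c ≤ m → ∃ v, closed v = c
  link_spec : ∀ v, link v → w ≤ v ∧ v < T.n ∧ T.parent v ≠ v ∧ piece v ≠ 0 ∧
    piece (T.parent v) = piece v ∧ closed v = 0
  clause : ∀ v, w ≤ v → v < T.n → piece v ≠ 0 → closed v = 0 → clauseAt H (T.node v) ∩ Q ⊆ O v
  up : ∀ v, w ≤ v → v < T.n → piece v ≠ 0 → closed v = 0 → T.parent v ≠ v →
    piece (T.parent v) = piece v → O v ⊆ O (T.parent v) ∨ (O (T.parent v)).card = 3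
  card_link : ∀ p, ∃ s : Finset ℕ, (∀ v, link v → T.parent v = p → v ∈ s) ∧ s.card ≤ (O p).card
  source : ∀ v, ∀ x ∈ O v, ∃ i < T.n, x ∈ clauseAt H (T.node i) ∧
    Relation.ReflTransGen (fun a b => link a ∧ T.parent a = b) i v

namespace Refinement

variable {H : ℕ → Finset ℕ} {T : Forest H} {piece : ℕ → ℕ} {Q : Finset ℕ} {O : ℕ → Finset ℕ}
  {link : ℕ → Prop} {closed : ℕ → ℕ} {m w : ℕ}

theorem init (T : Forest H) (piece : ℕ → ℕ) (Q : Finset ℕ) :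
    Refinement T piece Q (fun _ => ∅) (fun _ => False) (fun _ => 0) 0 T.n where
  card_le _ := by simp
  subset _ := Finset.empty_subset _
  closed_iff v h h' := absurd h' (by omega)
  closed_spec v h := absurd rfl h
  closed_inj u v h := absurd rfl h
  closed_surj c h h' := absurd h' (by omega)
  link_spec v h := h.elim
  clause v h h' := absurd h' (by omega)
  up v h h' := absurd h' (by omega)
  card_link p := ⟨∅, fun v h => h.elim, by simp⟩
  source v x h := absurd h (Finset.notMem_empty _)

/-- A vertex that is not processed yet collects a variable of its own clause. -/
theorem insert (h : Refinement T piece Q O link closed m w) {v x : ℕ} (hv : v < w) (hvn : v < T.n)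
    (hx : x ∈ clauseAt H (T.node v)) (hxQ : x ∈ Q) (hc : (O v).card < 3) :
    Refinement T piece Q (Function.update O v (insert x (O v))) link closed m w := by
  have sub : ∀ u, O u ⊆ Function.update O v (Insert.insert x (O v)) u := by
    intro u
    by_cases hu : u = v
    · subst hu; rw [Function.update_self]; exact Finset.subset_insert _ _
    · rw [Function.update_of_ne hu]
  have same : ∀ u, w ≤ u → Function.update O v (Insert.insert x (O v)) u = O u := fun u hu =>
    Function.update_of_ne (by omega) _ _
  refine ⟨fun u => ?_, fun u => ?_, fun u h1 h2 h3 => ?_, h.closed_spec, h.closed_inj,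
    h.closed_surj, h.link_spec, fun u h1 h2 h3 h4 => ?_, fun u h1 h2 h3 h4 h5 h6 => ?_,
    fun p => ?_, fun u y hy => ?_⟩
  · by_cases hu : u = v
    · subst hu; rw [Function.update_self]; exact (Finset.card_insert_le _ _).trans (by omega)
    · rw [Function.update_of_ne hu]; exact h.card_le u
  · by_cases hu : u = v
    · subst hu; rw [Function.update_self]
      exact Finset.insert_subset hxQ (h.subset u)
    · rw [Function.update_of_ne hu]; exact h.subset u
  · rw [same u h1]; exact h.closed_iff u h1 h2 h3
  · rw [same u h1]; exact h.clause u h1 h2 h3 h4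
  · rw [same u h1]
    rcases h.up u h1 h2 h3 h4 h5 h6 with h7 | h7
    · exact Or.inl (h7.trans (sub _))
    · by_cases hu : T.parent u = v
      · rw [hu] at h7; omega
      · rw [Function.update_of_ne hu]; exact Or.inr h7
  · obtain ⟨s, h1, h2⟩ := h.card_link p
    exact ⟨s, h1, h2.trans (Finset.card_le_card (sub p))⟩
  · by_cases hu : u = v
    · subst hu
      rw [Function.update_self, Finset.mem_insert] at hy
      rcases hy with rfl | hy
      · exact ⟨u, hvn, hx, .refl⟩
      · exact h.source u y hy
    · rw [Function.update_of_ne hu] at hy; exact h.source u y hy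

/-- A vertex outside all pieces is skipped. -/
theorem skip (h : Refinement T piece Q O link closed m (w + 1)) (hw : piece w = 0) :
    Refinement T piece Q O link closed m w where
  card_le := h.card_le
  subset := h.subset
  closed_iff v h1 h2 h3 := h.closed_iff v (by
    rcases Nat.eq_or_lt_of_le h1 with rfl | h1
    · exact absurd hw h3
    · exact h1) h2 h3
  closed_spec v h1 := by obtain ⟨h2, h3⟩ := h.closed_spec v h1; exact ⟨by omega, h3⟩
  closed_inj := h.closed_inj
  closed_surj := h.closed_surj
  link_spec v h1 := by obtain ⟨h2, h3⟩ := h.link_spec v h1; exact ⟨by omega, h3⟩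
  clause v h1 h2 h3 h4 := h.clause v (by
    rcases Nat.eq_or_lt_of_le h1 with rfl | h1
    · exact absurd hw h3
    · exact h1) h2 h3 h4
  up v h1 h2 h3 h4 h5 h6 := h.up v (by
    rcases Nat.eq_or_lt_of_le h1 with rfl | h1
    · exact absurd hw h3
    · exact h1) h2 h3 h4 h5 h6
  card_link := h.card_link
  source := h.source

/-- A vertex with three variables is closed. -/
theorem close (h : Refinement T piece Q O link closed m (w + 1)) (hwn : w < T.n)
    (hw : piece w ≠ 0) (hc : (O w).card = 3) :
    Refinement T piece Q O link (Function.update closed w (m + 1)) (m + 1) w := by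
  have old : ∀ v, w + 1 ≤ v → Function.update closed w (m + 1) v = closed v := fun v hv =>
    Function.update_of_ne (by omega) _ _
  have hcw : closed w = 0 := by
    by_contra hne
    have := (h.closed_spec w hne).1
    omega
  refine ⟨h.card_le, h.subset, fun v h1 h2 h3 => ?_, fun v h1 => ?_, fun u v h1 h2 => ?_,
    fun c h1 h2 => ?_, fun v h1 => ?_, fun v h1 h2 h3 h4 => ?_, fun v h1 h2 h3 h4 h5 h6 => ?_,
    h.card_link, h.source⟩
  · rcases Nat.eq_or_lt_of_le h1 with rfl | h1
    · simp [hc]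
    · rw [old v h1]; exact h.closed_iff v h1 h2 h3
  · by_cases hv : v = w
    · subst hv; exact ⟨le_rfl, hwn, hw, by simp⟩
    · rw [Function.update_of_ne hv] at h1 ⊢
      obtain ⟨h2, h3, h4, h5⟩ := h.closed_spec v h1
      exact ⟨by omega, h3, h4, by omega⟩
  · by_cases hu : u = w
    · by_cases hv : v = w
      · rw [hu, hv]
      · rw [hu, Function.update_self, Function.update_of_ne hv] at h2
        have := (h.closed_spec v (by omega)).2.2.2
        omega
    · rw [Function.update_of_ne hu] at h1 h2
      by_cases hv : v = w
      · rw [hv, Function.update_self] at h2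
        have := (h.closed_spec u h1).2.2.2
        omega
      · rw [Function.update_of_ne hv] at h2
        exact h.closed_inj u v h1 h2
  · rcases Nat.lt_or_eq_of_le h2 with h2 | rfl
    · obtain ⟨v, hv⟩ := h.closed_surj c h1 (by omega)
      exact ⟨v, by rw [Function.update_of_ne (by rintro rfl; omega), hv]⟩
    · exact ⟨w, Function.update_self _ _ _⟩
  · obtain ⟨h2, h3⟩ := h.link_spec v h1
    rw [old v h2]
    exact ⟨by omega, h3⟩
  · rcases Nat.eq_or_lt_of_le h1 with rfl | h1
    · rw [Function.update_self] at h4; omega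
    · rw [old v h1] at h4; exact h.clause v h1 h2 h3 h4
  · rcases Nat.eq_or_lt_of_le h1 with rfl | h1
    · rw [Function.update_self] at h4; omega
    · rw [old v h1] at h4; exact h.up v h1 h2 h3 h4 h5 h6

/-- A vertex with at most two variables, which is the top of its piece, is left open. -/
theorem leave (h : Refinement T piece Q O link closed m (w + 1))
    (hcl : clauseAt H (T.node w) ∩ Q ⊆ O w) (hc : (O w).card < 3) (htop : T.IsTop piece w) :
    Refinement T piece Q O link closed m w := by
  have hcw : closed w = 0 := by
    by_contra hne
    have := (h.closed_spec w hne).1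
    omega
  refine ⟨h.card_le, h.subset, fun v h1 h2 h3 => ?_, fun v h1 => ?_, h.closed_inj, h.closed_surj,
    fun v h1 => ?_, fun v h1 h2 h3 h4 => ?_, fun v h1 h2 h3 h4 h5 h6 => ?_, h.card_link, h.source⟩
  · rcases Nat.eq_or_lt_of_le h1 with rfl | h1
    · exact ⟨fun h => absurd hcw h, fun h => by omega⟩
    · exact h.closed_iff v h1 h2 h3
  · obtain ⟨h2, h3⟩ := h.closed_spec v h1; exact ⟨by omega, h3⟩
  · obtain ⟨h2, h3⟩ := h.link_spec v h1; exact ⟨by omega, h3⟩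
  · rcases Nat.eq_or_lt_of_le h1 with rfl | h1
    · exact hcl
    · exact h.clause v h1 h2 h3 h4
  · rcases Nat.eq_or_lt_of_le h1 with rfl | h1
    · exact (htop.elim h5 fun h => h h6).elim
    · exact h.up v h1 h2 h3 h4 h5 h6

/-- A vertex with at most two variables passes them on to its parent, and is linked to its parent if
the variables there have changed. -/
theorem pass (h : Refinement T piece Q O link closed m (w + 1)) (hwn : w < T.n)
    (hw : piece w ≠ 0) (hcl : clauseAt H (T.node w) ∩ Q ⊆ O w) (hc : (O w).card < 3)
    (hne : T.parent w ≠ w) (hpp : piece (T.parent w) = piece w) {P : Finset ℕ}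
    (h1 : O (T.parent w) ⊆ P) (h2 : P ⊆ O (T.parent w) ∪ O w) (h3 : P.card ≤ 3)
    (h4 : O w ⊆ P ∨ P.card = 3) :
    Refinement T piece Q (Function.update O (T.parent w) P)
      (fun v => link v ∨ v = w ∧ P ≠ O (T.parent w)) closed m w := by
  have hlt : T.parent w < w := lt_of_le_of_ne (T.parent_le w hwn) hne
  have hcw : closed w = 0 := by
    by_contra hne
    have := (h.closed_spec w hne).1
    omega
  set p := T.parent w with hp
  have sub : ∀ u, O u ⊆ Function.update O p P u := by
    intro u
    by_cases hu : u = p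
    · rw [hu, Function.update_self]; exact h1
    · rw [Function.update_of_ne hu]
  have card3 : ∀ u, (Function.update O p P u).card ≤ 3 := by
    intro u
    by_cases hu : u = p
    · rw [hu, Function.update_self]; exact h3
    · rw [Function.update_of_ne hu]; exact h.card_le u
  have same : ∀ u, w ≤ u → Function.update O p P u = O u := fun u hu =>
    Function.update_of_ne (by omega) _ _
  have mono : ∀ a b, Relation.ReflTransGen (fun a b => link a ∧ T.parent a = b) a b →
      Relation.ReflTransGen (fun a b => (link a ∨ a = w ∧ P ≠ O p) ∧ T.parent a = b) a b :=
    fun a b hab => Relation.ReflTransGen.mono (fun a b h => ⟨Or.inl h.1, h.2⟩) _ _ hab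
  refine ⟨card3, fun u => ?_, fun v g1 g2 g3 => ?_, fun v g1 => ?_, h.closed_inj,
    h.closed_surj, fun v g1 => ?_, fun v g1 g2 g3 g4 => ?_, fun v g1 g2 g3 g4 g5 g6 => ?_,
    fun q => ?_, fun v x hx => ?_⟩
  · by_cases hu : u = p
    · rw [hu, Function.update_self]
      exact h2.trans (Finset.union_subset (h.subset _) (h.subset _))
    · rw [Function.update_of_ne hu]; exact h.subset u
  · rw [same v g1]
    rcases Nat.eq_or_lt_of_le g1 with rfl | g1
    · exact ⟨fun h => absurd hcw h, fun h => by omega⟩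
    · exact h.closed_iff v g1 g2 g3
  · obtain ⟨g2, g3⟩ := h.closed_spec v g1; exact ⟨by omega, g3⟩
  · rcases g1 with g1 | ⟨rfl, -⟩
    · obtain ⟨g2, g3⟩ := h.link_spec v g1; exact ⟨by omega, g3⟩
    · exact ⟨le_rfl, hwn, hne, hw, hpp, hcw⟩
  · rw [same v g1]
    rcases Nat.eq_or_lt_of_le g1 with rfl | g1
    · exact hcl
    · exact h.clause v g1 g2 g3 g4
  · rw [same v g1]
    rcases Nat.eq_or_lt_of_le g1 with rfl | g1
    · rw [← hp, Function.update_self]; exact h4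
    · rcases h.up v g1 g2 g3 g4 g5 g6 with g7 | g7
      · exact Or.inl (g7.trans (sub _))
      · exact Or.inr (le_antisymm (card3 _) (g7 ▸ Finset.card_le_card (sub _)))
  · obtain ⟨s, g1, g2⟩ := h.card_link q
    by_cases hq : q = p
    · by_cases hP : P = O p
      · refine ⟨s, ?_, g2.trans (Finset.card_le_card (sub q))⟩
        rintro v (g3 | ⟨-, g3⟩) g4
        · exact g1 v g3 g4
        · exact absurd hP g3
      · refine ⟨Insert.insert w s, ?_, ?_⟩
        · rintro v (g3 | ⟨rfl, -⟩) g4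
          · exact Finset.mem_insert_of_mem (g1 v g3 g4)
          · exact Finset.mem_insert_self _ _
        · rw [hq, Function.update_self]
          rw [hq] at g2
          have : (O p).card < P.card :=
            Finset.card_lt_card (h1.ssubset_of_ne (Ne.symm hP))
          exact (Finset.card_insert_le _ _).trans (by omega)
    · rw [Function.update_of_ne hq]
      refine ⟨s, ?_, g2⟩
      rintro v (g3 | ⟨rfl, -⟩) g4
      · exact g1 v g3 g4
      · exact absurd g4.symm hq
  · by_cases hv : v = p
    · rw [hv, Function.update_self] at hx
      by_cases hxp : x ∈ O p
      · obtain ⟨i, hi, g1, g2⟩ := h.source p x hxp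
        exact ⟨i, hi, g1, hv ▸ mono _ _ g2⟩
      · obtain ⟨i, hi, g1, g2⟩ := h.source w x ((Finset.mem_union.1 (h2 hx)).resolve_left hxp)
        refine ⟨i, hi, g1, (mono _ _ g2).tail ⟨Or.inr ⟨rfl, ?_⟩, hv.symm⟩⟩
        rintro rfl
        exact hxp hx
    · rw [Function.update_of_ne hv] at hx
      obtain ⟨i, hi, g1, g2⟩ := h.source v x hx
      exact ⟨i, hi, g1, mono _ _ g2⟩

/-- The labels of the refined division: a closed vertex is the top of a new piece, which consists of
the vertices from which links lead to it. -/
def Relabels (T : Forest H) (link : ℕ → Prop) (closed piece' : ℕ → ℕ) : Prop :=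
  ∀ i < T.n, (closed i ≠ 0 → piece' i = closed i) ∧
    (closed i = 0 → link i → piece' i = piece' (T.parent i)) ∧
    (closed i = 0 → ¬ link i → piece' i = 0)

variable {piece' : ℕ → ℕ}

theorem relabel_eq_closed (h : Refinement T piece Q O link closed m 0)
    (h' : Relabels T link closed piece') {i : ℕ} (hi : i < T.n) (h0 : piece' i ≠ 0) :
    ∃ t ≤ i, piece' i = closed t ∧ closed t ≠ 0 := by
  induction i using Nat.strong_induction_on with
  | _ i ih =>
    by_cases hc : closed i = 0
    · by_cases hl : link i
      · have e := (h' i hi).2.1 hc hl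
        have hlt : T.parent i < i := lt_of_le_of_ne (T.parent_le i hi) (h.link_spec i hl).2.2.1
        obtain ⟨t, ht, h1, h2⟩ := ih _ hlt (hlt.trans hi) (e ▸ h0)
        exact ⟨t, by omega, e.trans h1, h2⟩
      · exact absurd ((h' i hi).2.2 hc hl) h0
    · exact ⟨i, le_rfl, (h' i hi).1 hc, hc⟩

theorem relabel_le (h : Refinement T piece Q O link closed m 0)
    (h' : Relabels T link closed piece') {i : ℕ} (hi : i < T.n) : piece' i ≤ m := by
  by_cases h0 : piece' i = 0
  · omega
  · obtain ⟨t, -, h1, h2⟩ := h.relabel_eq_closed h' hi h0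
    rw [h1]; exact (h.closed_spec t h2).2.2.2

theorem link_of_relabel (h : Refinement T piece Q O link closed m 0)
    (h' : Relabels T link closed piece') {i : ℕ} (hi : i < T.n) (h0 : piece' i ≠ 0)
    (hne : T.parent i ≠ i) (hp : piece' (T.parent i) = piece' i) : link i := by
  by_contra hl
  have hc : closed i ≠ 0 := fun hc => h0 ((h' i hi).2.2 hc hl)
  have hlt : T.parent i < i := lt_of_le_of_ne (T.parent_le i hi) hne
  obtain ⟨t, ht, h1, h2⟩ := h.relabel_eq_closed h' (hlt.trans hi) (hp ▸ h0)
  rw [hp, (h' i hi).1 hc] at h1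
  have := h.closed_inj i t hc h1
  omega

theorem divides (h : Refinement T piece Q O link closed m 0)
    (h' : Relabels T link closed piece') : T.Divides piece' := by
  have key : ∀ i < T.n, piece' i ≠ 0 → T.IsTop piece' i → closed i ≠ 0 := by
    intro i hi h0 htop hc
    by_cases hl : link i
    · rcases htop with h1 | h1
      · exact (h.link_spec i hl).2.2.1 h1
      · exact h1 ((h' i hi).2.1 hc hl).symm
    · exact h0 ((h' i hi).2.2 hc hl)
  intro i hi j hj h0 hij hti htj
  have ci := key i hi h0 hti
  have cj := key j hj (hij ▸ h0) htj
  refine h.closed_inj i j ci ?_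
  rw [← (h' i hi).1 ci, ← (h' j hj).1 cj, hij]

theorem labels_eq (h : Refinement T piece Q O link closed m 0)
    (h' : Relabels T link closed piece') : T.labels piece' = Finset.Icc 1 m := by
  ext l
  rw [T.mem_labels, Finset.mem_Icc]
  constructor
  · rintro ⟨hl, i, hi, rfl⟩
    exact ⟨by omega, h.relabel_le h' hi⟩
  · rintro ⟨h1, h2⟩
    obtain ⟨v, rfl⟩ := h.closed_surj l (by omega) h2
    have hv := h.closed_spec v (by omega)
    exact ⟨by omega, v, hv.2.1, (h' v hv.2.1).1 (by omega)⟩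

/-- In the refined division, every vertex has at most three children in its own piece. -/
theorem card_children_le (h : Refinement T piece Q O link closed m 0)
    (h' : Relabels T link closed piece') (p : ℕ) :
    ((Finset.range T.n).filter fun i => piece' i ≠ 0 ∧ T.parent i ≠ i ∧ T.parent i = p ∧
      piece' p = piece' i).card ≤ 3 := by
  obtain ⟨s, h1, h2⟩ := h.card_link p
  refine (Finset.card_le_card fun i hi => ?_).trans (h2.trans (h.card_le p))
  rw [Finset.mem_filter, Finset.mem_range] at hi
  obtain ⟨hi, h0, hne, rfl, hp⟩ := hi
  exact h1 i (h.link_of_relabel h' hi h0 hne hp) rfl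

/-- In the refined division, every piece contains clauses with three variables of `Q`. -/
theorem exists_touched (h : Refinement T piece Q O link closed m 0)
    (h' : Relabels T link closed piece') {l : ℕ} (hl : l ∈ T.labels piece') :
    ∃ S ⊆ Q, S.card = 3 ∧ ∀ x ∈ S, Touches H (T.part piece' l) x := by
  rw [h.labels_eq h', Finset.mem_Icc] at hl
  obtain ⟨v, hv⟩ := h.closed_surj l (by omega) hl.2
  obtain ⟨-, hvn, hp, -⟩ := h.closed_spec v (by omega)
  refine ⟨O v, h.subset v, (h.closed_iff v (Nat.zero_le _) hvn hp).1 (by omega), fun x hx => ?_⟩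
  obtain ⟨i, hi, hxi, hr⟩ := h.source v x hx
  obtain ⟨j, hj, hxj⟩ := exists_of_mem_clauseAt hxi
  refine ⟨j, ⟨i, hi, ?_, hj⟩, hxj⟩
  clear hxi hj hi
  induction hr using Relation.ReflTransGen.head_induction_on with
  | refl => rw [(h' v hvn).1 (by omega), hv]
  | head hab _ ih =>
    obtain ⟨-, han, -, -, -, hca⟩ := h.link_spec _ hab.1
    rw [(h' _ han).2.1 hca hab.1, hab.2]
    exact ih

/-! ### The number of pieces of the refined division -/

open Classical in
/-- The variables of `Q` in the clauses of a piece. -/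
noncomputable def touched (T : Forest H) (piece : ℕ → ℕ) (Q : Finset ℕ) (l : ℕ) : Finset ℕ :=
  Q.filter fun x => Touches H (T.part piece l) x

/-- The children of `p` in the piece of `p`. -/
def children (T : Forest H) (piece : ℕ → ℕ) (p : ℕ) : Finset ℕ :=
  (Finset.range T.n).filter fun i => piece i ≠ 0 ∧ T.parent i ≠ i ∧ T.parent i = p ∧
    piece p = piece i

/-- Going up from an open vertex, a variable gets lost only at a closed vertex. -/
theorem mem_top_or_child (h : Refinement T piece Q O link closed m 0) {i x : ℕ} (hi : i < T.n)
    (h0 : piece i ≠ 0) (hc : closed i = 0) (hx : x ∈ O i) :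
    (∃ t < T.n, piece t = piece i ∧ T.IsTop piece t ∧ closed t = 0 ∧ x ∈ O t) ∨
    ∃ p < T.n, piece p = piece i ∧ closed p ≠ 0 ∧ ∃ j ∈ children T piece p, closed j = 0 ∧ x ∈ O j := by
  induction i using Nat.strong_induction_on with
  | _ i ih =>
    by_cases htop : T.IsTop piece i
    · exact Or.inl ⟨i, hi, rfl, htop, hc, hx⟩
    · unfold Forest.IsTop at htop
      push Not at htop
      have hlt : T.parent i < i := lt_of_le_of_ne (T.parent_le i hi) htop.1
      have hpn := hlt.trans hi
      by_cases hcp : closed (T.parent i) = 0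
      · have hx' : x ∈ O (T.parent i) := by
          rcases h.up i (Nat.zero_le _) hi h0 hc htop.1 htop.2 with h1 | h1
          · exact h1 hx
          · exact absurd hcp ((h.closed_iff _ (Nat.zero_le _) hpn (htop.2 ▸ h0)).2 h1)
        rw [← htop.2]
        exact ih _ hlt hpn (htop.2 ▸ h0) hcp hx'
      · refine Or.inr ⟨_, hpn, htop.2, hcp, i, ?_, hc, hx⟩
        rw [children, Finset.mem_filter, Finset.mem_range]
        exact ⟨hi, h0, htop.1, rfl, htop.2⟩

theorem mem_touched_cases (h : Refinement T piece Q O link closed m 0) {l x : ℕ} (hl : l ≠ 0)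
    (hx : x ∈ touched T piece Q l) :
    (∃ t < T.n, piece t = l ∧ T.IsTop piece t ∧ closed t = 0 ∧ x ∈ O t) ∨
    ∃ p < T.n, piece p = l ∧ closed p ≠ 0 ∧ (x ∈ clauseAt H (T.node p) ∩ Q ∨
      ∃ j ∈ children T piece p, closed j = 0 ∧ x ∈ O j) := by
  classical
  rw [touched, Finset.mem_filter] at hx
  obtain ⟨hxQ, j, ⟨i, hi, rfl, hij⟩, hxj⟩ := hx
  have hxi : x ∈ clauseAt H (T.node i) ∩ Q := by
    rw [hij, clauseAt_clause]; exact Finset.mem_inter.2 ⟨hxj, hxQ⟩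
  by_cases hc : closed i = 0
  · rcases h.mem_top_or_child hi hl hc (h.clause i (Nat.zero_le _) hi hl hc hxi) with h1 | h1
    · exact Or.inl h1
    · obtain ⟨p, h1, h2, h3, h4⟩ := h1
      exact Or.inr ⟨p, h1, h2, h3, Or.inr h4⟩
  · exact Or.inr ⟨i, hi, rfl, hc, Or.inl hxi⟩

theorem card_open_le (h : Refinement T piece Q O link closed m 0) {v : ℕ} (hv : v < T.n)
    (h0 : piece v ≠ 0) (hc : closed v = 0) : (O v).card ≤ 2 := by
  have h1 := h.card_le v
  have h2 : (O v).card ≠ 3 := fun h2 => (h.closed_iff v (Nat.zero_le _) hv h0).2 h2 hc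
  omega

/-- The closed vertices. -/
def closedVerts (T : Forest H) (closed : ℕ → ℕ) : Finset ℕ :=
  (Finset.range T.n).filter fun i => closed i ≠ 0

theorem card_closedVerts_le (h : Refinement T piece Q O link closed m 0) :
    (closedVerts T closed).card ≤ m := by
  have : (closedVerts T closed).card ≤ (Finset.Icc 1 m).card := by
    refine Finset.card_le_card_of_injOn closed (fun i hi => ?_) (fun i hi j hj hij => ?_)
    · have hi := (Finset.mem_filter.1 hi).2
      have := (h.closed_spec i hi).2.2.2
      rw [Finset.coe_Icc, Set.mem_Icc]; omega
    · exact h.closed_inj i j (Finset.mem_filter.1 hi).2 hij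
  simpa using this

/-- The open top of a piece, if there is one, has at most two variables. -/
theorem card_top_le (h : Refinement T piece Q O link closed m 0) (hd : T.Divides piece) {l : ℕ}
    (hl : l ≠ 0) : ∃ S : Finset ℕ, S.card ≤ 2 ∧
      ∀ t < T.n, piece t = l → T.IsTop piece t → closed t = 0 → O t ⊆ S := by
  by_cases hex : ∃ t < T.n, piece t = l ∧ T.IsTop piece t ∧ closed t = 0
  · obtain ⟨t, h1, h2, h3, h4⟩ := hex
    refine ⟨O t, h.card_open_le h1 (h2 ▸ hl) h4, fun t' h1' h2' h3' h4' => ?_⟩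
    rw [hd t h1 t' h1' (h2 ▸ hl) (h2.trans h2'.symm) h3 h3']
  · refine ⟨∅, by simp, fun t h1 h2 h3 h4 => absurd ⟨t, h1, h2, h3, h4⟩ hex⟩

/-- A piece whose clauses contain three variables of `Q` contains a closed vertex, and there are at
most `m` pieces of this kind. -/
theorem sum_card_touched_le_of_card (h : Refinement T piece Q O link closed m 0)
    (hd : T.Divides piece) :
    ∑ l ∈ T.labels piece, (touched T piece Q l).card ≤
      2 * (T.labels piece).card + Q.card * m := by
  classical
  set L := T.labels piece with hL
  set L₃ := L.filter fun l => 3 ≤ (touched T piece Q l).card with hL₃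
  have h1 : L₃.card ≤ m := by
    refine le_trans ?_ h.card_closedVerts_le
    have hex : ∀ l ∈ L₃, ∃ p, p ∈ closedVerts T closed ∧ piece p = l := by
      intro l hl
      rw [hL₃, Finset.mem_filter] at hl
      have hl0 : l ≠ 0 := (T.mem_labels.1 hl.1).1
      by_contra hcon
      obtain ⟨S, hS, hS'⟩ := h.card_top_le hd hl0
      have : touched T piece Q l ⊆ S := by
        intro x hx
        rcases h.mem_touched_cases hl0 hx with ⟨t, h1, h2, h3, h4, h5⟩ | ⟨p, h1, h2, h3, -⟩
        · exact hS' t h1 h2 h3 h4 h5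
        · exact absurd ⟨p, Finset.mem_filter.2 ⟨Finset.mem_range.2 h1, h3⟩, h2⟩ hcon
      have := Finset.card_le_card this
      omega
    choose! g hg using hex
    exact Finset.card_le_card_of_injOn g (fun l hl => (hg l hl).1) (fun l hl l' hl' he => by
      rw [← (hg l hl).2, ← (hg l' hl').2, he])
  have h2 : ∀ l ∈ L, (touched T piece Q l).card ≤
      2 + if 3 ≤ (touched T piece Q l).card then Q.card else 0 := by
    intro l _
    have : (touched T piece Q l).card ≤ Q.card := Finset.card_le_card (Finset.filter_subset _ _)
    split_ifs <;> omega
  refine (Finset.sum_le_sum h2).trans ?_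
  rw [Finset.sum_add_distrib, Finset.sum_const, smul_eq_mul, mul_comm, ← Finset.sum_filter,
    Finset.sum_const, smul_eq_mul, ← hL₃, mul_comm L₃.card]
  exact Nat.add_le_add_left (Nat.mul_le_mul_left _ h1) _

/-- If every vertex has at most three children in its piece, then the pieces contain few
incidences with `Q`. -/
theorem sum_card_touched_le_of_children (h : Refinement T piece Q O link closed m 0)
    (hd : T.Divides piece) (hch : ∀ p, (children T piece p).card ≤ 3) :
    ∑ l ∈ T.labels piece, (touched T piece Q l).card ≤ 2 * (T.labels piece).card + 6 * m +
      ∑ i ∈ closedVerts T closed, (clauseAt H (T.node i) ∩ Q).card := by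
  classical
  set L := T.labels piece with hL
  set K := closedVerts T closed with hK
  set g : ℕ → ℕ := fun i => (clauseAt H (T.node i) ∩ Q).card + 6 with hg
  have h1 : ∀ l ∈ L, (touched T piece Q l).card ≤ 2 + ∑ i ∈ K.filter (fun i => piece i = l), g i := by
    intro l hl
    have hl0 : l ≠ 0 := (T.mem_labels.1 hl).1
    obtain ⟨S, hS, hS'⟩ := h.card_top_le hd hl0
    set W : ℕ → Finset ℕ := fun p => (clauseAt H (T.node p) ∩ Q) ∪
      ((children T piece p).filter fun j => closed j = 0).biUnion O with hW
    have hsub : touched T piece Q l ⊆ S ∪ (K.filter fun i => piece i = l).biUnion W := by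
      intro x hx
      rcases h.mem_touched_cases hl0 hx with ⟨t, h1, h2, h3, h4, h5⟩ | ⟨p, h1, h2, h3, h4⟩
      · exact Finset.mem_union_left _ (hS' t h1 h2 h3 h4 h5)
      · refine Finset.mem_union_right _ (Finset.mem_biUnion.2 ⟨p, Finset.mem_filter.2
          ⟨Finset.mem_filter.2 ⟨Finset.mem_range.2 h1, h3⟩, h2⟩, ?_⟩)
        rcases h4 with h4 | ⟨j, h5, h6, h7⟩
        · exact Finset.mem_union_left _ h4
        · exact Finset.mem_union_right _ (Finset.mem_biUnion.2
            ⟨j, Finset.mem_filter.2 ⟨h5, h6⟩, h7⟩)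
    have hWg : ∀ p, (W p).card ≤ g p := by
      intro p
      refine (Finset.card_union_le _ _).trans (Nat.add_le_add_left ?_ _)
      refine (Finset.card_biUnion_le_card_mul _ _ 2 fun j hj => ?_).trans ?_
      · rw [Finset.mem_filter, children, Finset.mem_filter, Finset.mem_range] at hj
        exact h.card_open_le hj.1.1 hj.1.2.1 hj.2
      · have := (Finset.card_le_card (Finset.filter_subset (fun j => closed j = 0) _)).trans (hch p)
        omega
    calc (touched T piece Q l).card ≤ _ := Finset.card_le_card hsub
      _ ≤ _ := Finset.card_union_le _ _
      _ ≤ _ := Nat.add_le_add hS (Finset.card_biUnion_le.trans (Finset.sum_le_sum fun p _ => hWg p))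
  refine (Finset.sum_le_sum h1).trans ?_
  have hmap : ∀ i ∈ K, piece i ∈ L := by
    intro i hi
    rw [hK, closedVerts, Finset.mem_filter, Finset.mem_range] at hi
    exact T.mem_labels.2 ⟨(h.closed_spec i hi.2).2.2.1, i, hi.1, rfl⟩
  rw [Finset.sum_add_distrib, Finset.sum_const, smul_eq_mul, Finset.sum_fiberwise_of_maps_to hmap,
    hg, Finset.sum_add_distrib, Finset.sum_const, smul_eq_mul]
  have := h.card_closedVerts_le
  rw [← hK] at this
  omega

/-- Counts the incidences between the pieces and `Q` in two ways. -/
theorem card_mul_le_sum_touched (T : Forest H) (piece : ℕ → ℕ) (Q : Finset ℕ) {a b : ℕ}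
    (hQ : ∀ x ∈ Q, ∀ s : Finset ℕ, (∀ l ∈ T.labels piece, Touches H (T.part piece l) x → l ∈ s) →
      a ≤ b * s.card) :
    Q.card * a ≤ b * ∑ l ∈ T.labels piece, (touched T piece Q l).card := by
  classical
  have h1 : ∑ l ∈ T.labels piece, (touched T piece Q l).card =
      ∑ x ∈ Q, ((T.labels piece).filter fun l => Touches H (T.part piece l) x).card := by
    exact Finset.sum_card_bipartiteAbove_eq_sum_card_bipartiteBelow
      (fun l x => Touches H (T.part piece l) x)
  rw [h1, Finset.mul_sum, ← smul_eq_mul, ← Finset.sum_const]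
  exact Finset.sum_le_sum fun x hx => hQ x hx _ fun l hl h => Finset.mem_filter.2 ⟨hl, h⟩

end Refinement

/-! ### Growth of the number of pieces -/

/-- The properties of a strong backdoor set `B` with at most `k` elements that the algorithm relies
on: the sets that avoid `B` form a nested family, and the incidences with a set of variables outside
`B` are few. -/
structure IsBackdoorFor (H : ℕ → Finset ℕ) (k : ℕ) (B : Finset ℕ) : Prop where
  card_le : B.card ≤ k
  order : ∃ lt : ℕ → ℕ → Prop, IsStrictTotalOrder ℕ lt ∧ ∀ i j, i ≠ j →
    Disjoint (H i) B → Disjoint (H j) B → ¬ Cross lt (H i) (H j)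
  sum_le : ∀ J Q : Finset ℕ, Disjoint Q B →
    ∑ j ∈ J, (H j ∩ Q).card ≤ 4 ^ k * Q.card + 2 * J.card

open Classical in
/-- The labels of the pieces with a clause that contains an element of `B`. -/
noncomputable def Forest.touchedBy {H : ℕ → Finset ℕ} (T : Forest H) (piece : ℕ → ℕ)
    (B : Finset ℕ) : Finset ℕ :=
  (T.labels piece).filter fun l => ∃ b ∈ B, Touches H (T.part piece l) b

namespace Refinement

variable {H : ℕ → Finset ℕ} {T : Forest H} {piece piece' : ℕ → ℕ} {Q B : Finset ℕ}
  {O : ℕ → Finset ℕ} {link : ℕ → Prop} {closed : ℕ → ℕ} {m k : ℕ}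

/-- All but few pieces of the refined division are touched by a backdoor set that avoids `Q`. -/
theorem le_card_touchedBy (h : Refinement T piece Q O link closed m 0)
    (h' : Relabels T link closed piece') (hB : IsBackdoorFor H k B) :
    m - 2 * Q.card ≤ (T.touchedBy piece' B).card := by
  classical
  obtain ⟨lt, hlt, hc⟩ := hB.order
  set L := (T.labels piece').filter fun l => ¬ ∃ b ∈ B, Touches H (T.part piece' l) b with hL
  have hm : (T.labels piece').card = m := by rw [h.labels_eq h']; simp
  have hsum : (T.touchedBy piece' B).card + L.card = m := by
    rw [← hm, Forest.touchedBy]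
    convert Finset.card_filter_add_card_filter_not (s := T.labels piece')
      (fun l => ∃ b ∈ B, Touches H (T.part piece' l) b)
  have hmem : ∀ l ∈ L, l ∈ T.labels piece' ∧ ∀ b ∈ B, ¬ Touches H (T.part piece' l) b := by
    intro l hl
    rw [hL, Finset.mem_filter] at hl
    exact ⟨hl.1, fun b hb hb' => hl.2 ⟨b, hb, hb'⟩⟩
  have hex : ∀ l, ∃ S : Finset ℕ, l ∈ L →
      S ⊆ Q ∧ S.card = 3 ∧ ∀ x ∈ S, Touches H (T.part piece' l) x := by
    intro l
    by_cases hl : l ∈ L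
    · obtain ⟨S, hS⟩ := h.exists_touched h' (hmem l hl).1
      exact ⟨S, fun _ => hS⟩
    · exact ⟨∅, fun h => absurd h hl⟩
  choose S hS using hex
  have avoid : ∀ l ∈ L, ∀ j, 2 * j + 1 ∈ T.part piece' l → Disjoint (H j) B := by
    intro l hl j hj
    rw [Finset.disjoint_left]
    exact fun x hx hxB => (hmem l hl).2 x hxB ⟨j, hj, hx⟩
  have : L.card ≤ 2 * Q.card := by
    refine card_pieces_le hlt L (T.part piece')
      (fun l hl => (h.divides h').joined (T.mem_labels.1 (hmem l hl).1).1)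
      (fun l _ l' _ hne => Forest.part_disjoint piece' hne) (fun l hl l' hl' hne i j hi hj => ?_) Q S
      (fun l hl => (hS l hl).1) (fun l hl => (hS l hl).2.1.ge) (fun l hl => (hS l hl).2.2)
    refine hc i j ?_ (avoid l hl i hi) (avoid l' hl' j hj)
    rintro rfl
    exact Set.disjoint_left.1 (Forest.part_disjoint piece' hne) hi hj
  omega

/-- The bound of `IsBackdoorFor.sum_le` for the clauses at closed vertices. -/
theorem sum_closed_le (h : Refinement T piece Q O link closed m 0) (hB : IsBackdoorFor H k B)
    (hQB : Disjoint Q B) :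
    ∑ i ∈ closedVerts T closed, (clauseAt H (T.node i) ∩ Q).card ≤ 4 ^ k * Q.card + 2 * m := by
  classical
  set K := (closedVerts T closed).filter fun i => T.node i % 2 = 1 with hK
  have h1 : ∑ i ∈ closedVerts T closed, (clauseAt H (T.node i) ∩ Q).card =
      ∑ i ∈ K, (H (T.node i / 2) ∩ Q).card := by
    rw [hK, Finset.sum_filter]
    refine Finset.sum_congr rfl fun i _ => ?_
    unfold clauseAt
    split_ifs <;> simp
  have hinj : Set.InjOn (fun i => T.node i / 2) (K : Set ℕ) := by
    intro i hi j hj hij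
    simp only [hK, Finset.coe_filter, Set.mem_ofPred_eq, closedVerts, Finset.mem_filter,
      Finset.mem_range] at hi hj
    refine T.inj i hi.1.1 j hj.1.1 ?_
    simp only at hij
    omega
  have h2 := hB.sum_le (K.image fun i => T.node i / 2) Q hQB
  rw [Finset.sum_image hinj, Finset.card_image_of_injOn hinj] at h2
  have h3 : K.card ≤ m := (Finset.card_le_card (Finset.filter_subset _ _)).trans h.card_closedVerts_le
  rw [h1]
  omega

/-- A division into very many pieces is refined into more than `4 * quota k` pieces. Each of the
`quota k` candidates touches a `k`-th part of the pieces, while all but few incidences of candidates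
with pieces are in pieces with a closed vertex. -/
theorem lt_of_first (h : Refinement T piece Q O link closed m 0) (hd : T.Divides piece)
    (hk : 0 < k) (hq : Q.card = quota k) (hM : 49 * (k * k * 4 ^ k) ≤ (T.labels piece).card)
    (hQ : ∀ x ∈ Q, ∀ s : Finset ℕ, (∀ l ∈ T.labels piece, Touches H (T.part piece l) x → l ∈ s) →
      (T.labels piece).card ≤ k * s.card) : 4 * quota k < m := by
  have h1 := (card_mul_le_sum_touched T piece Q hQ).trans
    (Nat.mul_le_mul_left k (h.sum_card_touched_le_of_card hd))
  set M := (T.labels piece).card with hMdef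
  rw [hq] at h1
  unfold quota at h1 ⊢
  set u := 4 ^ k with hu
  have hu4 : 4 ≤ u := by
    rw [hu]; calc 4 = 4 ^ 1 := rfl
      _ ≤ 4 ^ k := Nat.pow_le_pow_right (by norm_num) hk
  by_contra hcon
  push Not at hcon
  -- Divided by `k`, the inequality `h1` says that `8 u M ≤ 2 M + 8 k u m`.
  have h2 : 8 * u * M ≤ 2 * M + 8 * k * u * m := by
    refine Nat.le_of_mul_le_mul_left ?_ hk
    calc k * (8 * u * M) = 8 * k * u * M := by ring
      _ ≤ _ := h1
  have h3 : 8 * k * u * m ≤ 8 * k * u * (4 * (8 * k * u)) := Nat.mul_le_mul_left _ hcon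
  have h4 : u * (49 * (k * k * u)) ≤ u * M := Nat.mul_le_mul_left _ hM
  have h5 : 4 * M ≤ u * M := Nat.mul_le_mul_right _ hu4
  have h6 : 0 < u * (k * k * u) := by positivity
  nlinarith

/-- A division in which no vertex has more than three children in its piece is refined into more
pieces, if some backdoor set avoids `Q`. By the small number of children, almost all incidences of
candidates with pieces come from clauses at closed vertices, and these have few incidences with `Q`. -/
theorem lt_of_later (h : Refinement T piece Q O link closed m 0) (hd : T.Divides piece)
    (hk : 0 < k) (hq : Q.card = quota k) (hB : IsBackdoorFor H k B) (hQB : Disjoint Q B)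
    (hM : 4 * quota k ≤ (T.labels piece).card) (hch : ∀ p, (children T piece p).card ≤ 3)
    (hQ : ∀ x ∈ Q, ∀ s : Finset ℕ, (∀ l ∈ T.labels piece, Touches H (T.part piece l) x → l ∈ s) →
      (T.labels piece).card - 2 * quota k ≤ k * s.card) : (T.labels piece).card < m := by
  have h1 := (card_mul_le_sum_touched T piece Q hQ).trans
    (Nat.mul_le_mul_left k ((h.sum_card_touched_le_of_children hd hch).trans
      (Nat.add_le_add_left (h.sum_closed_le hB hQB) _)))
  set N := (T.labels piece).card with hN
  rw [hq] at h1
  by_contra hcon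
  push Not at hcon
  set u := 4 ^ k with hu
  have hu4 : 4 ≤ u := by
    rw [hu]; calc 4 = 4 ^ 1 := rfl
      _ ≤ 4 ^ k := Nat.pow_le_pow_right (by norm_num) hk
  have hqu : quota k = 8 * k * u := rfl
  set q := quota k with hqd
  have hq0 : 0 < q := by rw [hqu]; positivity
  obtain ⟨a, ha⟩ : ∃ a, N = 2 * q + a := ⟨N - 2 * q, by omega⟩
  -- As `m ≤ N`, the inequality `h1` bounds `q * a` by `k * (10 * N + u * q)`; divide it by `k`.
  have h2 : 8 * u * a ≤ 10 * N + u * q := by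
    refine Nat.le_of_mul_le_mul_left ?_ hk
    calc k * (8 * u * a) = q * (N - 2 * q) := by
          rw [ha, Nat.add_sub_cancel_left, hqu]; ring
      _ ≤ _ := h1
      _ ≤ k * (10 * N + u * q) := Nat.mul_le_mul_left _ (by omega)
  have h3 : N ≤ 2 * a := by omega
  have h4 : 2 * q ≤ a := by omega
  have h5 : 4 * a ≤ u * a := Nat.mul_le_mul_right _ hu4
  have h6 : u * (2 * q) ≤ u * a := Nat.mul_le_mul_left _ h4
  have h7 : 0 < u * q := by positivity
  nlinarith

end Refinement

/-- If the elements of `B` touch many pieces, then one of them touches many pieces. -/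
theorem Forest.exists_touches_many {H : ℕ → Finset ℕ} {T : Forest H} {piece : ℕ → ℕ} {B : Finset ℕ}
    {k a : ℕ} (hB : B.card ≤ k) (ha : 0 < a) (h : a ≤ (T.touchedBy piece B).card) :
    ∃ b ∈ B, (∃ l ≠ 0, Touches H (T.part piece l) b) ∧
      ∀ s : Finset ℕ, (∀ l ∈ T.labels piece, Touches H (T.part piece l) b → l ∈ s) →
        a ≤ k * s.card := by
  classical
  set t : ℕ → Finset ℕ := fun b => (T.labels piece).filter fun l => Touches H (T.part piece l) b
    with ht
  have hsub : T.touchedBy piece B ⊆ B.biUnion t := by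
    intro l hl
    rw [Forest.touchedBy, Finset.mem_filter] at hl
    obtain ⟨hl, b, hb, hb'⟩ := hl
    exact Finset.mem_biUnion.2 ⟨b, hb, Finset.mem_filter.2 ⟨hl, hb'⟩⟩
  have hex : ∃ b ∈ B, a ≤ k * (t b).card := by
    by_contra hcon
    push Not at hcon
    have h1 : a ≤ ∑ b ∈ B, (t b).card :=
      h.trans ((Finset.card_le_card hsub).trans Finset.card_biUnion_le)
    have hBne : B.Nonempty := by
      by_contra hne
      rw [Finset.not_nonempty_iff_eq_empty] at hne
      rw [hne] at h1; simp at h1; omega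
    have h2 : k * ∑ b ∈ B, (t b).card < B.card * a := by
      rw [Finset.mul_sum, ← smul_eq_mul, ← Finset.sum_const]
      exact Finset.sum_lt_sum_of_nonempty hBne hcon
    have h3 : k * a ≤ k * ∑ b ∈ B, (t b).card := Nat.mul_le_mul_left _ h1
    have h4 : B.card * a ≤ k * a := Nat.mul_le_mul_right _ hB
    omega
  obtain ⟨b, hb, hab⟩ := hex
  refine ⟨b, hb, ?_, fun s hs => hab.trans (Nat.mul_le_mul_left _ (Finset.card_le_card ?_))⟩
  · have : (t b).Nonempty := by
      rw [← Finset.card_pos]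
      rcases Nat.eq_zero_or_pos (t b).card with h0 | h0
      · rw [h0] at hab; omega
      · exact h0
    obtain ⟨l, hl⟩ := this
    rw [ht, Finset.mem_filter] at hl
    exact ⟨l, (T.mem_labels.1 hl.1).1, hl.2⟩
  · intro l hl
    rw [ht, Finset.mem_filter] at hl
    exact hs l hl.1 hl.2

/-! ### Counting the pieces that a variable touches -/

/-- The forest `T` is stored in the state `σ`; the array `index` holds one plus the number of each
vertex code that occurs in the forest. -/
structure Stores {H : ℕ → Finset ℕ} (σ : ArrState) (T : Forest H) : Prop where
  n : σ .numVerts 0 = T.n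
  parent : ∀ i < T.n, σ .parent i = T.parent i
  index : ∀ i < T.n, σ .index (T.node i) = i + 1
  exists_of_index : ∀ u, σ .index u ≠ 0 → ∃ i < T.n, T.node i = u

theorem Stores.congr {H : ℕ → Finset ℕ} {σ τ : ArrState} {T : Forest H} (h : Stores σ T)
    (h1 : τ .numVerts = σ .numVerts) (h2 : τ .parent = σ .parent) (h3 : τ .index = σ .index) :
    Stores τ T :=
  ⟨by rw [h1]; exact h.n, by rw [h2]; exact h.parent, by rw [h3]; exact h.index,
    by rw [h3]; exact h.exists_of_index⟩

theorem Stores.index_eq_iff {H : ℕ → Finset ℕ} {σ : ArrState} {T : Forest H} (h : Stores σ T)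
    (u : ℕ) {i : ℕ} (hi : i < T.n) : σ .index u = i + 1 ↔ T.node i = u := by
  constructor
  · intro hu
    obtain ⟨j, hj, rfl⟩ := h.exists_of_index u (by omega)
    rw [h.index j hj] at hu
    rw [show i = j by omega]
  · rintro rfl; exact h.index i hi

theorem EdgesAre.congr {σ τ : ArrState} {R : ℕ → ℕ → Prop} (h : EdgesAre σ R)
    (h1 : τ .numEdges = σ .numEdges) (h2 : τ .edgeClause = σ .edgeClause)
    (h3 : τ .edgeVar = σ .edgeVar) : EdgesAre τ R := by
  unfold EdgesAre; rw [h1, h2, h3]; exact h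

/-- The variable `x` occurs in one of the stored incidences. -/
def IsEdgeVar (σ : ArrState) (x : ℕ) : Prop := ∃ e < σ .numEdges 0, σ .edgeVar e = x

theorem IsEdgeVar.congr {σ τ : ArrState} {x : ℕ} (h : IsEdgeVar σ x)
    (h1 : τ .numEdges = σ .numEdges) (h2 : τ .edgeVar = σ .edgeVar) : IsEdgeVar τ x := by
  unfold IsEdgeVar; rw [h1, h2]; exact h

/-- The code of the clause of the incidence with number `edge`. -/
abbrev edgeCode : ArrExpr :=
  .add (.add (.arr .edgeClause (sc .edge)) (.arr .edgeClause (sc .edge))) (.const 1)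

/-- The variable of the incidence with number `edge`. -/
abbrev edgeVariable : ArrExpr := .arr .edgeVar (sc .edge)

/-- The clause of the incidence with number `e` is in the piece with label `l`. -/
def EdgeIn (σ : ArrState) (l e : ℕ) : Prop :=
  σ .index (2 * σ .edgeClause e + 1) ≠ 0 ∧
    σ .piece (σ .index (2 * σ .edgeClause e + 1) - 1) = l

theorem Stores.touches_iff {H : ℕ → Finset ℕ} {σ : ArrState} {T : Forest H} (h : Stores σ T)
    (hE : EdgesAre σ fun j x => x ∈ H j) (l x : ℕ) :
    Touches H (T.part (σ .piece) l) x ↔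
      ∃ e < σ .numEdges 0, σ .edgeVar e = x ∧ EdgeIn σ l e := by
  constructor
  · rintro ⟨j, ⟨i, hi, rfl, hij⟩, hx⟩
    obtain ⟨e, he, rfl, rfl⟩ := (hE j x).1 hx
    have := h.index i hi
    rw [hij] at this
    exact ⟨e, he, rfl, by rw [this]; omega, by rw [this]; rfl⟩
  · rintro ⟨e, he, rfl, h1, rfl⟩
    obtain ⟨i, hi, hij⟩ := h.exists_of_index _ h1
    refine ⟨σ .edgeClause e, ⟨i, hi, ?_, hij⟩, (hE _ _).2 ⟨e, he, rfl, rfl⟩⟩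
    have := h.index i hi
    rw [hij] at this
    rw [this]; rfl

/-- Resets the data about the variables. -/
def resetVariables : ArrProg :=
  .rep .edge (seqs [.store .lastSeen edgeVariable (.const 0),
    .store .count edgeVariable (.const 0), .store .chosen edgeVariable (.const 0)])

theorem run_resetVariables (E : ArrEnv) (σ : ArrState) (hN : σ .numEdges 0 ≤ E.size) {x : ℕ}
    (hx : IsEdgeVar σ x) : resetVariables.run E σ .lastSeen x = 0 ∧
      resetVariables.run E σ .count x = 0 ∧ resetVariables.run E σ .chosen x = 0 := by
  obtain ⟨e, he, rfl⟩ := hx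
  have key := ArrProg.rep_induction_frame (E := E) (a := .edge) (σ := σ)
    (c := seqs [.store .lastSeen edgeVariable (.const 0),
      .store .count edgeVariable (.const 0), .store .chosen edgeVariable (.const 0)])
    (fun t τ => e < t → τ .lastSeen (σ .edgeVar e) = 0 ∧ τ .count (σ .edgeVar e) = 0 ∧
      τ .chosen (σ .edgeVar e) = 0) (fun h => absurd h (by omega)) ?_
  · exact key (by omega)
  · intro t _ τ hf ih ht
    have hv : τ .edgeVar = σ .edgeVar := hf _ (by decide)
    simp only [run_seqs_cons, run_seqs_nil, run_store]
    rcases Nat.lt_succ_iff_lt_or_eq.1 ht with ht | rfl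
    · obtain ⟨h1, h2, h3⟩ := ih ht
      simp [h1, h2, h3]
    · simp [hv]

/-- For each label, adds `k` to the counts of the variables that touch the piece. The parameter `k`
is read from the start of the input; with this factor, the counts can be compared with the threshold
without a division. -/
def countPieces : ArrProg :=
  .rep .label (.rep .edge (whenLt (sc .edge) (sc .numEdges)
    (.ite (.arr .index edgeCode)
      (whenEq (.arr .piece (.sub (.arr .index edgeCode) (.const 1))) (.add (sc .label) (.const 1))
        (whenNe (.arr .lastSeen edgeVariable) (.add (sc .label) (.const 1))
          (seqs [.store .lastSeen edgeVariable (.add (sc .label) (.const 1)),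
            .store .count edgeVariable (.add (.arr .count edgeVariable) (.inp (.const 0)))])))
      .skip)))

open Classical in
theorem run_countPieces (E : ArrEnv) (σ : ArrState) (hN : σ .numEdges 0 ≤ E.size)
    (h0 : ∀ x, IsEdgeVar σ x → σ .lastSeen x = 0 ∧ σ .count x = 0) {x : ℕ} (hx : IsEdgeVar σ x) :
    countPieces.run E σ .count x = E.read 0 * ((Finset.Icc 1 E.size).filter fun l =>
      ∃ e < σ .numEdges 0, σ .edgeVar e = x ∧ EdgeIn σ l e).card := by
  set Z : ℕ → ℕ → Prop := fun l x => ∃ e < σ .numEdges 0, σ .edgeVar e = x ∧ EdgeIn σ l e with hZ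
  have key := ArrProg.rep_induction_frame (E := E) (a := .label) (σ := σ)
    (c := .rep .edge (whenLt (sc .edge) (sc .numEdges)
    (.ite (.arr .index edgeCode)
      (whenEq (.arr .piece (.sub (.arr .index edgeCode) (.const 1))) (.add (sc .label) (.const 1))
        (whenNe (.arr .lastSeen edgeVariable) (.add (sc .label) (.const 1))
          (seqs [.store .lastSeen edgeVariable (.add (sc .label) (.const 1)),
            .store .count edgeVariable (.add (.arr .count edgeVariable) (.inp (.const 0)))])))
      .skip)))
    (fun t τ => ∀ x, IsEdgeVar σ x → τ .lastSeen x ≤ t ∧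
      τ .count x = E.read 0 * ((Finset.Icc 1 t).filter fun l => Z l x).card) ?_ ?_
  · exact (key x hx).2
  · intro x hx
    simp [h0 x hx]
  · intro t ht τ hf ih
    have inner := ArrProg.rep_induction_frame (E := E) (a := .edge) (σ := τ.upd .label 0 t)
      (c := whenLt (sc .edge) (sc .numEdges)
      (.ite (.arr .index edgeCode)
        (whenEq (.arr .piece (.sub (.arr .index edgeCode) (.const 1))) (.add (sc .label) (.const 1))
          (whenNe (.arr .lastSeen edgeVariable) (.add (sc .label) (.const 1))
            (seqs [.store .lastSeen edgeVariable (.add (sc .label) (.const 1)),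
              .store .count edgeVariable (.add (.arr .count edgeVariable) (.inp (.const 0)))])))
        .skip))
      (fun s κ => ∀ x, IsEdgeVar σ x →
        ((∃ e < s, e < σ .numEdges 0 ∧ σ .edgeVar e = x ∧ EdgeIn σ (t + 1) e) →
          κ .lastSeen x = t + 1 ∧
          κ .count x = E.read 0 * ((Finset.Icc 1 t).filter fun l => Z l x).card + E.read 0) ∧
        ((¬ ∃ e < s, e < σ .numEdges 0 ∧ σ .edgeVar e = x ∧ EdgeIn σ (t + 1) e) →
          κ .lastSeen x ≤ t ∧
          κ .count x = E.read 0 * ((Finset.Icc 1 t).filter fun l => Z l x).card)) ?_ ?_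
    · intro x hx
      obtain ⟨h1, h2⟩ := inner x hx
      have hIcc : Finset.Icc 1 (t + 1) = insert (t + 1) (Finset.Icc 1 t) := by
        ext l; simp only [Finset.mem_insert, Finset.mem_Icc]; omega
      have hnot : t + 1 ∉ (Finset.Icc 1 t).filter fun l => Z l x := by
        simp
      rw [hIcc, Finset.filter_insert]
      by_cases hz : Z (t + 1) x
      · rw [if_pos hz, Finset.card_insert_of_notMem hnot, Nat.mul_add, mul_one]
        obtain ⟨e, he, h3⟩ := hz
        obtain ⟨h4, h5⟩ := h1 ⟨e, by omega, he, h3⟩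
        exact ⟨h4.le, h5⟩
      · rw [if_neg hz]
        obtain ⟨h4, h5⟩ := h2 fun ⟨e, _, he⟩ => hz ⟨e, he⟩
        exact ⟨h4.trans (by omega), h5⟩
    · intro x hx
      refine ⟨fun ⟨e, he, _⟩ => absurd he (by omega), fun _ => ?_⟩
      obtain ⟨h1, h2⟩ := ih x hx
      exact ⟨by simpa using h1, by simpa using h2⟩
    · intro s _ κ hf' ih' x hx
      have e1 : κ .numEdges = σ .numEdges := (hf' _ (by decide)).trans
        ((ArrState.upd_of_ne _ (by decide) _ _).trans (hf _ (by decide)))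
      have e2 : κ .edgeVar = σ .edgeVar := (hf' _ (by decide)).trans
        ((ArrState.upd_of_ne _ (by decide) _ _).trans (hf _ (by decide)))
      have e3 : κ .edgeClause = σ .edgeClause := (hf' _ (by decide)).trans
        ((ArrState.upd_of_ne _ (by decide) _ _).trans (hf _ (by decide)))
      have e4 : κ .index = σ .index := (hf' _ (by decide)).trans
        ((ArrState.upd_of_ne _ (by decide) _ _).trans (hf _ (by decide)))
      have e5 : κ .piece = σ .piece := (hf' _ (by decide)).trans
        ((ArrState.upd_of_ne _ (by decide) _ _).trans (hf _ (by decide)))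
      have e6 : κ .label 0 = t := by rw [hf' _ (by decide)]; simp
      have skip : ∀ κ' : ArrState, κ' .lastSeen x = κ .lastSeen x → κ' .count x = κ .count x →
          ((s < σ .numEdges 0 ∧ σ .edgeVar s = x ∧ EdgeIn σ (t + 1) s) → κ .lastSeen x = t + 1) →
          ((∃ e < s + 1, e < σ .numEdges 0 ∧ σ .edgeVar e = x ∧ EdgeIn σ (t + 1) e) →
            κ' .lastSeen x = t + 1 ∧
            κ' .count x = E.read 0 * ((Finset.Icc 1 t).filter fun l => Z l x).card + E.read 0) ∧
          ((¬ ∃ e < s + 1, e < σ .numEdges 0 ∧ σ .edgeVar e = x ∧ EdgeIn σ (t + 1) e) →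
            κ' .lastSeen x ≤ t ∧
            κ' .count x = E.read 0 * ((Finset.Icc 1 t).filter fun l => Z l x).card) := by
        intro κ' h1 h2 h3
        rw [h1, h2]
        refine ⟨fun ⟨e, he, h4⟩ => ?_, fun h => (ih' x hx).2 fun ⟨e, he, h4⟩ => h ⟨e, by omega, h4⟩⟩
        by_cases hex : ∃ e < s, e < σ .numEdges 0 ∧ σ .edgeVar e = x ∧ EdgeIn σ (t + 1) e
        · exact (ih' x hx).1 hex
        · rcases Nat.lt_succ_iff_lt_or_eq.1 he with he | rfl
          · exact absurd ⟨e, he, h4⟩ hex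
          · have := h3 h4
            have := ((ih' x hx).2 hex).1
            omega
      by_cases hs : s < σ .numEdges 0
      swap
      · rw [run_whenLt_neg (by simpa [e1] using hs)]
        exact skip _ (by simp) (by simp) (fun h => absurd h.1 hs)
      rw [run_whenLt_pos (by simpa [e1] using hs)]
      have hcode : σ .edgeClause s + σ .edgeClause s + 1 = 2 * σ .edgeClause s + 1 := by omega
      by_cases hi : σ .index (2 * σ .edgeClause s + 1) = 0
      · rw [run_ite_neg (by simpa [e3, e4, hcode] using hi)]
        exact skip _ (by simp [ArrProg.run]) (by simp [ArrProg.run]) (fun h => absurd hi h.2.2.1)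
      rw [run_ite_pos (by simpa [e3, e4, hcode] using hi)]
      by_cases hp : σ .piece (σ .index (2 * σ .edgeClause s + 1) - 1) = t + 1
      swap
      · rw [run_whenEq_neg (by simpa [e3, e4, e5, e6, hcode] using hp)]
        exact skip _ (by simp) (by simp) (fun h => absurd h.2.2.2 hp)
      rw [run_whenEq_pos (by simpa [e3, e4, e5, e6, hcode] using hp)]
      by_cases hl : κ .lastSeen (σ .edgeVar s) = t + 1
      · rw [run_whenNe_neg (by simpa [e2, e6] using hl)]
        exact skip _ (by simp) (by simp) (fun h => by rw [← h.2.1]; exact hl)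
      rw [run_whenNe_pos (by simpa [e2, e6] using hl)]
      simp only [run_seqs_cons, run_seqs_nil, run_store]
      by_cases hxs : x = σ .edgeVar s
      · subst hxs
        have hold : ¬ ∃ e < s, e < σ .numEdges 0 ∧ σ .edgeVar e = σ .edgeVar s ∧
            EdgeIn σ (t + 1) e := fun hex => hl ((ih' _ hx).1 hex).1
        refine ⟨fun _ => ?_, fun h => absurd ⟨s, by omega, hs, rfl, hi, hp⟩ h⟩
        have := ((ih' _ hx).2 hold).2
        simp [e2, e6, this]
      · refine skip _ ?_ ?_ (fun h => absurd h.2.1.symm hxs)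
        · simp [e2, hxs]
        · simp [e2, hxs]

/-! ### Selecting candidates -/

/-- Selects up to `quota` variables for which the count is at least the threshold. -/
def chooseVariables : ArrProg :=
  seqs [set .numChosen (.const 0), .rep .edge (whenLt (sc .edge) (sc .numEdges)
    (whenEq (.arr .chosen edgeVariable) (.const 0)
      (whenLt (sc .threshold) (.add (.arr .count edgeVariable) (.const 1))
        (whenLt (sc .numChosen) .quota
          (seqs [.store .chosen edgeVariable (.const 1),
            .store .choice (sc .numChosen) edgeVariable,
            set .numChosen (.add (sc .numChosen) (.const 1))])))))]

/-- The set of the first `n` entries of an array. -/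
def firstEntries (f : ℕ → ℕ) (n : ℕ) : Finset ℕ := (Finset.range n).image f

theorem mem_firstEntries {f : ℕ → ℕ} {n x : ℕ} : x ∈ firstEntries f n ↔ ∃ i < n, f i = x := by
  simp [firstEntries]

theorem run_chooseVariables (E : ArrEnv) (σ : ArrState) (hN : σ .numEdges 0 ≤ E.size)
    (h0 : ∀ x, IsEdgeVar σ x → σ .chosen x = 0) {ρ : ArrState}
    (hρ : ρ = chooseVariables.run E σ) {Q : Finset ℕ}
    (hQ : Q = firstEntries (ρ .choice) (ρ .numChosen 0)) :
    Q.card = ρ .numChosen 0 ∧ ρ .numChosen 0 ≤ E.quota ∧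
      (∀ x, IsEdgeVar σ x → (ρ .chosen x ≠ 0 ↔ x ∈ Q)) ∧
      (∀ x ∈ Q, IsEdgeVar σ x ∧ σ .threshold 0 ≤ σ .count x) ∧
      (ρ .numChosen 0 < E.quota → ∀ x, IsEdgeVar σ x → σ .threshold 0 ≤ σ .count x → x ∈ Q) := by
  unfold chooseVariables at hρ
  simp only [run_seqs_cons, run_seqs_nil, run_set] at hρ
  have key := ArrProg.rep_induction_frame (E := E) (a := .edge)
    (σ := σ.upd .numChosen 0 ((ArrExpr.const 0).val E σ))
    (c := whenLt (sc .edge) (sc .numEdges)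
    (whenEq (.arr .chosen edgeVariable) (.const 0)
      (whenLt (sc .threshold) (.add (.arr .count edgeVariable) (.const 1))
        (whenLt (sc .numChosen) .quota
          (seqs [.store .chosen edgeVariable (.const 1),
            .store .choice (sc .numChosen) edgeVariable,
            set .numChosen (.add (sc .numChosen) (.const 1))])))))
    (fun t τ => ∃ Q, Q = firstEntries (τ .choice) (τ .numChosen 0) ∧
      Q.card = τ .numChosen 0 ∧ τ .numChosen 0 ≤ E.quota ∧
      (∀ x, IsEdgeVar σ x → (τ .chosen x ≠ 0 ↔ x ∈ Q)) ∧
      (∀ x ∈ Q, IsEdgeVar σ x ∧ σ .threshold 0 ≤ σ .count x) ∧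
      (τ .numChosen 0 < E.quota → ∀ e < t, e < σ .numEdges 0 →
        σ .threshold 0 ≤ σ .count (σ .edgeVar e) → σ .edgeVar e ∈ Q)) ?_ ?_
  · rw [← hρ] at key
    obtain ⟨Q', hQ', h1, h2, h3, h4, h5⟩ := key
    rw [← hQ] at hQ'
    subst hQ'
    refine ⟨h1, h2, h3, h4, ?_⟩
    rintro h x ⟨e, he, rfl⟩ hx
    exact h5 h e (by omega) he hx
  · refine ⟨∅, by simp [firstEntries], by simp, by simp, fun x hx => ?_, by simp, by simp⟩
    simpa using h0 x hx
  · rintro t _ τ hf ⟨Q, hQ, h1, h2, h3, h4, h5⟩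
    have f1 : τ .numEdges = σ .numEdges := (hf _ (by decide)).trans (ArrState.upd_of_ne _ (by decide) _ _)
    have f2 : τ .edgeVar = σ .edgeVar := (hf _ (by decide)).trans (ArrState.upd_of_ne _ (by decide) _ _)
    have f3 : τ .threshold = σ .threshold :=
      (hf _ (by decide)).trans (ArrState.upd_of_ne _ (by decide) _ _)
    have f4 : τ .count = σ .count := (hf _ (by decide)).trans (ArrState.upd_of_ne _ (by decide) _ _)
    have skip : ∀ τ' : ArrState, τ' .choice = τ .choice → τ' .numChosen = τ .numChosen →
        τ' .chosen = τ .chosen →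
        (τ .numChosen 0 < E.quota → t < σ .numEdges 0 →
          σ .threshold 0 ≤ σ .count (σ .edgeVar t) → σ .edgeVar t ∈ Q) →
        ∃ Q, Q = firstEntries (τ' .choice) (τ' .numChosen 0) ∧
          Q.card = τ' .numChosen 0 ∧ τ' .numChosen 0 ≤ E.quota ∧
          (∀ x, IsEdgeVar σ x → (τ' .chosen x ≠ 0 ↔ x ∈ Q)) ∧
          (∀ x ∈ Q, IsEdgeVar σ x ∧ σ .threshold 0 ≤ σ .count x) ∧
          (τ' .numChosen 0 < E.quota → ∀ e < t + 1, e < σ .numEdges 0 →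
            σ .threshold 0 ≤ σ .count (σ .edgeVar e) → σ .edgeVar e ∈ Q) := by
      intro τ' g1 g2 g3 g4
      rw [g1, g2, g3]
      refine ⟨Q, hQ, h1, h2, h3, h4, fun h e he he' hc => ?_⟩
      rcases Nat.lt_succ_iff_lt_or_eq.1 he with he | rfl
      · exact h5 h e he he' hc
      · exact g4 h he' hc
    have up : ∀ a, a ≠ .edge → τ.upd .edge 0 t a = τ a := fun a ha => ArrState.upd_of_ne _ ha _ _
    by_cases ht : t < σ .numEdges 0
    swap
    · rw [run_whenLt_neg (by simpa [f1] using ht)]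
      exact skip _ (up _ (by decide)) (up _ (by decide)) (up _ (by decide)) (fun _ h => absurd h ht)
    rw [run_whenLt_pos (by simpa [f1] using ht)]
    have hev : IsEdgeVar σ (σ .edgeVar t) := ⟨t, ht, rfl⟩
    by_cases hch : τ .chosen (σ .edgeVar t) = 0
    swap
    · rw [run_whenEq_neg (by simpa [f2] using hch)]
      exact skip _ (up _ (by decide)) (up _ (by decide)) (up _ (by decide))
        (fun _ _ _ => (h3 _ hev).1 hch)
    rw [run_whenEq_pos (by simpa [f2] using hch)]
    by_cases hth : σ .threshold 0 ≤ σ .count (σ .edgeVar t)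
    swap
    · rw [run_whenLt_neg (by simp [f2, f3, f4]; omega)]
      exact skip _ (up _ (by decide)) (up _ (by decide)) (up _ (by decide))
        (fun _ _ h => absurd h hth)
    rw [run_whenLt_pos (by simp [f2, f3, f4]; omega)]
    by_cases hq : τ .numChosen 0 < E.quota
    swap
    · rw [run_whenLt_neg (by simpa using hq)]
      exact skip _ (up _ (by decide)) (up _ (by decide)) (up _ (by decide)) (fun h => absurd h hq)
    rw [run_whenLt_pos (by simpa using hq)]
    have hnQ : σ .edgeVar t ∉ Q := fun h => (h3 _ hev).2 h hch
    simp only [run_seqs_cons, run_seqs_nil, run_set, run_store]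
    refine ⟨insert (σ .edgeVar t) Q, ?_, ?_, ?_, ?_, ?_, ?_⟩
    · ext x
      rw [Finset.mem_insert, hQ, mem_firstEntries, mem_firstEntries]
      simp only [ArrState.upd_apply, reduceCtorEq, false_and, if_false, true_and, val, and_false,
        if_true, and_true, f2]
      constructor
      · rintro (rfl | ⟨i, hi, rfl⟩)
        · exact ⟨τ .numChosen 0, by omega, by rw [if_pos rfl]⟩
        · exact ⟨i, by omega, by rw [if_neg (by omega)]⟩
      · rintro ⟨i, hi, rfl⟩
        by_cases hi' : i = τ .numChosen 0
        · left; rw [if_pos hi']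
        · right; exact ⟨i, by omega, by rw [if_neg hi']⟩
    · rw [Finset.card_insert_of_notMem hnQ, h1]; simp
    · simp; omega
    · intro x hx
      rw [Finset.mem_insert, ← h3 x hx]
      by_cases hxe : x = σ .edgeVar t
      · simp [f2, hxe]
      · simp [f2, hxe]
    · intro x hx
      rcases Finset.mem_insert.1 hx with rfl | hx
      · exact ⟨hev, hth⟩
      · exact h4 x hx
    · intro _ e he he' hc
      rcases Nat.lt_succ_iff_lt_or_eq.1 he with he | rfl
      · exact Finset.mem_insert_of_mem (h5 hq e he he' hc)
      · exact Finset.mem_insert_self _ _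

/-! ### Collecting candidates in the vertices of the forest -/

/-- The set stored in three slots: `0` stands for an empty slot, and `x + 1` for the variable `x`. -/
def slotVars (a b c : ℕ) : Finset ℕ := (({a, b, c} : Finset ℕ).erase 0).image (· - 1)

theorem mem_slotVars {a b c x : ℕ} : x ∈ slotVars a b c ↔ a = x + 1 ∨ b = x + 1 ∨ c = x + 1 := by
  simp only [slotVars, Finset.mem_image, Finset.mem_erase, Finset.mem_insert, Finset.mem_singleton]
  constructor
  · rintro ⟨y, ⟨hy, h⟩, rfl⟩
    omega
  · intro h
    exact ⟨x + 1, ⟨by omega, by omega⟩, by omega⟩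

/-- The slots are filled from left to right, with distinct values. -/
def GoodSlots (a b c : ℕ) : Prop := (b ≠ 0 → a ≠ 0 ∧ a ≠ b) ∧ (c ≠ 0 → b ≠ 0 ∧ c ≠ a ∧ c ≠ b)

theorem GoodSlots.card {a b c : ℕ} (h : GoodSlots a b c) :
    (slotVars a b c).card ≤ 3 ∧ ((slotVars a b c).card = 3 ↔ c ≠ 0) := by
  have himg : (slotVars a b c).card = (({a, b, c} : Finset ℕ).erase 0).card := by
    unfold slotVars
    refine Finset.card_image_of_injOn ?_
    intro x hx y hy hxy
    simp only [Finset.coe_erase, Set.mem_sdiff, Set.mem_singleton_iff] at hx hy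
    simp only at hxy
    omega
  rw [himg]
  by_cases hc : c = 0
  · have : ({a, b, c} : Finset ℕ).erase 0 ⊆ {a, b} := by
      intro x hx
      simp only [Finset.mem_erase, Finset.mem_insert, Finset.mem_singleton] at hx ⊢
      omega
    have := (Finset.card_le_card this).trans Finset.card_le_two
    exact ⟨by omega, ⟨fun h => by omega, fun h => absurd hc h⟩⟩
  · have hb := (h.2 hc).1
    have ha := (h.1 hb).1
    rw [Finset.erase_eq_of_notMem (by simp; omega)]
    have : ({a, b, c} : Finset ℕ).card = 3 :=
      Finset.card_eq_three.2 ⟨a, b, c, (h.1 hb).2, Ne.symm (h.2 hc).2.1, Ne.symm (h.2 hc).2.2, rfl⟩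
    rw [this]
    exact ⟨le_rfl, fun _ => hc, fun _ => rfl⟩

/-- The variables collected at the vertex number `v`. -/
def slots (σ : ArrState) (v : ℕ) : Finset ℕ := slotVars (σ .open1 v) (σ .open2 v) (σ .open3 v)

/-- The slots of the vertex number `v` are well-formed. -/
def GoodAt (σ : ArrState) (v : ℕ) : Prop := GoodSlots (σ .open1 v) (σ .open2 v) (σ .open3 v)

/-- Adds the candidate `cand` to the slots of the vertex number `host`, if there is an empty slot
and the candidate is new. -/
def insertCandidate : ArrProg :=
  whenNe (.arr .open1 (sc .host)) (sc .cand) (whenNe (.arr .open2 (sc .host)) (sc .cand)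
    (whenNe (.arr .open3 (sc .host)) (sc .cand)
      (.ite (.arr .open1 (sc .host))
        (.ite (.arr .open2 (sc .host))
          (.ite (.arr .open3 (sc .host)) .skip
            (seqs [.store .open3 (sc .host) (sc .cand), set .changed (.const 1)]))
          (seqs [.store .open2 (sc .host) (sc .cand), set .changed (.const 1)]))
        (seqs [.store .open1 (sc .host) (sc .cand), set .changed (.const 1)]))))

theorem run_insertCandidate (E : ArrEnv) (σ : ArrState) {p x : ℕ} (hp : σ .host 0 = p)
    (hx : σ .cand 0 = x + 1) (hg : GoodAt σ p) {ρ : ArrState} (hρ : ρ = insertCandidate.run E σ) :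
    GoodAt ρ p ∧ (∀ v, v ≠ p → slots ρ v = slots σ v ∧ (GoodAt σ v → GoodAt ρ v) ∧
      ρ .open1 v = σ .open1 v ∧ ρ .open2 v = σ .open2 v ∧ ρ .open3 v = σ .open3 v) ∧
    ((slots ρ p = slots σ p ∧ (x ∈ slots σ p ∨ (slots σ p).card = 3) ∧
        ρ .changed 0 = σ .changed 0) ∨
      (slots ρ p = insert x (slots σ p) ∧ x ∉ slots σ p ∧ (slots σ p).card < 3 ∧
        ρ .changed 0 = 1)) := by
  have hcard := GoodSlots.card hg
  have h3 : (slots σ p).card = 3 ↔ σ .open3 p ≠ 0 := hcard.2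
  have hle : (slots σ p).card ≤ 3 := hcard.1
  have old : ρ = σ → (x ∈ slots σ p ∨ (slots σ p).card = 3) →
      GoodAt ρ p ∧ (∀ v, v ≠ p → slots ρ v = slots σ v ∧ (GoodAt σ v → GoodAt ρ v) ∧
        ρ .open1 v = σ .open1 v ∧ ρ .open2 v = σ .open2 v ∧ ρ .open3 v = σ .open3 v) ∧
      ((slots ρ p = slots σ p ∧ (x ∈ slots σ p ∨ (slots σ p).card = 3) ∧
          ρ .changed 0 = σ .changed 0) ∨
        (slots ρ p = insert x (slots σ p) ∧ x ∉ slots σ p ∧ (slots σ p).card < 3 ∧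
          ρ .changed 0 = 1)) := by
    rintro h h'
    subst h
    exact ⟨hg, fun v _ => ⟨rfl, id, rfl, rfl, rfl⟩, Or.inl ⟨rfl, h', rfl⟩⟩
  have new : ∀ a b c, ρ .open1 p = a → ρ .open2 p = b → ρ .open3 p = c →
      (∀ v, v ≠ p → ρ .open1 v = σ .open1 v ∧ ρ .open2 v = σ .open2 v ∧ ρ .open3 v = σ .open3 v) →
      GoodSlots a b c → slotVars a b c = insert x (slots σ p) → x ∉ slots σ p → σ .open3 p = 0 →
      ρ .changed 0 = 1 →
      GoodAt ρ p ∧ (∀ v, v ≠ p → slots ρ v = slots σ v ∧ (GoodAt σ v → GoodAt ρ v) ∧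
        ρ .open1 v = σ .open1 v ∧ ρ .open2 v = σ .open2 v ∧ ρ .open3 v = σ .open3 v) ∧
      ((slots ρ p = slots σ p ∧ (x ∈ slots σ p ∨ (slots σ p).card = 3) ∧
          ρ .changed 0 = σ .changed 0) ∨
        (slots ρ p = insert x (slots σ p) ∧ x ∉ slots σ p ∧ (slots σ p).card < 3 ∧
          ρ .changed 0 = 1)) := by
    rintro a b c rfl rfl rfl h1 h2 h3' h4 h5 h6
    refine ⟨h2, fun v hv => ?_, Or.inr ⟨h3', h4, lt_of_le_of_ne hle fun h => h3.1 h h5, h6⟩⟩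
    obtain ⟨e1, e2, e3⟩ := h1 v hv
    refine ⟨?_, ?_, e1, e2, e3⟩
    · unfold slots; rw [e1, e2, e3]
    · unfold GoodAt; rw [e1, e2, e3]; exact id
  unfold insertCandidate at hρ
  by_cases m1 : σ .open1 p = x + 1
  · rw [run_whenNe_neg (by simpa [hp, hx] using m1)] at hρ
    exact old hρ (Or.inl (mem_slotVars.2 (Or.inl m1)))
  rw [run_whenNe_pos (by simpa [hp, hx] using m1)] at hρ
  by_cases m2 : σ .open2 p = x + 1
  · rw [run_whenNe_neg (by simpa [hp, hx] using m2)] at hρ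
    exact old hρ (Or.inl (mem_slotVars.2 (Or.inr (Or.inl m2))))
  rw [run_whenNe_pos (by simpa [hp, hx] using m2)] at hρ
  by_cases m3 : σ .open3 p = x + 1
  · rw [run_whenNe_neg (by simpa [hp, hx] using m3)] at hρ
    exact old hρ (Or.inl (mem_slotVars.2 (Or.inr (Or.inr m3))))
  rw [run_whenNe_pos (by simpa [hp, hx] using m3)] at hρ
  have hnot : x ∉ slots σ p := fun h => by
    rcases mem_slotVars.1 h with h | h | h
    · exact m1 h
    · exact m2 h
    · exact m3 h
  obtain ⟨g1, g2⟩ := hg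
  by_cases o1 : σ .open1 p = 0
  · rw [run_ite_neg (by simpa [hp] using o1)] at hρ
    simp only [run_seqs_cons, run_seqs_nil, run_set, run_store] at hρ
    have o2 : σ .open2 p = 0 := by by_contra h; exact (g1 h).1 o1
    have o3 : σ .open3 p = 0 := by by_contra h; exact (g2 h).1 o2
    refine new (x + 1) 0 0 (by simp [hρ, hp, hx]) (by simp [hρ, o2]) (by simp [hρ, o3]) ?_ ?_ ?_ hnot
      o3 (by simp [hρ])
    · intro v hv; simp [hρ, hp, hv]
    · exact ⟨fun h => absurd rfl h, fun h => absurd rfl h⟩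
    · ext y
      simp only [mem_slotVars, Finset.mem_insert, slots, o1, o2, o3]
      omega
  rw [run_ite_pos (by simpa [hp] using o1)] at hρ
  by_cases o2 : σ .open2 p = 0
  · rw [run_ite_neg (by simpa [hp] using o2)] at hρ
    simp only [run_seqs_cons, run_seqs_nil, run_set, run_store] at hρ
    have o3 : σ .open3 p = 0 := by by_contra h; exact (g2 h).1 o2
    refine new (σ .open1 p) (x + 1) 0 (by simp [hρ]) (by simp [hρ, hp, hx]) (by simp [hρ, o3])
      ?_ ?_ ?_ hnot o3 (by simp [hρ])
    · intro v hv; simp [hρ, hp, hv]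
    · exact ⟨fun h => ⟨o1, m1⟩, fun h => absurd rfl h⟩
    · ext y
      simp only [mem_slotVars, Finset.mem_insert, slots, o2, o3]
      omega
  rw [run_ite_pos (by simpa [hp] using o2)] at hρ
  by_cases o3 : σ .open3 p = 0
  · rw [run_ite_neg (by simpa [hp] using o3)] at hρ
    simp only [run_seqs_cons, run_seqs_nil, run_set, run_store] at hρ
    refine new (σ .open1 p) (σ .open2 p) (x + 1) (by simp [hρ]) (by simp [hρ])
      (by simp [hρ, hp, hx]) ?_ ?_ ?_ hnot o3 (by simp [hρ])
    · intro v hv; simp [hρ, hp, hv]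
    · exact ⟨g1, fun h => ⟨o2, Ne.symm m1, Ne.symm m2⟩⟩
    · ext y
      simp only [mem_slotVars, Finset.mem_insert, slots, o3]
      omega
  · rw [run_ite_pos (by simpa [hp] using o3)] at hρ
    exact old hρ (Or.inr (h3.2 o3))

/-- The state `σ` holds a refinement of the division `piece` of the forest `T`; see `Refinement`. -/
def Refines {H : ℕ → Finset ℕ} (T : Forest H) (piece : ℕ → ℕ) (Q : Finset ℕ) (σ : ArrState)
    (w : ℕ) : Prop :=
  (∀ v < T.n, GoodAt σ v) ∧ ∃ O link closed,
    Refinement T piece Q O link closed (σ .numClosed 0) w ∧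
    (∀ v < T.n, O v = slots σ v) ∧ (∀ v < T.n, link v ↔ σ .link v ≠ 0) ∧
    (∀ v < T.n, closed v = σ .closed v)

theorem Refines.congr {H : ℕ → Finset ℕ} {T : Forest H} {piece : ℕ → ℕ} {Q : Finset ℕ}
    {σ τ : ArrState} {w : ℕ} (h : Refines T piece Q σ w) (h1 : τ .open1 = σ .open1)
    (h2 : τ .open2 = σ .open2) (h3 : τ .open3 = σ .open3) (h4 : τ .link = σ .link)
    (h5 : τ .closed = σ .closed) (h6 : τ .numClosed = σ .numClosed) : Refines T piece Q τ w := by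
  have e : slots τ = slots σ := by funext v; unfold slots; rw [h1, h2, h3]
  have e' : GoodAt τ = GoodAt σ := by funext v; unfold GoodAt; rw [h1, h2, h3]
  unfold Refines
  rw [e, e', h4, h5, h6]
  exact h

/-- Resets the data about the vertices. -/
def resetVertices : ArrProg :=
  seqs [set .numClosed (.const 0), .rep .vert (seqs [.store .open1 (sc .vert) (.const 0),
    .store .open2 (sc .vert) (.const 0), .store .open3 (sc .vert) (.const 0),
    .store .link (sc .vert) (.const 0), .store .closed (sc .vert) (.const 0)])]

theorem run_resetVertices (E : ArrEnv) (σ : ArrState) {H : ℕ → Finset ℕ} (T : Forest H)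
    (hN : T.n ≤ E.size) (piece : ℕ → ℕ) (Q : Finset ℕ) :
    Refines T piece Q (resetVertices.run E σ) T.n := by
  unfold resetVertices
  simp only [run_seqs_cons, run_seqs_nil, run_set]
  have key := ArrProg.rep_induction_frame (E := E) (a := .vert)
    (σ := σ.upd .numClosed 0 ((ArrExpr.const 0).val E σ))
    (c := seqs [.store .open1 (sc .vert) (.const 0),
      .store .open2 (sc .vert) (.const 0), .store .open3 (sc .vert) (.const 0),
      .store .link (sc .vert) (.const 0), .store .closed (sc .vert) (.const 0)])
    (fun t τ => τ .numClosed 0 = 0 ∧ ∀ v < t, τ .open1 v = 0 ∧ τ .open2 v = 0 ∧ τ .open3 v = 0 ∧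
      τ .link v = 0 ∧ τ .closed v = 0) ?_ ?_
  · obtain ⟨h0, h⟩ := key
    set ρ := (ArrProg.rep .vert _).run E _ with hρ
    refine ⟨fun v hv => ?_, fun _ => ∅, fun _ => False, fun _ => 0, ?_, fun v hv => ?_,
      fun v hv => ?_, fun v hv => ?_⟩
    · obtain ⟨h1, h2, h3, -⟩ := h v (by omega)
      unfold GoodAt; rw [h1, h2, h3]
      exact ⟨fun h => absurd rfl h, fun h => absurd rfl h⟩
    · rw [h0]; exact Refinement.init T piece Q
    · obtain ⟨h1, h2, h3, -⟩ := h v (by omega)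
      unfold slots; rw [h1, h2, h3]; rfl
    · simp [(h v (by omega)).2.2.2.1]
    · exact (h v (by omega)).2.2.2.2.symm
  · simp
  · rintro t _ τ _ ⟨h0, h⟩
    simp only [run_seqs_cons, run_seqs_nil, run_store]
    refine ⟨by simpa using h0, fun v hv => ?_⟩
    rcases Nat.lt_succ_iff_lt_or_eq.1 hv with hv | rfl
    · obtain ⟨h1, h2, h3, h4, h5⟩ := h v hv
      simp [h1, h2, h3, h4, h5]
    · simp

/-- Collects the candidates in the clause at the vertex number `vert`. -/
def collectOwn : ArrProg :=
  seqs [set .host (sc .vert), .rep .edge (whenLt (sc .edge) (sc .numEdges)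
    (whenEq (.arr .index edgeCode) (.add (sc .vert) (.const 1))
      (.ite (.arr .chosen edgeVariable)
        (seqs [set .cand (.add edgeVariable (.const 1)), insertCandidate]) .skip)))]

section

variable {H : ℕ → Finset ℕ} {T : Forest H} {piece : ℕ → ℕ} {Q : Finset ℕ} (E : ArrEnv)
  (σ : ArrState)

theorem run_collectOwn (hS : Stores σ T) (hE : EdgesAre σ fun j x => x ∈ H j)
    (hN : σ .numEdges 0 ≤ E.size) (hQ : ∀ x, IsEdgeVar σ x → (σ .chosen x ≠ 0 ↔ x ∈ Q)) {v : ℕ}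
    (hv : σ .vert 0 = v) (hvn : v < T.n) (hR : Refines T piece Q σ (v + 1)) {ρ : ArrState}
    (hρ : ρ = collectOwn.run E σ) :
    Refines T piece Q ρ (v + 1) ∧
      (clauseAt H (T.node v) ∩ Q ⊆ slots ρ v ∨ (slots ρ v).card = 3) := by
  unfold collectOwn at hρ
  simp only [run_seqs_cons, run_seqs_nil, run_set] at hρ
  have key := ArrProg.rep_induction_frame (E := E) (a := .edge)
    (σ := σ.upd .host 0 ((sc .vert).val E σ))
    (c := whenLt (sc .edge) (sc .numEdges)
    (whenEq (.arr .index edgeCode) (.add (sc .vert) (.const 1))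
      (.ite (.arr .chosen edgeVariable)
        (seqs [set .cand (.add edgeVariable (.const 1)), insertCandidate]) .skip)))
    (fun t τ => Refines T piece Q τ (v + 1) ∧ ∀ e < t, e < σ .numEdges 0 →
      T.node v = 2 * σ .edgeClause e + 1 → σ .edgeVar e ∈ Q →
      σ .edgeVar e ∈ slots τ v ∨ (slots τ v).card = 3) ?_ ?_
  · rw [← hρ] at key
    obtain ⟨h1, h2⟩ := key
    refine ⟨h1, ?_⟩
    by_cases hc : (slots ρ v).card = 3
    · exact Or.inr hc
    · refine Or.inl fun x hx => ?_
      rw [Finset.mem_inter] at hx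
      obtain ⟨j, hj, hxj⟩ := exists_of_mem_clauseAt hx.1
      obtain ⟨e, he, rfl, rfl⟩ := (hE j x).1 hxj
      exact (h2 e (by omega) he hj hx.2).resolve_right hc
  · refine ⟨hR.congr ?_ ?_ ?_ ?_ ?_ ?_, fun e he => absurd he (by omega)⟩
    all_goals exact ArrState.upd_of_ne _ (by decide) _ _
  · rintro t _ τ hf ⟨ih1, ih2⟩
    have f : ∀ a, a ∉ (ArrProg.rep .edge (whenLt (sc .edge) (sc .numEdges)
        (whenEq (.arr .index edgeCode) (.add (sc .vert) (.const 1))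
          (.ite (.arr .chosen edgeVariable)
            (seqs [set .cand (.add edgeVariable (.const 1)), insertCandidate]) .skip)))).mods →
        a ≠ .host → τ a = σ a := fun a h h' => (hf a h).trans (ArrState.upd_of_ne _ h' _ _)
    have f1 : τ .numEdges = σ .numEdges := f _ (by decide) (by decide)
    have f2 : τ .edgeVar = σ .edgeVar := f _ (by decide) (by decide)
    have f3 : τ .edgeClause = σ .edgeClause := f _ (by decide) (by decide)
    have f4 : τ .index = σ .index := f _ (by decide) (by decide)
    have f5 : τ .chosen = σ .chosen := f _ (by decide) (by decide)
    have f6 : τ .vert 0 = v := by rw [f _ (by decide) (by decide), hv]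
    have f7 : τ .host 0 = v := by rw [hf _ (by decide)]; simp [hv]
    have up : ∀ a, a ≠ .edge → τ.upd .edge 0 t a = τ a := fun a ha => ArrState.upd_of_ne _ ha _ _
    have skip : (t < σ .numEdges 0 → T.node v = 2 * σ .edgeClause t + 1 → σ .edgeVar t ∉ Q) →
        Refines T piece Q (τ.upd .edge 0 t) (v + 1) ∧ ∀ e < t + 1, e < σ .numEdges 0 →
          T.node v = 2 * σ .edgeClause e + 1 → σ .edgeVar e ∈ Q →
          σ .edgeVar e ∈ slots (τ.upd .edge 0 t) v ∨ (slots (τ.upd .edge 0 t) v).card = 3 := by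
      intro h
      refine ⟨ih1.congr (up _ (by decide)) (up _ (by decide)) (up _ (by decide)) (up _ (by decide))
        (up _ (by decide)) (up _ (by decide)), fun e he he' h1 h2 => ?_⟩
      have es : slots (τ.upd .edge 0 t) v = slots τ v := by
        unfold slots; rw [up _ (by decide), up _ (by decide), up _ (by decide)]
      rw [es]
      rcases Nat.lt_succ_iff_lt_or_eq.1 he with he | rfl
      · exact ih2 e he he' h1 h2
      · exact absurd h2 (h he' h1)
    by_cases ht : t < σ .numEdges 0
    swap
    · rw [run_whenLt_neg (by simpa [f1] using ht)]
      exact skip fun h => absurd h ht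
    rw [run_whenLt_pos (by simpa [f1] using ht)]
    have hcode : σ .edgeClause t + σ .edgeClause t + 1 = 2 * σ .edgeClause t + 1 := by omega
    by_cases hi : σ .index (2 * σ .edgeClause t + 1) = v + 1
    swap
    · rw [run_whenEq_neg (by simpa [f3, f4, f6, hcode] using hi)]
      exact skip fun _ h => absurd ((hS.index_eq_iff _ hvn).2 h) hi
    rw [run_whenEq_pos (by simpa [f3, f4, f6, hcode] using hi)]
    rw [hS.index_eq_iff _ hvn] at hi
    have hiff := hQ (σ .edgeVar t) ⟨t, ht, rfl⟩
    by_cases hc : σ .chosen (σ .edgeVar t) = 0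
    · rw [run_ite_neg (by simpa [f2, f5] using hc)]
      exact skip fun _ _ h => hiff.2 h hc
    rw [run_ite_pos (by simpa [f2, f5] using hc)]
    have hxQ := hiff.1 hc
    simp only [run_seqs_cons, run_seqs_nil, run_set]
    set κ : ArrState := (τ.upd .edge 0 t).upd .cand 0 _ with hκ
    have g : ∀ a, a ≠ .edge → a ≠ .cand → κ a = τ a := fun a h1 h2 =>
      (ArrState.upd_of_ne _ h2 _ _).trans (ArrState.upd_of_ne _ h1 _ _)
    have gs : slots κ = slots τ := by
      funext u; unfold slots
      rw [g _ (by decide) (by decide), g _ (by decide) (by decide), g _ (by decide) (by decide)]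
    have gg : GoodAt κ = GoodAt τ := by
      funext u; unfold GoodAt
      rw [g _ (by decide) (by decide), g _ (by decide) (by decide), g _ (by decide) (by decide)]
    obtain ⟨hgood, O, link, closed, hR', hO, hl, hcl⟩ := ih1
    obtain ⟨c1, c2, c3⟩ := run_insertCandidate E κ (p := v) (x := σ .edgeVar t)
      (by rw [g _ (by decide) (by decide), f7]) (by simp [hκ, f2]) (by rw [gg]; exact hgood v hvn) rfl
    set μ := insertCandidate.run E κ with hμ
    have fr : ∀ a, a ∉ insertCandidate.mods → a ≠ .edge → a ≠ .cand → μ a = τ a := fun a h h1 h2 =>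
      (ArrProg.run_frame _ _ h).trans (g a h1 h2)
    have m1 : μ .link = τ .link := fr _ (by decide) (by decide) (by decide)
    have m2 : μ .closed = τ .closed := fr _ (by decide) (by decide) (by decide)
    have m3 : μ .numClosed = τ .numClosed := fr _ (by decide) (by decide) (by decide)
    rw [gs] at c2 c3
    rw [gg] at c2
    have hgood' : ∀ u < T.n, GoodAt μ u := by
      intro u hu
      by_cases huv : u = v
      · rw [huv]; exact c1
      · exact (c2 u huv).2.1 (hgood u hu)
    have hsub : slots τ v ⊆ slots μ v ∧ (σ .edgeVar t ∈ slots μ v ∨ (slots μ v).card = 3) := by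
      rcases c3 with ⟨d1, d2, -⟩ | ⟨d1, -, -, -⟩
      · rw [d1]; exact ⟨le_rfl, d2⟩
      · rw [d1]; exact ⟨Finset.subset_insert _ _, Or.inl (Finset.mem_insert_self _ _)⟩
    refine ⟨⟨hgood', ?_⟩, fun e he he' h1 h2 => ?_⟩
    · rw [m1, m2, m3]
      rcases c3 with ⟨d1, d2, -⟩ | ⟨d1, d2, d3, -⟩
      · refine ⟨O, link, closed, hR', fun u hu => ?_, hl, hcl⟩
        rw [hO u hu]
        by_cases huv : u = v
        · rw [huv, d1]
        · rw [(c2 u huv).1]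
      · refine ⟨_, link, closed, hR'.insert (v := v) (x := σ .edgeVar t) (by omega) hvn ?_ hxQ
          (by rw [hO v hvn]; exact d3), fun u hu => ?_, hl, hcl⟩
        · rw [hi, clauseAt_clause]
          exact (hE _ _).2 ⟨t, ht, rfl, rfl⟩
        · by_cases huv : u = v
          · rw [huv, Function.update_self, hO v hvn, d1]
          · rw [Function.update_of_ne huv, hO u hu, (c2 u huv).1]
    · rcases Nat.lt_succ_iff_lt_or_eq.1 he with he | rfl
      · rcases ih2 e he he' h1 h2 with h3 | h3
        · exact Or.inl (hsub.1 h3)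
        · right
          have h4 := (GoodSlots.card (hgood' v hvn)).1
          have h5 := Finset.card_le_card hsub.1
          change (slots μ v).card ≤ 3 at h4
          omega
      · exact hsub.2

/-- Passes the candidate in one slot of the vertex number `vert` on to the vertex number `host`. -/
def passSlot (a : Arr) : ArrProg :=
  .ite (.arr a (sc .vert)) (seqs [set .cand (.arr a (sc .vert)), insertCandidate]) .skip

theorem run_passSlot (a : Arr) (ha : a = .open1 ∨ a = .open2) {v p : ℕ} (hv : σ .vert 0 = v)
    (hp : σ .host 0 = p) (hg : GoodAt σ p) {ρ : ArrState}
    (hρ : ρ = (passSlot a).run E σ) :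
    GoodAt ρ p ∧ (∀ u, u ≠ p → slots ρ u = slots σ u ∧ (GoodAt σ u → GoodAt ρ u) ∧
      ρ .open1 u = σ .open1 u ∧ ρ .open2 u = σ .open2 u ∧ ρ .open3 u = σ .open3 u) ∧
    slots σ p ⊆ slots ρ p ∧ (∀ x ∈ slots ρ p, x ∈ slots σ p ∨ σ a v = x + 1) ∧
    (∀ x, σ a v = x + 1 → x ∈ slots ρ p ∨ (slots ρ p).card = 3) ∧
    (ρ .changed 0 ≠ 0 ↔ σ .changed 0 ≠ 0 ∨ slots ρ p ≠ slots σ p) := by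
  have hane : a ≠ .cand := by rcases ha with rfl | rfl <;> decide
  unfold passSlot at hρ
  by_cases h0 : σ a v = 0
  · rw [run_ite_neg (by simpa [hv] using h0)] at hρ
    change ρ = σ at hρ
    subst hρ
    exact ⟨hg, fun u _ => ⟨rfl, id, rfl, rfl, rfl⟩, le_rfl, fun x hx => Or.inl hx,
      fun x hx => by omega, by simp⟩
  · rw [run_ite_pos (by simpa [hv] using h0)] at hρ
    simp only [run_seqs_cons, run_seqs_nil, run_set] at hρ
    set κ : ArrState := σ.upd .cand 0 _ with hκ
    have g : ∀ b, b ≠ .cand → κ b = σ b := fun b h => ArrState.upd_of_ne _ h _ _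
    have gs : slots κ = slots σ := by
      funext u; unfold slots; rw [g _ (by decide), g _ (by decide), g _ (by decide)]
    have gg : GoodAt κ = GoodAt σ := by
      funext u; unfold GoodAt; rw [g _ (by decide), g _ (by decide), g _ (by decide)]
    obtain ⟨x, hx⟩ : ∃ x, σ a v = x + 1 := ⟨σ a v - 1, by omega⟩
    obtain ⟨c1, c2, c3⟩ := run_insertCandidate E κ (p := p) (x := x)
      (by rw [g _ (by decide), hp]) (by simp [hκ, hv, hx]) (by rw [gg]; exact hg) hρ
    rw [gs] at c2 c3
    rw [gg, g _ (by decide), g _ (by decide), g _ (by decide)] at c2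
    rw [g _ (by decide)] at c3
    refine ⟨c1, c2, ?_⟩
    rcases c3 with ⟨d1, d2, d3⟩ | ⟨d1, d2, d3, d4⟩
    · rw [d1, d3]
      refine ⟨le_rfl, fun y hy => Or.inl hy, fun y hy => ?_, by simp⟩
      rw [show y = x by omega]; exact d2
    · rw [d1, d4]
      refine ⟨Finset.subset_insert _ _, fun y hy => ?_, fun y hy => ?_, ?_⟩
      · rcases Finset.mem_insert.1 hy with rfl | hy
        · exact Or.inr hx
        · exact Or.inl hy
      · rw [show y = x by omega]; exact Or.inl (Finset.mem_insert_self _ _)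
      · refine ⟨fun _ => Or.inr fun h => d2 ?_, fun _ => one_ne_zero⟩
        rw [← h]; exact Finset.mem_insert_self _ _

/-- Processes the vertex number `vert`: closes it, or passes its candidates on to its parent. -/
def processVertex : ArrProg :=
  seqs [collectOwn,
    .ite (.arr .open3 (sc .vert))
      (seqs [set .numClosed (.add (sc .numClosed) (.const 1)),
        .store .closed (sc .vert) (sc .numClosed)])
      (seqs [set .host (.arr .parent (sc .vert)),
        whenNe (sc .host) (sc .vert)
          (whenEq (.arr .piece (sc .host)) (.arr .piece (sc .vert))
            (seqs [set .changed (.const 0), passSlot .open1, passSlot .open2,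
              .ite (sc .changed) (.store .link (sc .vert) (.const 1)) .skip]))])]

theorem run_processVertex (hS : Stores σ T) (hE : EdgesAre σ fun j x => x ∈ H j)
    (hN : σ .numEdges 0 ≤ E.size) (hQ : ∀ x, IsEdgeVar σ x → (σ .chosen x ≠ 0 ↔ x ∈ Q)) {v : ℕ}
    (hv : σ .vert 0 = v) (hvn : v < T.n) (hpiece : piece = σ .piece) (h0 : piece v ≠ 0)
    (hR : Refines T piece Q σ (v + 1)) :
    Refines T piece Q (processVertex.run E σ) v := by
  unfold processVertex
  simp only [run_seqs_cons, run_seqs_nil]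
  obtain ⟨r1, r2⟩ := run_collectOwn E σ hS hE hN hQ hv hvn hR rfl
  set τ := collectOwn.run E σ with hτ
  have f1 : τ .vert 0 = v := by rw [hτ, ArrProg.run_frame _ _ (by decide), hv]
  have f2 : τ .parent v = T.parent v := by
    rw [hτ, ArrProg.run_frame _ _ (by decide), hS.parent v hvn]
  have f3 : τ .piece = piece := by rw [hτ, ArrProg.run_frame _ _ (by decide), hpiece]
  obtain ⟨hgood, O, link, closed, hR', hO, hl, hcl⟩ := r1
  have h3 : (slots τ v).card = 3 ↔ τ .open3 v ≠ 0 := (GoodSlots.card (hgood v hvn)).2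
  have hle : (slots τ v).card ≤ 3 := (GoodSlots.card (hgood v hvn)).1
  by_cases ho : τ .open3 v = 0
  swap
  · rw [run_ite_pos (by simpa [f1] using ho)]
    simp only [run_seqs_cons, run_seqs_nil, run_set, run_store]
    set κ : ArrState := (τ.upd .numClosed 0 _).upd .closed _ _ with hκ
    have g : ∀ b, b ≠ .numClosed → b ≠ .closed → κ b = τ b := fun b h h' =>
      (ArrState.upd_of_ne _ h' _ _).trans (ArrState.upd_of_ne _ h _ _)
    have gs : slots κ = slots τ := by
      funext u; unfold slots
      rw [g _ (by decide) (by decide), g _ (by decide) (by decide), g _ (by decide) (by decide)]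
    have gg : GoodAt κ = GoodAt τ := by
      funext u; unfold GoodAt
      rw [g _ (by decide) (by decide), g _ (by decide) (by decide), g _ (by decide) (by decide)]
    have gn : κ .numClosed 0 = τ .numClosed 0 + 1 := by simp [hκ]
    unfold Refines
    rw [gs, gg, gn, g .link (by decide) (by decide)]
    refine ⟨hgood, O, link, _, hR'.close hvn h0 (by rw [hO v hvn]; exact h3.2 ho), hO, hl,
      fun u hu => ?_⟩
    by_cases huv : u = v
    · subst huv; simp [hκ, f1]
    · rw [Function.update_of_ne huv, hcl u hu]; simp [hκ, f1, huv]
  rw [run_ite_neg (by simpa [f1] using ho)]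
  have hlt : (slots τ v).card < 3 := lt_of_le_of_ne hle fun h => h3.1 h ho
  have hcl' : clauseAt H (T.node v) ∩ Q ⊆ O v := by
    rw [hO v hvn]; exact r2.resolve_right (by omega)
  have hlt' : (O v).card < 3 := by rw [hO v hvn]; exact hlt
  simp only [run_seqs_cons, run_seqs_nil, run_set]
  set κ : ArrState := τ.upd .host 0 _ with hκ
  have g : ∀ b, b ≠ .host → κ b = τ b := fun b h => ArrState.upd_of_ne _ h _ _
  have k1 : κ .host 0 = T.parent v := by simp [hκ, f1, f2]
  have k2 : κ .vert 0 = v := by rw [g _ (by decide), f1]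
  have k3 : κ .piece = piece := by rw [g _ (by decide), f3]
  have leave : T.IsTop piece v → Refines T piece Q κ v := by
    intro htop
    have : Refines T piece Q τ v :=
      ⟨hgood, O, link, closed, hR'.leave hcl' hlt' htop, hO, hl, hcl⟩
    exact this.congr (g _ (by decide)) (g _ (by decide)) (g _ (by decide)) (g _ (by decide))
      (g _ (by decide)) (g _ (by decide))
  by_cases hpv : T.parent v = v
  · rw [run_whenNe_neg (by simpa [k1, k2] using hpv)]
    exact leave (Or.inl hpv)
  rw [run_whenNe_pos (by simpa [k1, k2] using hpv)]
  by_cases hpp : piece (T.parent v) = piece v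
  swap
  · rw [run_whenEq_neg (by simpa [k1, k2, k3] using hpp)]
    exact leave (Or.inr hpp)
  rw [run_whenEq_pos (by simpa [k1, k2, k3] using hpp)]
  simp only [run_seqs_cons, run_seqs_nil, run_set]
  set p := T.parent v with hp
  have hpn : p < T.n := (T.parent_le v hvn).trans_lt hvn
  set μ : ArrState := κ.upd .changed 0 _ with hμ
  have gm : ∀ b, b ≠ .host → b ≠ .changed → μ b = τ b := fun b h h' =>
    (ArrState.upd_of_ne _ h' _ _).trans (g b h)
  have gs : slots μ = slots τ := by
    funext u; unfold slots
    rw [gm _ (by decide) (by decide), gm _ (by decide) (by decide), gm _ (by decide) (by decide)]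
  have gg : GoodAt μ = GoodAt τ := by
    funext u; unfold GoodAt
    rw [gm _ (by decide) (by decide), gm _ (by decide) (by decide), gm _ (by decide) (by decide)]
  obtain ⟨a1, a2, a3, a4, a5, a6⟩ := run_passSlot E μ .open1 (Or.inl rfl) (v := v) (p := p)
    (by rw [gm _ (by decide) (by decide), f1]) (by rw [hμ, ArrState.upd_of_ne _ (by decide), k1])
    (by rw [gg]; exact hgood p hpn) rfl
  set μ₁ := (passSlot .open1).run E μ with hμ₁
  have e1 : μ₁ .vert 0 = v := by
    rw [hμ₁, ArrProg.run_frame _ _ (by decide), gm _ (by decide) (by decide), f1]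
  have e2 : μ₁ .host 0 = p := by
    rw [hμ₁, ArrProg.run_frame _ _ (by decide), hμ, ArrState.upd_of_ne _ (by decide), k1]
  obtain ⟨b1, b2, b3, b4, b5, b6⟩ := run_passSlot E μ₁ .open2 (Or.inr rfl) (v := v) (p := p)
    e1 e2 a1 rfl
  set μ₂ := (passSlot .open2).run E μ₁ with hμ₂
  have fr : ∀ a, a ∉ (passSlot .open1).mods → a ≠ .host → a ≠ .changed → μ₂ a = τ a := fun a h h1 h2 =>
    (ArrProg.run_frame (passSlot .open2) _ h).trans
      ((ArrProg.run_frame (passSlot .open1) _ h).trans (gm a h1 h2))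
  have m0 : μ₂ .vert 0 = v := by rw [fr _ (by decide) (by decide) (by decide), f1]
  rw [gs] at a2 a3 a4 a6
  rw [gg] at a2
  have hch0 : μ .changed 0 = 0 := by simp [hμ]
  rw [hch0] at a6
  have hs1 : μ .open1 v = τ .open1 v := by rw [gm _ (by decide) (by decide)]
  have hs2 : μ₁ .open2 v = τ .open2 v := by
    rw [(a2 v (Ne.symm hpv)).2.2.2.1, gm _ (by decide) (by decide)]
  rw [hs1] at a4 a5
  rw [hs2] at b4 b5
  have hgood₂ : ∀ u < T.n, GoodAt μ₂ u := by
    intro u hu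
    by_cases hup : u = p
    · rw [hup]; exact b1
    · exact (b2 u hup).2.1 ((a2 u hup).2.1 (hgood u hu))
  have hslots : ∀ u, u ≠ p → slots μ₂ u = slots τ u := fun u hu => by
    rw [(b2 u hu).1, (a2 u hu).1]
  have hchanged : μ₂ .changed 0 ≠ 0 ↔ slots μ₂ p ≠ slots τ p := by
    rw [b6, a6]
    constructor
    · rintro ((h | h) | h) he
      · exact h rfl
      · exact h (le_antisymm (he ▸ b3) a3)
      · exact h (le_antisymm (he ▸ a3) b3)
    · intro h
      by_contra hcon
      push Not at hcon
      exact h (hcon.2.trans hcon.1.2)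
  have hcard₂ : (slots μ₂ p).card ≤ 3 := (GoodSlots.card b1).1
  have hpass := hR'.pass hvn h0 hcl' hlt' hpv hpp (P := slots μ₂ p)
    (by rw [hO p hpn]; exact a3.trans b3)
    (by
      intro x hx
      rw [hO p hpn, hO v hvn, Finset.mem_union]
      rcases b4 x hx with h | h
      · rcases a4 x h with h | h
        · exact Or.inl h
        · exact Or.inr (mem_slotVars.2 (Or.inl h))
      · exact Or.inr (mem_slotVars.2 (Or.inr (Or.inl h))))
    hcard₂
    (by
      by_cases hc : (slots μ₂ p).card = 3
      · exact Or.inr hc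
      · refine Or.inl fun x hx => ?_
        rw [hO v hvn] at hx
        rcases mem_slotVars.1 hx with h | h | h
        · rcases a5 x h with h' | h'
          · exact b3 h'
          · have := Finset.card_le_card b3
            omega
        · exact (b5 x h).resolve_right hc
        · omega)
  have hOP : ∀ u < T.n, Function.update O p (slots μ₂ p) u = slots μ₂ u := by
    intro u hu
    by_cases hup : u = p
    · rw [hup, Function.update_self]
    · rw [Function.update_of_ne hup, hO u hu, hslots u hup]
  by_cases hch : μ₂ .changed 0 = 0
  · rw [run_ite_neg (by simpa using hch)]
    change Refines T piece Q μ₂ v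
    refine ⟨hgood₂, _, fun u => link u ∨ u = v ∧ slots μ₂ p ≠ O p, closed, ?_, hOP, fun u hu => ?_, fun u hu => ?_⟩
    · rw [fr .numClosed (by decide) (by decide) (by decide)]; exact hpass
    · rw [fr .link (by decide) (by decide) (by decide), ← hl u hu]
      refine ⟨fun h => h.elim id fun h => ?_, Or.inl⟩
      exact absurd (hO p hpn ▸ h.2) fun h => hchanged.2 h hch
    · rw [fr .closed (by decide) (by decide) (by decide)]; exact hcl u hu
  · rw [run_ite_pos (by simpa using hch), run_store]
    set ν : ArrState := μ₂.upd .link _ _ with hν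
    have gn : ∀ b, b ≠ .link → ν b = μ₂ b := fun b h => ArrState.upd_of_ne _ h _ _
    have gs' : slots ν = slots μ₂ := by
      funext u; unfold slots; rw [gn _ (by decide), gn _ (by decide), gn _ (by decide)]
    have gg' : GoodAt ν = GoodAt μ₂ := by
      funext u; unfold GoodAt; rw [gn _ (by decide), gn _ (by decide), gn _ (by decide)]
    unfold Refines
    rw [gs', gg', gn .numClosed (by decide), gn .closed (by decide)]
    refine ⟨hgood₂, _, fun u => link u ∨ u = v ∧ slots μ₂ p ≠ O p, closed, ?_, hOP, fun u hu => ?_, fun u hu => ?_⟩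
    · rw [fr .numClosed (by decide) (by decide) (by decide)]; exact hpass
    · simp only [hν, ArrState.upd_apply, true_and, val, m0]
      by_cases huv : u = v
      · rw [if_pos huv]
        exact ⟨fun _ => one_ne_zero, fun _ => Or.inr ⟨huv, hO p hpn ▸ hchanged.1 hch⟩⟩
      · rw [if_neg huv, fr .link (by decide) (by decide) (by decide), ← hl u hu]
        exact ⟨fun h => h.elim id fun h => absurd h.1 huv, Or.inl⟩
    · rw [fr .closed (by decide) (by decide) (by decide)]; exact hcl u hu

/-- Processes all vertices in the pieces, in descending order. -/
def processVertices : ArrProg :=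
  .rep .pass (whenLt (sc .pass) (sc .numVerts) (seqs [
    set .vert (.sub (sc .numVerts) (.add (sc .pass) (.const 1))),
    .ite (.arr .piece (sc .vert)) processVertex .skip]))

theorem run_processVertices (hS : Stores σ T) (hE : EdgesAre σ fun j x => x ∈ H j)
    (hN : σ .numEdges 0 ≤ E.size) (hn : T.n ≤ E.size)
    (hQ : ∀ x, IsEdgeVar σ x → (σ .chosen x ≠ 0 ↔ x ∈ Q)) (hpiece : piece = σ .piece)
    (hR : Refines T piece Q σ T.n) : Refines T piece Q (processVertices.run E σ) 0 := by
  have key := ArrProg.rep_induction_frame (E := E) (a := .pass) (σ := σ)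
    (c := whenLt (sc .pass) (sc .numVerts) (seqs [
      set .vert (.sub (sc .numVerts) (.add (sc .pass) (.const 1))),
      .ite (.arr .piece (sc .vert)) processVertex .skip]))
    (fun t τ => Refines T piece Q τ (T.n - t)) ?_ ?_
  · rw [Nat.sub_eq_zero_of_le hn] at key; exact key
  · exact hR
  · intro t _ τ hf ih
    have f : ∀ a, a ∉ (ArrProg.rep .pass (whenLt (sc .pass) (sc .numVerts) (seqs [
        set .vert (.sub (sc .numVerts) (.add (sc .pass) (.const 1))),
        .ite (.arr .piece (sc .vert)) processVertex .skip]))).mods → τ a = σ a := hf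
    have hnv : τ .numVerts 0 = T.n := by rw [f _ (by decide)]; exact hS.n
    by_cases ht : t < T.n
    swap
    · rw [run_whenLt_neg (by simpa [hnv] using ht), show T.n - (t + 1) = T.n - t by omega]
      refine ih.congr ?_ ?_ ?_ ?_ ?_ ?_
      all_goals exact ArrState.upd_of_ne _ (by decide) _ _
    rw [run_whenLt_pos (by simpa [hnv] using ht)]
    simp only [run_seqs_cons, run_seqs_nil, run_set]
    set κ : ArrState := (τ.upd .pass 0 t).upd .vert 0 _ with hκ
    have g : ∀ b, b ≠ .pass → b ≠ .vert → κ b = τ b := fun b h h' =>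
      (ArrState.upd_of_ne _ h' _ _).trans (ArrState.upd_of_ne _ h _ _)
    have gf : ∀ a, a ∉ (ArrProg.rep .pass (whenLt (sc .pass) (sc .numVerts) (seqs [
        set .vert (.sub (sc .numVerts) (.add (sc .pass) (.const 1))),
        .ite (.arr .piece (sc .vert)) processVertex .skip]))).mods → κ a = σ a := fun a ha => by
      rw [g a (by rintro rfl; exact ha (by decide)) (by rintro rfl; exact ha (by decide)), f a ha]
    obtain ⟨v, hv⟩ : ∃ v, T.n - t = v + 1 := ⟨T.n - t - 1, by omega⟩
    rw [show T.n - (t + 1) = v by omega]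
    rw [hv] at ih
    have hκv : κ .vert 0 = v := by simp [hκ, hnv]; omega
    have hRκ : Refines T piece Q κ (v + 1) := ih.congr (g _ (by decide) (by decide))
      (g _ (by decide) (by decide)) (g _ (by decide) (by decide)) (g _ (by decide) (by decide))
      (g _ (by decide) (by decide)) (g _ (by decide) (by decide))
    have hpκ : κ .piece = piece := by rw [gf _ (by decide), hpiece]
    by_cases h0 : piece v = 0
    · rw [run_ite_neg (by simpa [hκv, hpκ] using h0)]
      change Refines T piece Q κ v
      obtain ⟨hgood, O, link, closed, hR', hO, hl, hcl⟩ := hRκ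
      exact ⟨hgood, O, link, closed, hR'.skip h0, hO, hl, hcl⟩
    · rw [run_ite_pos (by simpa [hκv, hpκ] using h0)]
      refine run_processVertex E κ
        (hS.congr (gf _ (by decide)) (gf _ (by decide)) (gf _ (by decide)))
        (hE.congr (gf _ (by decide)) (gf _ (by decide)) (gf _ (by decide)))
        (by rw [gf _ (by decide)]; exact hN) (fun x hx => ?_) hκv (by omega) hpκ.symm h0 hRκ
      rw [gf _ (by decide)]
      exact hQ x (hx.congr (gf _ (by decide)).symm (gf _ (by decide)).symm)

/-- Stores the labels of the refined division. The vertices are processed in ascending order, so that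
the label of a parent is already the new one. -/
def relabel : ArrProg :=
  .rep .vert (whenLt (sc .vert) (sc .numVerts) (.ite (.arr .closed (sc .vert))
    (.store .piece (sc .vert) (.arr .closed (sc .vert)))
    (.ite (.arr .link (sc .vert))
      (.store .piece (sc .vert) (.arr .piece (.arr .parent (sc .vert))))
      (.store .piece (sc .vert) (.const 0)))))

theorem run_relabel (hS : Stores σ T) (hn : T.n ≤ E.size) (hR : Refines T piece Q σ 0) :
    ∃ O link closed, Refinement T piece Q O link closed (σ .numClosed 0) 0 ∧
      Refinement.Relabels T link closed (relabel.run E σ .piece) := by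
  obtain ⟨-, O, link, closed, hR', -, hl, hcl⟩ := hR
  refine ⟨O, link, closed, hR', ?_⟩
  have key := ArrProg.rep_induction_frame (E := E) (a := .vert) (σ := σ)
    (c := whenLt (sc .vert) (sc .numVerts) (.ite (.arr .closed (sc .vert))
      (.store .piece (sc .vert) (.arr .closed (sc .vert)))
      (.ite (.arr .link (sc .vert))
        (.store .piece (sc .vert) (.arr .piece (.arr .parent (sc .vert))))
        (.store .piece (sc .vert) (.const 0)))))
    (fun t τ => ∀ i < t, i < T.n → (closed i ≠ 0 → τ .piece i = closed i) ∧
      (closed i = 0 → link i → τ .piece i = τ .piece (T.parent i)) ∧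
      (closed i = 0 → ¬ link i → τ .piece i = 0)) ?_ ?_
  · exact fun i hi => key i (by omega) hi
  · exact fun i hi => absurd hi (by omega)
  · intro t _ τ hf ih i hi hin
    have hnv : τ .numVerts 0 = T.n := by rw [hf _ (by decide)]; exact hS.n
    by_cases ht : t < T.n
    swap
    · rw [run_whenLt_neg (by simpa [hnv] using ht), ArrState.upd_of_ne _ (by decide)]
      exact ih i (by omega) hin
    rw [run_whenLt_pos (by simpa [hnv] using ht)]
    have c1 : τ .closed t = closed t := by rw [hf _ (by decide), hcl t ht]
    have c2 : τ .link t ≠ 0 ↔ link t := by rw [hf _ (by decide), hl t ht]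
    have c3 : τ .parent t = T.parent t := by rw [hf _ (by decide), hS.parent t ht]
    -- It suffices to look at the label that is written.
    have main : ∀ (ρ : ArrState) (y : ℕ), ρ .piece = Function.update (τ .piece) t y →
        (closed t ≠ 0 → y = closed t) →
        (closed t = 0 → link t → y = τ .piece (T.parent t)) →
        (closed t = 0 → ¬ link t → y = 0) →
        (closed i ≠ 0 → ρ .piece i = closed i) ∧
        (closed i = 0 → link i → ρ .piece i = ρ .piece (T.parent i)) ∧
        (closed i = 0 → ¬ link i → ρ .piece i = 0) := by
      intro ρ y hρ h1 h2 h3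
      rw [hρ]
      rcases Nat.lt_succ_iff_lt_or_eq.1 hi with hi | rfl
      · have := T.parent_le i hin
        rw [Function.update_of_ne (by omega), Function.update_of_ne (by omega)]
        exact ih i hi hin
      · rw [Function.update_self]
        refine ⟨h1, fun h4 h5 => ?_, h3⟩
        rw [Function.update_of_ne (hR'.link_spec i h5).2.2.1]
        exact h2 h4 h5
    have upd : ∀ y, ((τ.upd .vert 0 t).upd .piece t y) .piece = Function.update (τ .piece) t y := by
      intro y; funext j; simp [Function.update_apply]
    have hvt : (τ.upd .vert 0 t) .vert 0 = t := by simp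
    by_cases hc : closed t = 0
    · rw [run_ite_neg (by simpa [c1] using hc)]
      by_cases hlt : link t
      · rw [run_ite_pos (by simpa using c2.2 hlt), run_store]
        refine main _ (τ .piece (T.parent t)) ?_ (fun h => absurd hc h) (fun _ _ => rfl)
          (fun _ h => absurd hlt h)
        rw [← upd]; simp [c3]
      · rw [run_ite_neg (by simpa using (not_congr c2).2 hlt), run_store]
        refine main _ 0 ?_ (fun h => absurd hc h) (fun _ h => absurd h hlt) (fun _ _ => rfl)
        rw [← upd]; simp
    · rw [run_ite_pos (by simpa [c1] using hc), run_store]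
      refine main _ (closed t) ?_ (fun _ => rfl) (fun h => absurd h hc) (fun h => absurd h hc)
      rw [← upd]; simp [c1]

end

/-! ### The rounds of the algorithm -/

/-- The forest `T` and the incidences are stored, and the size of the environment suffices for all
loops. -/
structure Loaded {H : ℕ → Finset ℕ} (E : ArrEnv) (T : Forest H) (k : ℕ) (σ : ArrState) : Prop where
  stores : Stores σ T
  edges : EdgesAre σ fun j x => x ∈ H j
  numEdges_le : σ .numEdges 0 ≤ E.size
  n_lt : T.n < E.size
  read_zero : E.read 0 = k
  quota_eq : E.quota = quota k
  quota_le : quota k ≤ E.size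

/-- The arrays that `Loaded` depends on. -/
def loadedArrays : List Arr := [.numVerts, .parent, .index, .numEdges, .edgeClause, .edgeVar]

theorem Loaded.congr {H : ℕ → Finset ℕ} {E : ArrEnv} {T : Forest H} {k : ℕ} {σ τ : ArrState}
    (h : Loaded E T k σ) (e : ∀ a ∈ loadedArrays, τ a = σ a) : Loaded E T k τ :=
  ⟨h.stores.congr (e _ (by decide)) (e _ (by decide)) (e _ (by decide)),
    h.edges.congr (e _ (by decide)) (e _ (by decide)) (e _ (by decide)),
    by rw [e _ (by decide)]; exact h.numEdges_le, h.n_lt, h.read_zero, h.quota_eq, h.quota_le⟩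

theorem Loaded.run {H : ℕ → Finset ℕ} {E : ArrEnv} {T : Forest H} {k : ℕ} {σ : ArrState}
    (h : Loaded E T k σ) (c : ArrProg) (hc : ∀ a ∈ loadedArrays, a ∉ c.mods) :
    Loaded E T k (c.run E σ) :=
  h.congr fun a ha => ArrProg.run_frame _ _ (hc a ha)

/-- The candidates of the last round. -/
def chosenVars (σ : ArrState) : Finset ℕ := firstEntries (σ .choice) (σ .numChosen 0)

/-- The candidates of the round before. -/
def prevVars (σ : ArrState) : Finset ℕ := firstEntries (σ .prevChoice) (σ .numPrev 0)

/-- What holds before each round. Backdoor sets that avoid the previous candidates touch as many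
pieces as the threshold says. In the first round, the pieces are the blocks of the grid; later there
are at most three children of each vertex in its piece. -/
structure Ready {H : ℕ → Finset ℕ} (E : ArrEnv) (T : Forest H) (k : ℕ) (σ : ArrState) : Prop where
  divides : T.Divides (σ .piece)
  label_le : ∀ i < T.n, σ .piece i ≤ E.size
  prev : ∀ x ∈ prevVars σ, IsEdgeVar σ x
  numPrev_le : σ .numPrev 0 ≤ quota k
  threshold_pos : 0 < σ .threshold 0
  touched : ∀ B, IsBackdoorFor H k B → Disjoint (prevVars σ) B →
    σ .threshold 0 ≤ (T.touchedBy (σ .piece) B).card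
  stage : (σ .prevPieces 0 = 4 * quota k ∧ σ .threshold 0 = (T.labels (σ .piece)).card ∧
      49 * (k * k * 4 ^ k) ≤ (T.labels (σ .piece)).card) ∨
    (σ .prevPieces 0 = (T.labels (σ .piece)).card ∧
      σ .threshold 0 = (T.labels (σ .piece)).card - 2 * quota k ∧
      4 * quota k ≤ (T.labels (σ .piece)).card ∧
      ∀ p, (Refinement.children T (σ .piece) p).card ≤ 3)

/-- The candidates of the last two rounds hit all backdoor sets. -/
structure Finished (H : ℕ → Finset ℕ) (k : ℕ) (σ : ArrState) : Prop where
  numChosen_le : σ .numChosen 0 ≤ quota k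
  numPrev_le : σ .numPrev 0 ≤ quota k
  chosen : ∀ x ∈ chosenVars σ, IsEdgeVar σ x
  prev : ∀ x ∈ prevVars σ, IsEdgeVar σ x
  hits : ∀ B, IsBackdoorFor H k B → ∃ b ∈ B, b ∈ chosenVars σ ∪ prevVars σ

theorem Finished.congr {H : ℕ → Finset ℕ} {k : ℕ} {σ τ : ArrState} (h : Finished H k σ)
    (e : ∀ a ∈ [Arr.numChosen, .numPrev, .choice, .prevChoice, .numEdges, .edgeVar], τ a = σ a) :
    Finished H k τ := by
  have h1 : chosenVars τ = chosenVars σ := by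
    unfold chosenVars; rw [e _ (by decide), e _ (by decide)]
  have h2 : prevVars τ = prevVars σ := by
    unfold prevVars; rw [e _ (by decide), e _ (by decide)]
  have h3 : ∀ x, IsEdgeVar σ x → IsEdgeVar τ x := fun x hx =>
    hx.congr (e _ (by decide)) (e _ (by decide))
  refine ⟨by rw [e _ (by decide)]; exact h.numChosen_le, by rw [e _ (by decide)]; exact h.numPrev_le,
    fun x hx => h3 x (h.chosen x (h1 ▸ hx)), fun x hx => h3 x (h.prev x (h2 ▸ hx)), ?_⟩
  rw [h1, h2]; exact h.hits

/-- Selects the candidates of a round. -/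
def selectVariables : ArrProg := seqs [resetVariables, countPieces, chooseVariables]

/-- Refines the pieces. -/
def refinePieces : ArrProg := seqs [resetVertices, processVertices, relabel]

/-- Prepares the next round. A backdoor set that avoids the candidates of this round touches all new
pieces but `2 * quota k` of them, and this number is the new threshold. -/
def nextRound : ArrProg :=
  seqs [set .prevPieces (sc .numClosed),
    set .threshold (.sub (.sub (sc .numClosed) .quota) .quota),
    set .numPrev (sc .numChosen),
    .rep .slot (.store .prevChoice (sc .slot) (.arr .choice (sc .slot)))]

/-- One round. With fewer than `quota k` candidates, all variables that reach the threshold have been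
selected, and every backdoor set contains one of them or a candidate of the round before. If the
number of pieces does not grow, then no backdoor set avoids the candidates. In both cases, the
algorithm is done. -/
def playRound : ArrProg :=
  seqs [selectVariables,
    .ite (.sub .quota (sc .numChosen)) (set .done (.const 1))
      (seqs [refinePieces,
        .ite (.sub (sc .numClosed) (sc .prevPieces)) nextRound (set .done (.const 1))])]

section

variable {H : ℕ → Finset ℕ} {E : ArrEnv} {T : Forest H} {k : ℕ} {σ : ArrState}

theorem Loaded.run_selectVariables (h : Loaded E T k σ)
    (hlab : ∀ i < T.n, σ .piece i ≤ E.size) {ρ : ArrState}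
    (hρ : ρ = selectVariables.run E σ) :
    (chosenVars ρ).card = ρ .numChosen 0 ∧ ρ .numChosen 0 ≤ quota k ∧
      (∀ x, IsEdgeVar ρ x → (ρ .chosen x ≠ 0 ↔ x ∈ chosenVars ρ)) ∧
      (∀ x ∈ chosenVars ρ, IsEdgeVar ρ x ∧ ∀ s : Finset ℕ,
        (∀ l ∈ T.labels (σ .piece), Touches H (T.part (σ .piece) l) x → l ∈ s) →
          σ .threshold 0 ≤ k * s.card) ∧
      (ρ .numChosen 0 < quota k → ∀ x, (∃ l ≠ 0, Touches H (T.part (σ .piece) l) x) →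
        (∀ s : Finset ℕ, (∀ l ∈ T.labels (σ .piece), Touches H (T.part (σ .piece) l) x → l ∈ s) →
          σ .threshold 0 ≤ k * s.card) → x ∈ chosenVars ρ) := by
  classical
  unfold selectVariables at hρ
  simp only [run_seqs_cons, run_seqs_nil] at hρ
  set σ₁ := resetVariables.run E σ with h₁
  set σ₂ := countPieces.run E σ₁ with h₂
  have f₁ : ∀ a, a ∉ resetVariables.mods → σ₁ a = σ a := fun a ha => ArrProg.run_frame _ _ ha
  have f₂ : ∀ a, a ∉ countPieces.mods → σ₂ a = σ₁ a := fun a ha => ArrProg.run_frame _ _ ha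
  have f₃ : ∀ a, a ∉ chooseVariables.mods → ρ a = σ₂ a := fun a ha => by
    rw [hρ]; exact ArrProg.run_frame _ _ ha
  have ev₁ : ∀ x, IsEdgeVar σ₁ x ↔ IsEdgeVar σ x := fun x =>
    ⟨fun hx => hx.congr (f₁ _ (by decide)).symm (f₁ _ (by decide)).symm,
      fun hx => hx.congr (f₁ _ (by decide)) (f₁ _ (by decide))⟩
  have ev₂ : ∀ x, IsEdgeVar σ₂ x ↔ IsEdgeVar σ₁ x := fun x =>
    ⟨fun hx => hx.congr (f₂ _ (by decide)).symm (f₂ _ (by decide)).symm,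
      fun hx => hx.congr (f₂ _ (by decide)) (f₂ _ (by decide))⟩
  have ev₃ : ∀ x, IsEdgeVar ρ x ↔ IsEdgeVar σ₂ x := fun x =>
    ⟨fun hx => hx.congr (f₃ _ (by decide)).symm (f₃ _ (by decide)).symm,
      fun hx => hx.congr (f₃ _ (by decide)) (f₃ _ (by decide))⟩
  have hload : Loaded E T k σ₁ := h.run _ (by decide)
  have hp : σ₁ .piece = σ .piece := f₁ _ (by decide)
  have hthr : σ₂ .threshold 0 = σ .threshold 0 := by rw [f₂ _ (by decide), f₁ _ (by decide)]
  set t : ℕ → Finset ℕ := fun x => (Finset.Icc 1 E.size).filter fun l =>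
    Touches H (T.part (σ .piece) l) x with ht
  have hcount : ∀ x, IsEdgeVar σ x → σ₂ .count x = k * (t x).card := by
    intro x hx
    rw [h₂, run_countPieces E σ₁ hload.numEdges_le
      (fun y hy => by
        have := run_resetVariables E σ h.numEdges_le ((ev₁ y).1 hy)
        exact ⟨this.1, this.2.1⟩) ((ev₁ x).2 hx), h.read_zero, ht]
    congr 3
    ext l
    rw [← hp, hload.stores.touches_iff hload.edges]
  have hsub : ∀ x (s : Finset ℕ),
      (∀ l ∈ T.labels (σ .piece), Touches H (T.part (σ .piece) l) x → l ∈ s) → t x ⊆ s := by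
    intro x s hs l hl
    rw [ht, Finset.mem_filter, Finset.mem_Icc] at hl
    exact hs l (Forest.mem_labels_of_touches (by omega) hl.2) hl.2
  have hmem : ∀ x, ∀ l ∈ T.labels (σ .piece), Touches H (T.part (σ .piece) l) x → l ∈ t x := by
    intro x l hl hx
    obtain ⟨hl0, i, hi, rfl⟩ := T.mem_labels.1 hl
    exact Finset.mem_filter.2 ⟨Finset.mem_Icc.2 ⟨by omega, hlab i hi⟩, hx⟩
  obtain ⟨c1, c2, c3, c4, c5⟩ := run_chooseVariables E σ₂
    (by rw [f₂ _ (by decide)]; exact hload.numEdges_le)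
    (fun x hx => by
      rw [f₂ _ (by decide)]
      exact (run_resetVariables E σ h.numEdges_le ((ev₁ x).1 ((ev₂ x).1 hx))).2.2)
    hρ (Q := chosenVars ρ) rfl
  rw [h.quota_eq] at c2 c5
  refine ⟨c1, c2, fun x hx => c3 x ((ev₃ x).1 hx), fun x hx => ?_, fun hlt x hx hs => ?_⟩
  · obtain ⟨d1, d2⟩ := c4 x hx
    refine ⟨(ev₃ x).2 d1, fun s hs => ?_⟩
    rw [hthr, hcount x ((ev₁ x).1 ((ev₂ x).1 d1))] at d2
    exact d2.trans (Nat.mul_le_mul_left _ (Finset.card_le_card (hsub x s hs)))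
  · have hev : IsEdgeVar σ x := by
      obtain ⟨l, -, j, -, hxj⟩ := hx
      obtain ⟨e, he, -, h1⟩ := (h.edges j x).1 hxj
      exact ⟨e, he, h1⟩
    refine c5 hlt x ((ev₂ x).2 ((ev₁ x).2 hev)) ?_
    rw [hthr, hcount x hev]
    exact hs _ (hmem x)

theorem Loaded.run_refinePieces (h : Loaded E T k σ)
    (hQ : ∀ x, IsEdgeVar σ x → (σ .chosen x ≠ 0 ↔ x ∈ chosenVars σ)) {ρ : ArrState}
    (hρ : ρ = refinePieces.run E σ) :
    ∃ O link closed, Refinement T (σ .piece) (chosenVars σ) O link closed (ρ .numClosed 0) 0 ∧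
      Refinement.Relabels T link closed (ρ .piece) := by
  unfold refinePieces at hρ
  simp only [run_seqs_cons, run_seqs_nil] at hρ
  have h1 := run_resetVertices E σ T h.n_lt.le (σ .piece) (chosenVars σ)
  set σ₁ := resetVertices.run E σ with e₁
  have l1 : Loaded E T k σ₁ := h.run _ (by decide)
  have f₁ : ∀ a, a ∉ resetVertices.mods → σ₁ a = σ a := fun a ha => ArrProg.run_frame _ _ ha
  have h2 := run_processVertices E σ₁ l1.stores l1.edges l1.numEdges_le l1.n_lt.le
    (fun x hx => by
      rw [f₁ _ (by decide)]
      exact hQ x (hx.congr (f₁ _ (by decide)).symm (f₁ _ (by decide)).symm))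
    (f₁ .piece (by decide)).symm h1
  set σ₂ := processVertices.run E σ₁ with e₂
  have l2 : Loaded E T k σ₂ := l1.run _ (by decide)
  obtain ⟨O, link, closed, h3, h4⟩ := run_relabel E σ₂ l2.stores l2.n_lt.le h2
  refine ⟨O, link, closed, ?_, ?_⟩
  · rw [hρ, ArrProg.run_frame _ _ (by decide)]; exact h3
  · rw [hρ]; exact h4

/-- A round keeps the invariants, and the number of pieces grows, unless the algorithm is done. -/
theorem run_playRound (h : Loaded E T k σ) (hk : 0 < k) (hr : Ready E T k σ) (hd : σ .done 0 = 0)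
    {ρ : ArrState} (hρ : ρ = playRound.run E σ) :
    (ρ .done 0 = 0 → Ready E T k ρ ∧ σ .prevPieces 0 < ρ .prevPieces 0 ∧ ρ .prevPieces 0 ≤ T.n) ∧
      (ρ .done 0 ≠ 0 → Finished H k ρ) := by
  unfold playRound at hρ
  simp only [run_seqs_cons, run_seqs_nil] at hρ
  obtain ⟨c1, c2, c3, c4, c5⟩ := h.run_selectVariables hr.label_le rfl
  set σ₁ := selectVariables.run E σ with h₁
  have f₁ : ∀ a, a ∉ selectVariables.mods → σ₁ a = σ a := fun a ha => ArrProg.run_frame _ _ ha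
  have l1 : Loaded E T k σ₁ := h.run _ (by decide)
  have pv : prevVars σ₁ = prevVars σ := by
    unfold prevVars; rw [f₁ _ (by decide), f₁ _ (by decide)]
  have hprev : ∀ x ∈ prevVars σ₁, IsEdgeVar σ₁ x := fun x hx =>
    (hr.prev x (pv ▸ hx)).congr (f₁ _ (by decide)) (f₁ _ (by decide))
  have hnp : σ₁ .numPrev 0 ≤ quota k := by rw [f₁ _ (by decide)]; exact hr.numPrev_le
  by_cases hlt : σ₁ .numChosen 0 < quota k
  · rw [run_ite_pos (by simp [h.quota_eq]; omega), run_set] at hρ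
    have hdone : ρ .done 0 = 1 := by simp [hρ]
    refine ⟨fun h0 => by omega, fun _ => ?_⟩
    have : Finished H k σ₁ := by
      refine ⟨c2, hnp, fun x hx => (c4 x hx).1, hprev, fun B hB => ?_⟩
      by_cases hdis : Disjoint (prevVars σ) B
      · obtain ⟨b, hb, h2, h3⟩ := Forest.exists_touches_many hB.card_le hr.threshold_pos
          (hr.touched B hB hdis)
        exact ⟨b, hb, Finset.mem_union_left _ (c5 hlt b h2 h3)⟩
      · obtain ⟨b, hb, hbB⟩ := Finset.not_disjoint_iff.1 hdis
        exact ⟨b, hbB, Finset.mem_union_right _ (pv ▸ hb)⟩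
    rw [hρ]
    refine this.congr fun a ha => ArrState.upd_of_ne _ ?_ _ _
    rintro rfl
    exact absurd ha (by decide)
  rw [run_ite_neg (by simp [h.quota_eq]; omega)] at hρ
  simp only [run_seqs_cons, run_seqs_nil] at hρ
  have hcard : (chosenVars σ₁).card = quota k := by omega
  obtain ⟨O, link, closed, r1, r2⟩ := l1.run_refinePieces c3 rfl
  set σ₂ := refinePieces.run E σ₁ with h₂
  have f₂ : ∀ a, a ∉ refinePieces.mods → σ₂ a = σ₁ a := fun a ha => ArrProg.run_frame _ _ ha
  have l2 : Loaded E T k σ₂ := l1.run _ (by decide)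
  rw [f₁ .piece (by decide)] at r1
  set m := σ₂ .numClosed 0 with hm
  have hpp : σ₂ .prevPieces 0 = σ .prevPieces 0 := by rw [f₂ _ (by decide), f₁ _ (by decide)]
  have hmn : m ≤ T.n := by
    have : (T.labels (σ₂ .piece)).card ≤ T.n :=
      (Finset.card_le_card (Finset.erase_subset _ _)).trans (Finset.card_image_le.trans (by simp))
    rw [r1.labels_eq r2] at this
    simpa using this
  have grow : ∀ B, IsBackdoorFor H k B → Disjoint (chosenVars σ₁) B → σ .prevPieces 0 < m := by
    intro B hB hdis
    rcases hr.stage with ⟨s1, s2, s3⟩ | ⟨s1, s2, s3, s4⟩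
    · rw [s1]
      exact r1.lt_of_first hr.divides hk hcard s3 fun x hx s hs => s2 ▸ (c4 x hx).2 s hs
    · rw [s1]
      exact r1.lt_of_later hr.divides hk hcard hB hdis s3 s4 fun x hx s hs => s2 ▸ (c4 x hx).2 s hs
  have cv : chosenVars σ₂ = chosenVars σ₁ := by
    unfold chosenVars; rw [f₂ _ (by decide), f₂ _ (by decide)]
  have pv₂ : prevVars σ₂ = prevVars σ₁ := by
    unfold prevVars; rw [f₂ _ (by decide), f₂ _ (by decide)]
  have hch : ∀ x ∈ chosenVars σ₂, IsEdgeVar σ₂ x := fun x hx =>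
    (c4 x (cv ▸ hx)).1.congr (f₂ _ (by decide)) (f₂ _ (by decide))
  by_cases hgr : σ .prevPieces 0 < m
  · rw [run_ite_pos (by simp only [val]; omega)] at hρ
    unfold nextRound at hρ
    simp only [run_seqs_cons, run_seqs_nil, run_set] at hρ
    set σ₃ : ArrState := ((σ₂.upd .prevPieces 0 _).upd .threshold 0 _).upd .numPrev 0 _ with h₃
    have f₃ : ∀ a, a ≠ .prevPieces → a ≠ .threshold → a ≠ .numPrev → σ₃ a = σ₂ a :=
      fun a g1 g2 g3 => (ArrState.upd_of_ne _ g3 _ _).trans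
        ((ArrState.upd_of_ne _ g2 _ _).trans (ArrState.upd_of_ne _ g1 _ _))
    have hcopy := ArrProg.rep_induction_frame (E := E) (a := .slot) (σ := σ₃)
      (c := .store .prevChoice (sc .slot) (.arr .choice (sc .slot)))
      (fun t τ => ∀ i < t, τ .prevChoice i = σ₂ .choice i) (fun i hi => absurd hi (by omega))
      (by
        intro t _ τ hf ih i hi
        rw [run_store]
        rcases Nat.lt_succ_iff_lt_or_eq.1 hi with hi | rfl
        · simp only [ArrState.upd_apply, true_and, val, reduceCtorEq, false_and, if_false, and_self,
            if_true]
          rw [if_neg (by omega)]; exact ih i hi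
        · simp only [ArrState.upd_apply, true_and, val, reduceCtorEq, false_and, if_false, and_self,
            if_true]
          rw [hf _ (by decide), f₃ _ (by decide) (by decide) (by decide)])
    rw [← hρ] at hcopy
    have f₄ : ∀ a, a ≠ .slot → a ≠ .prevChoice → ρ a = σ₃ a := fun a g1 g2 => by
      rw [hρ]; exact ArrProg.run_frame _ _ (by simp [mods, g1, g2])
    have k1 : ρ .prevPieces 0 = m := by
      rw [f₄ _ (by decide) (by decide)]; simp [h₃, hm]
    have k2 : ρ .threshold 0 = m - 2 * quota k := by
      rw [f₄ _ (by decide) (by decide)]; simp [h₃, hm, h.quota_eq]; omega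
    have k3 : ρ .numPrev 0 = σ₂ .numChosen 0 := by
      rw [f₄ _ (by decide) (by decide)]; simp [h₃]
    have k4 : ρ .piece = σ₂ .piece := by
      rw [f₄ _ (by decide) (by decide), f₃ _ (by decide) (by decide) (by decide)]
    have k5 : ρ .done 0 = 0 := by
      rw [f₄ _ (by decide) (by decide), f₃ _ (by decide) (by decide) (by decide), f₂ _ (by decide),
        f₁ _ (by decide), hd]
    have hnc : σ₂ .numChosen 0 = σ₁ .numChosen 0 := by rw [f₂ _ (by decide)]
    have k6 : prevVars ρ = chosenVars σ₁ := by
      have := h.quota_le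
      rw [← cv]
      unfold prevVars chosenVars firstEntries
      rw [k3]
      refine Finset.image_congr fun i hi => ?_
      rw [Finset.coe_range, Set.mem_Iio] at hi
      exact hcopy i (by omega)
    have hL : (T.labels (ρ .piece)).card = m := by
      rw [k4, r1.labels_eq r2]; simp
    have h4q : 4 * quota k < m := by
      rcases hr.stage with ⟨s1, -⟩ | ⟨s1, -, s3, -⟩ <;> omega
    refine ⟨fun _ => ⟨⟨?_, ?_, ?_, ?_, ?_, ?_, Or.inr ⟨?_, ?_, ?_, ?_⟩⟩, by omega, by omega⟩,
      fun h => absurd k5 h⟩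
    · rw [k4]; exact r1.divides r2
    · rw [k4]
      intro i hi
      have := r1.relabel_le r2 hi
      have := h.n_lt
      omega
    · intro x hx
      rw [k6, ← cv] at hx
      refine (hch x hx).congr ?_ ?_
      · rw [f₄ _ (by decide) (by decide), f₃ _ (by decide) (by decide) (by decide)]
      · rw [f₄ _ (by decide) (by decide), f₃ _ (by decide) (by decide) (by decide)]
    · rw [k3, hnc]; exact c2
    · omega
    · intro B hB _
      rw [k2, k4, ← hcard]
      exact r1.le_card_touchedBy r2 hB
    · rw [k1, hL]
    · rw [k2, hL]
    · rw [hL]; omega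
    · rw [k4]; exact r1.card_children_le r2
  · rw [run_ite_neg (by simp only [val]; omega), run_set] at hρ
    have hdone : ρ .done 0 = 1 := by simp [hρ]
    refine ⟨fun h0 => by omega, fun _ => ?_⟩
    have : Finished H k σ₂ := by
      refine ⟨by rw [f₂ _ (by decide)]; exact c2, by rw [f₂ _ (by decide)]; exact hnp, hch,
        fun x hx => (hprev x (pv₂ ▸ hx)).congr (f₂ _ (by decide)) (f₂ _ (by decide)),
        fun B hB => ?_⟩
      by_contra hcon
      push Not at hcon
      refine hgr (grow B hB (Finset.disjoint_right.2 fun b hb hb' => ?_))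
      exact hcon b hb (Finset.mem_union_left _ (cv ▸ hb'))
    rw [hρ]
    refine this.congr fun a ha => ArrState.upd_of_ne _ ?_ _ _
    rintro rfl
    exact absurd ha (by decide)

theorem Ready.congr {τ : ArrState} (h : Ready E T k σ)
    (e : ∀ a ∈ [Arr.piece, .prevChoice, .numPrev, .threshold, .prevPieces, .numEdges, .edgeVar],
      τ a = σ a) : Ready E T k τ := by
  have h2 : prevVars τ = prevVars σ := by
    unfold prevVars; rw [e _ (by decide), e _ (by decide)]
  have e1 : τ .piece = σ .piece := e _ (by decide)
  have e2 : τ .threshold = σ .threshold := e _ (by decide)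
  refine ⟨by rw [e1]; exact h.divides, by rw [e1]; exact h.label_le, fun x hx => ?_,
    by rw [e _ (by decide)]; exact h.numPrev_le, by rw [e2]; exact h.threshold_pos, ?_, ?_⟩
  · exact (h.prev x (h2 ▸ hx)).congr (e _ (by decide)) (e _ (by decide))
  · rw [h2, e1, e2]; exact h.touched
  · rw [e1, e2, e .prevPieces (by decide)]; exact h.stage

/-- Plays rounds until the algorithm is done. -/
def playRounds : ArrProg := .rep .round (whenEq (sc .done) (.const 0) playRound)

theorem run_playRounds (h : Loaded E T k σ) (hk : 0 < k) (hr : Ready E T k σ)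
    (hd : σ .done 0 = 0) : Finished H k (playRounds.run E σ) := by
  have key := ArrProg.rep_induction_frame (E := E) (a := .round) (σ := σ)
    (c := whenEq (sc .done) (.const 0) playRound)
    (fun t τ => (τ .done 0 = 0 → Ready E T k τ ∧ t ≤ τ .prevPieces 0 ∧
      (t ≠ 0 → τ .prevPieces 0 ≤ T.n)) ∧ (τ .done 0 ≠ 0 → Finished H k τ)) ?_ ?_
  · -- Otherwise, the number of pieces would exceed the number of vertices, as it grows in each round.
    have hn := h.n_lt
    refine key.2 fun h0 => ?_
    obtain ⟨-, h1, h2⟩ := key.1 h0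
    have := h2 (by omega)
    omega
  · exact ⟨fun _ => ⟨hr, Nat.zero_le _, fun h => absurd rfl h⟩, fun h => absurd hd h⟩
  · intro t _ τ hf ⟨i1, i2⟩
    by_cases h0 : τ .done 0 = 0
    · rw [run_whenEq_pos (by simpa using h0)]
      obtain ⟨j1, j2, -⟩ := i1 h0
      obtain ⟨c1, c2⟩ := run_playRound (σ := τ.upd .round 0 t)
        (h.congr fun a ha => by
          rw [ArrState.upd_of_ne _ (by rintro rfl; exact absurd ha (by decide)), hf]
          revert a; decide) hk
        (j1.congr fun a ha => ArrState.upd_of_ne _ (by rintro rfl; exact absurd ha (by decide)) _ _)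
        (by simpa using h0) rfl
      refine ⟨fun h1 => ?_, c2⟩
      obtain ⟨d1, d2, d3⟩ := c1 h1
      have e : (τ.upd .round 0 t) .prevPieces 0 = τ .prevPieces 0 := by simp
      rw [e] at d2
      exact ⟨d1, by omega, fun _ => d3⟩
    · rw [run_whenEq_neg (by simpa using h0)]
      refine ⟨fun h1 => absurd (by simpa using h1) h0, fun _ => (i2 h0).congr fun a ha => ?_⟩
      exact ArrState.upd_of_ne _ (by rintro rfl; exact absurd ha (by decide)) _ _

/-- Copies the candidates of the last two rounds to the output. -/
def collectOutput : ArrProg :=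
  seqs [.rep .slot (whenLt (sc .slot) (sc .numChosen)
      (.store .out (sc .slot) (.arr .choice (sc .slot)))),
    .rep .slot (whenLt (sc .slot) (sc .numPrev)
      (.store .out (.add (sc .numChosen) (sc .slot)) (.arr .prevChoice (sc .slot)))),
    set .numOut (.add (sc .numChosen) (sc .numPrev))]

theorem run_collectOutput (h1 : σ .numChosen 0 ≤ E.size) (h2 : σ .numPrev 0 ≤ E.size) {ρ : ArrState}
    (hρ : ρ = collectOutput.run E σ) :
    ρ .numOut 0 = σ .numChosen 0 + σ .numPrev 0 ∧
      (Finset.range (ρ .numOut 0)).image (ρ .out) = chosenVars σ ∪ prevVars σ := by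
  unfold collectOutput at hρ
  simp only [run_seqs_cons, run_seqs_nil, run_set] at hρ
  have k1 := ArrProg.rep_induction_frame (E := E) (a := .slot) (σ := σ)
    (c := whenLt (sc .slot) (sc .numChosen)
      (.store .out (sc .slot) (.arr .choice (sc .slot))))
    (fun t τ => ∀ i < t, i < σ .numChosen 0 → τ .out i = σ .choice i)
    (fun i hi => absurd hi (by omega)) ?_
  swap
  · intro t _ τ hf ih i hi hin
    have e1 : τ .numChosen = σ .numChosen := hf _ (by decide)
    have e2 : τ .choice = σ .choice := hf _ (by decide)
    by_cases ht : t < σ .numChosen 0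
    · rw [run_whenLt_pos (by simpa [e1] using ht), run_store]
      rcases Nat.lt_succ_iff_lt_or_eq.1 hi with hi | rfl
      · simp [ih i hi hin]; omega
      · simp [e2]
    · rw [run_whenLt_neg (by simpa [e1] using ht)]
      simpa using ih i (by omega) hin
  set σ₁ := (ArrProg.rep .slot (whenLt (sc .slot) (sc .numChosen)
    (.store .out (sc .slot) (.arr .choice (sc .slot))))).run E σ with hσ₁
  have f1 : ∀ a, a ≠ .slot → a ≠ .out → σ₁ a = σ a := fun a g1 g2 =>
    ArrProg.run_frame _ _ (by simp [whenLt, mods, g1, g2])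
  have k2 := ArrProg.rep_induction_frame (E := E) (a := .slot) (σ := σ₁)
    (c := whenLt (sc .slot) (sc .numPrev)
      (.store .out (.add (sc .numChosen) (sc .slot)) (.arr .prevChoice (sc .slot))))
    (fun t τ => (∀ i < σ .numChosen 0, τ .out i = σ .choice i) ∧
      ∀ i < t, i < σ .numPrev 0 → τ .out (σ .numChosen 0 + i) = σ .prevChoice i)
    ⟨fun i hi => k1 i (by omega) hi, fun i hi => absurd hi (by omega)⟩ ?_
  swap
  · rintro t _ τ hf ⟨i1, i2⟩
    have f : ∀ a, a ≠ .slot → a ≠ .out → τ a = σ a := fun a g1 g2 => by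
      rw [hf a (by simp [whenLt, mods, g1, g2]), f1 a g1 g2]
    have e1 : τ .numPrev = σ .numPrev := f _ (by decide) (by decide)
    have e2 : τ .prevChoice = σ .prevChoice := f _ (by decide) (by decide)
    have e3 : τ .numChosen = σ .numChosen := f _ (by decide) (by decide)
    by_cases ht : t < σ .numPrev 0
    · rw [run_whenLt_pos (by simpa [e1] using ht), run_store]
      refine ⟨fun i hi => ?_, fun i hi hin => ?_⟩
      · simp [e3, i1 i hi]; omega
      · rcases Nat.lt_succ_iff_lt_or_eq.1 hi with hi | rfl
        · simp [e3, i2 i hi hin]; omega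
        · simp [e2, e3]
    · rw [run_whenLt_neg (by simpa [e1] using ht)]
      exact ⟨fun i hi => by simpa using i1 i hi, fun i hi hin => by simpa using i2 i (by omega) hin⟩
  set σ₂ := (ArrProg.rep .slot (whenLt (sc .slot) (sc .numPrev)
    (.store .out (.add (sc .numChosen) (sc .slot)) (.arr .prevChoice (sc .slot))))).run E σ₁ with hσ₂
  have f2 : ∀ a, a ≠ .slot → a ≠ .out → σ₂ a = σ a := fun a g1 g2 => by
    rw [hσ₂, ArrProg.run_frame _ _ (by simp [whenLt, mods, g1, g2]), f1 a g1 g2]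
  have hn : ρ .numOut 0 = σ .numChosen 0 + σ .numPrev 0 := by
    simp [hρ, f2]
  have ho : ρ .out = σ₂ .out := by rw [hρ]; exact ArrState.upd_of_ne _ (by decide) _ _
  refine ⟨hn, ?_⟩
  rw [hn, ho]
  ext x
  simp only [Finset.mem_image, Finset.mem_range, Finset.mem_union, chosenVars, prevVars,
    mem_firstEntries]
  constructor
  · rintro ⟨i, hi, rfl⟩
    by_cases hi' : i < σ .numChosen 0
    · exact Or.inl ⟨i, hi', (k2.1 i hi').symm⟩
    · refine Or.inr ⟨i - σ .numChosen 0, by omega, ?_⟩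
      rw [← k2.2 _ (by omega) (by omega)]
      congr 1; omega
  · rintro (⟨i, hi, rfl⟩ | ⟨i, hi, rfl⟩)
    · exact ⟨i, by omega, k2.1 i hi⟩
    · exact ⟨σ .numChosen 0 + i, by omega, k2.2 i (by omega) hi⟩

end

/-! ### Spanning forests of the blocks -/

/-- Adds the vertex with code `v` to the forest, with parent number `p`. -/
def addVertex (v p : ArrExpr) : ArrProg :=
  seqs [.store .order (sc .numVerts) v, .store .parent (sc .numVerts) p,
    .store .piece (sc .numVerts) (.arr .block v),
    .store .index v (.add (sc .numVerts) (.const 1)),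
    set .numVerts (.add (sc .numVerts) (.const 1))]

/-- If both ends of the incidence with number `edge` are in the same block, then adds the first end
as a root if the block has no root, and adds an end of which only the other end is in the forest. -/
def discoverEdge : ArrProg :=
  seqs [set .fst edgeCode, set .snd (.add edgeVariable edgeVariable),
    whenEq (.arr .block (sc .fst)) (.arr .block (sc .snd))
      (whenNe (.arr .block (sc .fst)) (.const 0) (seqs [
        whenEq (.arr .seeded (.arr .block (sc .fst))) (.const 0) (seqs [
          .store .seeded (.arr .block (sc .fst)) (.const 1),
          set .threshold (.add (sc .threshold) (.const 1)),
          addVertex (sc .fst) (sc .numVerts)]),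
        .ite (.arr .index (sc .fst))
          (whenEq (.arr .index (sc .snd)) (.const 0)
            (addVertex (sc .snd) (.sub (.arr .index (sc .fst)) (.const 1))))
          (.ite (.arr .index (sc .snd))
            (addVertex (sc .fst) (.sub (.arr .index (sc .snd)) (.const 1))) .skip)]))]

/-- Discovers a spanning forest of the blocks. Every pass over the incidences adds a vertex, until
all incidences are closed; see `EdgeClosed`. -/
def discover : ArrProg :=
  .rep .pass (.rep .edge (whenLt (sc .edge) (sc .numEdges) discoverEdge))

/-- The forest under construction: the trees lie in different blocks, and the roots are marked in
the array `seeded` and counted in `threshold`. -/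
structure PartialForest (H : ℕ → Finset ℕ) (σ : ArrState) : Prop where
  index_order : ∀ i < σ .numVerts 0, σ .index (σ .order i) = i + 1
  order_index : ∀ u, σ .index u ≠ 0 → ∃ i < σ .numVerts 0, σ .order i = u
  piece_eq : ∀ i < σ .numVerts 0, σ .piece i = σ .block (σ .order i)
  piece_ne : ∀ i < σ .numVerts 0, σ .piece i ≠ 0
  parent_le : ∀ i < σ .numVerts 0, σ .parent i ≤ i
  parent_adj : ∀ i < σ .numVerts 0, σ .parent i ≠ i →
    IncAdj H (σ .order i) (σ .order (σ .parent i)) ∧ σ .piece (σ .parent i) = σ .piece i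
  root_unique : ∀ i < σ .numVerts 0, ∀ j < σ .numVerts 0, σ .parent i = i → σ .parent j = j →
    σ .piece i = σ .piece j → i = j
  seeded_iff : ∀ l, σ .seeded l ≠ 0 ↔ ∃ i < σ .numVerts 0, σ .piece i = l
  card_eq : ∃ L : Finset ℕ, L.card = σ .threshold 0 ∧ ∀ l, l ∈ L ↔ σ .seeded l ≠ 0

theorem PartialForest.congr {H : ℕ → Finset ℕ} {σ τ : ArrState} (h : PartialForest H σ)
    (e : ∀ a ∈ [Arr.numVerts, .index, .order, .piece, .block, .parent, .seeded, .threshold],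
      τ a = σ a) : PartialForest H τ := by
  have e1 : τ .numVerts = σ .numVerts := e _ (by decide)
  have e2 : τ .index = σ .index := e _ (by decide)
  have e3 : τ .order = σ .order := e _ (by decide)
  have e4 : τ .piece = σ .piece := e _ (by decide)
  have e5 : τ .block = σ .block := e _ (by decide)
  have e6 : τ .parent = σ .parent := e _ (by decide)
  have e7 : τ .seeded = σ .seeded := e _ (by decide)
  have e8 : τ .threshold = σ .threshold := e _ (by decide)
  constructor
  all_goals simp only [e1, e2, e3, e4, e5, e6, e7, e8]
  exacts [h.index_order, h.order_index, h.piece_eq, h.piece_ne, h.parent_le, h.parent_adj,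
    h.root_unique, h.seeded_iff, h.card_eq]

/-- A new vertex is added either as the root of a new tree, or as a child in its block. -/
theorem PartialForest.add {H : ℕ → Finset ℕ} {σ τ : ArrState} (h : PartialForest H σ) {n u p : ℕ}
    (hn : σ .numVerts 0 = n) (hu : σ .index u = 0) (hb : σ .block u ≠ 0)
    (e1 : τ .numVerts 0 = n + 1) (e2 : τ .index = Function.update (σ .index) u (n + 1))
    (e3 : τ .order = Function.update (σ .order) n u)
    (e4 : τ .piece = Function.update (σ .piece) n (σ .block u)) (e5 : τ .block = σ .block)
    (e6 : τ .parent = Function.update (σ .parent) n p)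
    (hp : (p = n ∧ σ .seeded (σ .block u) = 0 ∧
        τ .seeded = Function.update (σ .seeded) (σ .block u) 1 ∧
        τ .threshold 0 = σ .threshold 0 + 1) ∨
      (p < n ∧ IncAdj H u (σ .order p) ∧ σ .block (σ .order p) = σ .block u ∧
        τ .seeded = σ .seeded ∧ τ .threshold 0 = σ .threshold 0)) :
    PartialForest H τ := by
  classical
  have hne : ∀ i < n, σ .order i ≠ u := fun i hi he => by
    have := h.index_order i (hn ▸ hi)
    rw [he, hu] at this
    omega
  have lt : ∀ {i}, i < n + 1 → i ≠ n → i < n := fun h1 h2 => by omega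
  have hpiece : p < n → σ .piece p = σ .block (σ .order p) := fun hpn => h.piece_eq p (hn ▸ hpn)
  refine ⟨fun i hi => ?_, fun v hv => ?_, fun i hi => ?_, fun i hi => ?_, fun i hi => ?_,
    fun i hi hpi => ?_, fun i hi j hj hpi hpj hij => ?_, fun l => ?_, ?_⟩
  · rw [e1] at hi
    rw [e2, e3]
    by_cases hin : i = n
    · rw [hin, Function.update_self, Function.update_self]
    · rw [Function.update_of_ne hin, Function.update_of_ne (hne i (lt hi hin))]
      exact h.index_order i (hn ▸ lt hi hin)
  · rw [e2] at hv
    rw [e1, e3]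
    by_cases hvu : v = u
    · exact ⟨n, by omega, by rw [Function.update_self, hvu]⟩
    · rw [Function.update_of_ne hvu] at hv
      obtain ⟨i, hi, rfl⟩ := h.order_index v hv
      exact ⟨i, by omega, Function.update_of_ne (by omega) _ _⟩
  · rw [e1] at hi
    rw [e3, e4, e5]
    by_cases hin : i = n
    · rw [hin, Function.update_self, Function.update_self]
    · rw [Function.update_of_ne hin, Function.update_of_ne hin]
      exact h.piece_eq i (hn ▸ lt hi hin)
  · rw [e1] at hi
    rw [e4]
    by_cases hin : i = n
    · rw [hin, Function.update_self]; exact hb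
    · rw [Function.update_of_ne hin]
      exact h.piece_ne i (hn ▸ lt hi hin)
  · rw [e1] at hi
    rw [e6]
    by_cases hin : i = n
    · rw [hin, Function.update_self]; rcases hp with h | h <;> omega
    · rw [Function.update_of_ne hin]
      exact h.parent_le i (hn ▸ lt hi hin)
  · rw [e1] at hi
    rw [e6] at hpi
    rw [e3, e4, e6]
    by_cases hin : i = n
    · subst hin
      rw [Function.update_self] at hpi
      rcases hp with ⟨rfl, -⟩ | ⟨hpn, h1, h2, -⟩
      · exact absurd rfl hpi
      · simp only [Function.update_self, Function.update_of_ne hpi, hpiece hpn]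
        exact ⟨h1, h2⟩
    · rw [Function.update_of_ne hin] at hpi ⊢
      have hi' := lt hi hin
      have := h.parent_le i (hn ▸ hi')
      rw [Function.update_of_ne hin, Function.update_of_ne (by omega),
        Function.update_of_ne (by omega), Function.update_of_ne hin]
      exact h.parent_adj i (hn ▸ hi') hpi
  · rw [e1] at hi hj
    rw [e6] at hpi hpj
    rw [e4] at hij
    -- A new root has a label that did not occur before.
    have new : ∀ m < n, p = n → σ .piece m ≠ σ .block u := by
      intro m hm hpn he
      rcases hp with ⟨-, h1, -⟩ | ⟨h1, -⟩
      · exact (h.seeded_iff _).2 ⟨m, hn ▸ hm, he⟩ h1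
      · omega
    by_cases hin : i = n
    · by_cases hjn : j = n
      · omega
      · rw [hin, Function.update_self] at hpi hij
        rw [Function.update_of_ne hjn] at hij
        exact absurd hij.symm (new j (lt hj hjn) hpi)
    · rw [Function.update_of_ne hin] at hpi hij
      by_cases hjn : j = n
      · rw [hjn, Function.update_self] at hpj hij
        exact absurd hij (new i (lt hi hin) hpj)
      · rw [Function.update_of_ne hjn] at hpj hij
        exact h.root_unique i (hn ▸ lt hi hin) j (hn ▸ lt hj hjn) hpi hpj hij
  · rw [e1, e4]
    have old : (∃ i < n + 1, Function.update (σ .piece) n (σ .block u) i = l) ↔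
        l = σ .block u ∨ ∃ i < σ .numVerts 0, σ .piece i = l := by
      rw [hn]
      constructor
      · rintro ⟨i, hi, rfl⟩
        by_cases hin : i = n
        · left; rw [hin, Function.update_self]
        · right; exact ⟨i, lt hi hin, by rw [Function.update_of_ne hin]⟩
      · rintro (rfl | ⟨i, hi, rfl⟩)
        · exact ⟨n, by omega, Function.update_self _ _ _⟩
        · exact ⟨i, by omega, Function.update_of_ne (by omega) _ _⟩
    rw [old, ← h.seeded_iff]
    rcases hp with ⟨-, -, h2, -⟩ | ⟨hpn, -, h1, h2, -⟩
    · rw [h2]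
      by_cases hl : l = σ .block u
      · rw [hl, Function.update_self]; simp
      · rw [Function.update_of_ne hl]; simp [hl]
    · rw [h2]
      refine ⟨Or.inr, fun h3 => h3.elim (fun h4 => ?_) id⟩
      rw [h4, ← h1, ← hpiece hpn]
      exact (h.seeded_iff _).2 ⟨p, hn ▸ hpn, rfl⟩
  · obtain ⟨L, hL, hL'⟩ := h.card_eq
    rcases hp with ⟨-, h1, h2, h3⟩ | ⟨-, -, -, h2, h3⟩
    · refine ⟨insert (σ .block u) L, ?_, fun l => ?_⟩
      · rw [Finset.card_insert_of_notMem (fun h' => (hL' _).1 h' h1), hL, h3]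
      · rw [Finset.mem_insert, hL', h2]
        by_cases hl : l = σ .block u
        · rw [hl, Function.update_self]; simp
        · rw [Function.update_of_ne hl]; simp [hl]
    · exact ⟨L, by rw [hL, h3], fun l => by rw [hL', h2]⟩

section

variable {H : ℕ → Finset ℕ} (E : ArrEnv) (σ : ArrState)

/-- The effect of `addVertex`. -/
structure Adds (σ τ : ArrState) (u p : ℕ) : Prop where
  numVerts : τ .numVerts 0 = σ .numVerts 0 + 1
  index : τ .index = Function.update (σ .index) u (σ .numVerts 0 + 1)
  order : τ .order = Function.update (σ .order) (σ .numVerts 0) u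
  piece : τ .piece = Function.update (σ .piece) (σ .numVerts 0) (σ .block u)
  parent : τ .parent = Function.update (σ .parent) (σ .numVerts 0) p
  other : ∀ a ∉ [Arr.numVerts, .index, .order, .piece, .parent], τ a = σ a

theorem run_addVertex {v p : ArrExpr} {u q : ℕ} (hv : v = sc .fst ∨ v = sc .snd)
    (hp : p = sc .numVerts ∨ p = .sub (.arr .index (sc .fst)) (.const 1) ∨
      p = .sub (.arr .index (sc .snd)) (.const 1)) (hu : v.val E σ = u) (hq : p.val E σ = q) :
    Adds σ ((addVertex v p).run E σ) u q := by
  unfold addVertex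
  simp only [run_seqs_cons, run_seqs_nil, run_set, run_store]
  rw [hu]
  have h1 : p.val E (σ.upd .order ((sc .numVerts).val E σ) u) = q := by
    rw [← hq]; rcases hp with rfl | rfl | rfl <;> simp
  rw [h1]
  have h2 : v.val E ((σ.upd .order ((sc .numVerts).val E σ) u).upd .parent
      ((sc .numVerts).val E (σ.upd .order ((sc .numVerts).val E σ) u)) q) = u := by
    rw [← hu]; rcases hv with rfl | rfl <;> simp
  have h3 : ∀ y z, v.val E (((σ.upd .order ((sc .numVerts).val E σ) u).upd .parent
      ((sc .numVerts).val E (σ.upd .order ((sc .numVerts).val E σ) u)) q).upd .piece y z) = u := by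
    intro y z
    rw [← hu]; rcases hv with rfl | rfl <;> simp
  rw [h3]
  simp only [val] at h2 ⊢
  rw [h2]
  constructor
  · simp
  · funext i; simp [Function.update_apply]
  · funext i; simp [Function.update_apply]
  · funext i; simp [Function.update_apply]
  · funext i; simp [Function.update_apply]
  · intro a ha
    simp only [List.mem_cons, List.not_mem_nil, or_false, not_or] at ha
    funext i
    simp [ha]

/-- The block of the incidence with number `e`, if it is a block, has a root, and both ends or none
of them are in the forest. -/
def EdgeClosed (σ : ArrState) (e : ℕ) : Prop :=
  σ .block (2 * σ .edgeClause e + 1) = σ .block (2 * σ .edgeVar e) →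
    σ .block (2 * σ .edgeVar e) ≠ 0 → σ .seeded (σ .block (2 * σ .edgeVar e)) ≠ 0 ∧
      (σ .index (2 * σ .edgeClause e + 1) ≠ 0 ↔ σ .index (2 * σ .edgeVar e) ≠ 0)

theorem EdgeClosed.congr {σ τ : ArrState} {e : ℕ} (h : EdgeClosed σ e)
    (e' : ∀ a ∈ [Arr.block, .edgeClause, .edgeVar, .seeded, .index], τ a = σ a) :
    EdgeClosed τ e := by
  unfold EdgeClosed
  rw [e' .block (by decide), e' .edgeClause (by decide), e' .edgeVar (by decide),
    e' .seeded (by decide), e' .index (by decide)]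
  exact h

theorem run_discoverEdge (h : PartialForest H σ) (hE : EdgesAre σ fun j x => x ∈ H j) {e : ℕ}
    (he : σ .edge 0 = e) (hen : e < σ .numEdges 0) {ρ : ArrState}
    (hρ : ρ = discoverEdge.run E σ) :
    PartialForest H ρ ∧
      ((EdgeClosed σ e ∧ ρ .numVerts = σ .numVerts ∧ ρ .index = σ .index ∧
          ρ .seeded = σ .seeded) ∨
        (¬ EdgeClosed σ e ∧ σ .numVerts 0 < ρ .numVerts 0)) := by
  have hadj : IncAdj H (2 * σ .edgeClause e + 1) (2 * σ .edgeVar e) :=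
    ⟨_, _, (hE _ _).2 ⟨e, hen, rfl, rfl⟩, Or.inl ⟨rfl, rfl⟩⟩
  unfold EdgeClosed
  obtain ⟨u, hu⟩ : ∃ u, u = 2 * σ .edgeClause e + 1 := ⟨_, rfl⟩
  obtain ⟨w, hw⟩ : ∃ w, w = 2 * σ .edgeVar e := ⟨_, rfl⟩
  rw [← hu, ← hw] at hadj ⊢
  have huw : u ≠ w := by omega
  unfold discoverEdge at hρ
  simp only [run_seqs_cons, run_seqs_nil, run_set] at hρ
  set τ : ArrState := (σ.upd .fst 0 _).upd .snd 0 _ with hτ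
  have f : ∀ a, a ≠ .fst → a ≠ .snd → τ a = σ a := fun a h1 h2 =>
    (ArrState.upd_of_ne _ h2 _ _).trans (ArrState.upd_of_ne _ h1 _ _)
  have t1 : τ .fst 0 = u := by simp [hτ, he, hu]; omega
  have t2 : τ .snd 0 = w := by simp [hτ, he, hw]; omega
  have fb : τ .block = σ .block := f _ (by decide) (by decide)
  have fs : τ .seeded = σ .seeded := f _ (by decide) (by decide)
  have fi : τ .index = σ .index := f _ (by decide) (by decide)
  have fn : τ .numVerts = σ .numVerts := f _ (by decide) (by decide)
  have hPτ : PartialForest H τ := h.congr fun a ha => f a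
    (by rintro rfl; exact absurd ha (by decide)) (by rintro rfl; exact absurd ha (by decide))
  by_cases h1 : σ .block u = σ .block w
  swap
  · rw [run_whenEq_neg (by simpa [t1, t2, fb] using h1)] at hρ
    rw [hρ]
    exact ⟨hPτ, Or.inl ⟨fun h => absurd h h1, fn, fi, fs⟩⟩
  rw [run_whenEq_pos (by simpa [t1, t2, fb] using h1)] at hρ
  by_cases h2 : σ .block u = 0
  · rw [run_whenNe_neg (by simpa [t1, fb] using h2)] at hρ
    rw [hρ]
    exact ⟨hPτ, Or.inl ⟨fun _ h => absurd (h1 ▸ h2) h, fn, fi, fs⟩⟩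
  rw [run_whenNe_pos (by simpa [t1, fb] using h2)] at hρ
  simp only [run_seqs_cons, run_seqs_nil] at hρ
  -- The state after a root has been added, if necessary.
  obtain ⟨κ, hκ, c1, c2, c3, c4, c5, c6, c7, c8⟩ : ∃ κ : ArrState,
      (whenEq (.arr .seeded (.arr .block (sc .fst))) (.const 0) (seqs [
          .store .seeded (.arr .block (sc .fst)) (.const 1),
          set .threshold (.add (sc .threshold) (.const 1)),
          addVertex (sc .fst) (sc .numVerts)])).run E τ = κ ∧
        PartialForest H κ ∧ κ .block = σ .block ∧ κ .fst 0 = u ∧ κ .snd 0 = w ∧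
        κ .seeded (σ .block u) ≠ 0 ∧ σ .numVerts 0 ≤ κ .numVerts 0 ∧
        (σ .seeded (σ .block u) = 0 → σ .numVerts 0 < κ .numVerts 0) ∧
        (σ .seeded (σ .block u) ≠ 0 → κ = τ) := by
    refine ⟨_, rfl, ?_⟩
    by_cases h3 : σ .seeded (σ .block u) = 0
    · rw [run_whenEq_pos (by simpa [t1, fb, fs] using h3)]
      simp only [run_seqs_cons, run_seqs_nil, run_set, run_store]
      set μ : ArrState := (τ.upd .seeded _ _).upd .threshold 0 _ with hμ
      have g : ∀ a, a ≠ .seeded → a ≠ .threshold → μ a = τ a := fun a h1 h2 =>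
        (ArrState.upd_of_ne _ h2 _ _).trans (ArrState.upd_of_ne _ h1 _ _)
      have gn : μ .numVerts = σ .numVerts := (g _ (by decide) (by decide)).trans fn
      have gb : μ .block = σ .block := (g _ (by decide) (by decide)).trans fb
      have gs : μ .seeded = Function.update (σ .seeded) (σ .block u) 1 := by
        funext i; simp [hμ, t1, fb, fs, Function.update_apply]
      have gt : μ .threshold 0 = τ .threshold 0 + 1 := by simp [hμ]
      have hA := run_addVertex E μ (v := sc .fst) (p := sc .numVerts) (u := u)
        (q := σ .numVerts 0) (Or.inl rfl) (Or.inl rfl)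
        (by simp [g .fst (by decide) (by decide), t1]) (by simp [gn])
      set κ := (addVertex (sc .fst) (sc .numVerts)).run E μ with hκ
      have hui : σ .index u = 0 := by
        by_contra hne
        obtain ⟨i, hi, rfl⟩ := h.order_index u hne
        exact (h.seeded_iff _).2 ⟨i, hi, h.piece_eq i hi⟩ h3
      refine ⟨?_, ?_, ?_, ?_, ?_, ?_, ?_, fun h => absurd h3 h⟩
      · refine hPτ.add (n := σ .numVerts 0) (u := u) (p := σ .numVerts 0) (by rw [fn])
          (by rw [fi]; exact hui) (by rw [fb]; exact h2) ?_ ?_ ?_ ?_ ?_ ?_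
          (Or.inl ⟨rfl, ?_, ?_, ?_⟩)
        · rw [hA.numVerts, gn]
        · rw [hA.index, gn, g .index (by decide) (by decide)]
        · rw [hA.order, gn, g .order (by decide) (by decide)]
        · rw [hA.piece, gn, gb, fb, g .piece (by decide) (by decide)]
        · rw [hA.other _ (by decide), gb, fb]
        · rw [hA.parent, gn, g .parent (by decide) (by decide)]
        · rw [fb, fs]; exact h3
        · rw [hA.other _ (by decide), gs, fb, fs]
        · rw [hA.other _ (by decide), gt]
      · rw [hA.other _ (by decide), gb]
      · rw [hA.other _ (by decide), g _ (by decide) (by decide), t1]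
      · rw [hA.other _ (by decide), g _ (by decide) (by decide), t2]
      · rw [hA.other _ (by decide), gs, Function.update_self]; exact one_ne_zero
      · rw [hA.numVerts, gn]; omega
      · intro _; rw [hA.numVerts, gn]; omega
    · rw [run_whenEq_neg (by simpa [t1, fb, fs] using h3)]
      exact ⟨hPτ, fb, t1, t2, by rw [fs]; exact h3, by rw [fn], fun h => absurd h h3,
        fun _ => rfl⟩
  rw [hκ] at hρ
  have closed_of : σ .seeded (σ .block u) ≠ 0 → (σ .index u ≠ 0 ↔ σ .index w ≠ 0) →
      (σ .block u = σ .block w → σ .block w ≠ 0 → σ .seeded (σ .block w) ≠ 0 ∧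
        (σ .index u ≠ 0 ↔ σ .index w ≠ 0)) := fun g1 g2 _ _ => ⟨h1 ▸ g1, g2⟩
  have not_closed : ¬ (σ .seeded (σ .block u) ≠ 0 ∧ (σ .index u ≠ 0 ↔ σ .index w ≠ 0)) →
      ¬ (σ .block u = σ .block w → σ .block w ≠ 0 → σ .seeded (σ .block w) ≠ 0 ∧
        (σ .index u ≠ 0 ↔ σ .index w ≠ 0)) := fun g1 g2 =>
    g1 (h1 ▸ g2 h1 (h1 ▸ h2))
  -- If no further vertex is added, then both ends or none of them are in the forest.
  have stay : (κ .index u ≠ 0 ↔ κ .index w ≠ 0) → ρ = κ → PartialForest H ρ ∧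
      (((σ .block u = σ .block w → σ .block w ≠ 0 → σ .seeded (σ .block w) ≠ 0 ∧
        (σ .index u ≠ 0 ↔ σ .index w ≠ 0)) ∧ ρ .numVerts = σ .numVerts ∧ ρ .index = σ .index ∧
          ρ .seeded = σ .seeded) ∨
        (¬ (σ .block u = σ .block w → σ .block w ≠ 0 → σ .seeded (σ .block w) ≠ 0 ∧
        (σ .index u ≠ 0 ↔ σ .index w ≠ 0)) ∧ σ .numVerts 0 < ρ .numVerts 0)) := by
    rintro g rfl
    refine ⟨c1, ?_⟩
    by_cases h3 : σ .seeded (σ .block u) = 0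
    · exact Or.inr ⟨not_closed fun h => h.1 h3, c7 h3⟩
    · rw [c8 h3, fi] at g
      rw [c8 h3]
      exact Or.inl ⟨closed_of h3 g, fn, fi, fs⟩
  -- The case that the vertex `y` is added as a child of the vertex `z`.
  have child : ∀ y z, κ .block y = κ .block z → κ .block y ≠ 0 → IncAdj H y z → κ .index y = 0 →
      κ .index z ≠ 0 → (κ .index u ≠ 0 ↔ ¬ κ .index w ≠ 0) →
      Adds κ ρ y (κ .index z - 1) → PartialForest H ρ ∧
      (((σ .block u = σ .block w → σ .block w ≠ 0 → σ .seeded (σ .block w) ≠ 0 ∧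
        (σ .index u ≠ 0 ↔ σ .index w ≠ 0)) ∧ ρ .numVerts = σ .numVerts ∧ ρ .index = σ .index ∧
          ρ .seeded = σ .seeded) ∨
        (¬ (σ .block u = σ .block w → σ .block w ≠ 0 → σ .seeded (σ .block w) ≠ 0 ∧
        (σ .index u ≠ 0 ↔ σ .index w ≠ 0)) ∧ σ .numVerts 0 < ρ .numVerts 0)) := by
    intro y z g1 g2 g3 g4 g5 g6 hA
    obtain ⟨i, hi, rfl⟩ := c1.order_index z g5
    have hidx := c1.index_order i hi
    rw [hidx, Nat.add_sub_cancel] at hA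
    refine ⟨c1.add rfl g4 g2 hA.numVerts hA.index hA.order hA.piece (hA.other _ (by decide))
      hA.parent (Or.inr ⟨hi, g3, g1.symm, hA.other _ (by decide),
        by rw [hA.other _ (by decide)]⟩), Or.inr ⟨?_, ?_⟩⟩
    · refine not_closed fun h' => ?_
      rw [c8 h'.1, fi] at g6
      have := h'.2
      tauto
    · rw [hA.numVerts]; omega
  by_cases hiu : κ .index u = 0
  · rw [run_ite_neg (by simpa [c3] using hiu)] at hρ
    by_cases hiw : κ .index w = 0
    · rw [run_ite_neg (by simpa [c4] using hiw)] at hρ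
      exact stay (by simp [hiu, hiw]) hρ
    · rw [run_ite_pos (by simpa [c4] using hiw)] at hρ
      have hA := run_addVertex E κ (v := sc .fst) (u := u) (q := κ .index w - 1) (Or.inl rfl)
        (Or.inr (Or.inr rfl)) (by simp [c3]) (by simp [c4])
      rw [← hρ] at hA
      exact child u w (by rw [c2, h1]) (by rw [c2]; exact h2) hadj hiu hiw (by simp [hiu, hiw]) hA
  · rw [run_ite_pos (by simpa [c3] using hiu)] at hρ
    by_cases hiw : κ .index w = 0
    · rw [run_whenEq_pos (by simpa [c4] using hiw)] at hρ
      have hA := run_addVertex E κ (v := sc .snd) (u := w) (q := κ .index u - 1) (Or.inr rfl)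
        (Or.inr (Or.inl rfl)) (by simp [c4]) (by simp [c3])
      rw [← hρ] at hA
      exact child w u (by rw [c2, h1]) (by rw [c2, ← h1]; exact h2) hadj.symm hiw hiu
        (by simp [hiu, hiw]) hA
    · rw [run_whenEq_neg (by simpa [c4] using hiw)] at hρ
      exact stay (by simp [hiu, hiw]) hρ

/-- All incidences are closed; see `EdgeClosed`. -/
def AllClosed (σ : ArrState) : Prop := ∀ e < σ .numEdges 0, EdgeClosed σ e

theorem run_discover (hE : EdgesAre σ fun j x => x ∈ H j) (hN : σ .numEdges 0 ≤ E.size)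
    {V : Finset ℕ} (hV : V.card < E.size) (hVb : ∀ u, σ .block u ≠ 0 → u ∈ V)
    (h0 : σ .numVerts 0 = 0) (h1 : ∀ u, σ .index u = 0) (h2 : ∀ l, σ .seeded l = 0)
    (h3 : σ .threshold 0 = 0) {ρ : ArrState} (hρ : ρ = discover.run E σ) :
    PartialForest H ρ ∧ AllClosed ρ ∧ ρ .numVerts 0 < E.size := by
  have init : PartialForest H σ := by
    constructor
    case order_index => intro u hu; exact absurd (h1 u) hu
    case seeded_iff => intro l; rw [h2, h0]; simp
    case card_eq => exact ⟨∅, by simp [h3], by simp [h2]⟩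
    all_goals (rw [h0]; intro i hi; exact absurd hi (Nat.not_lt_zero _))
  -- The vertices of the forest have distinct codes in `V`.
  have bound : ∀ τ : ArrState, τ .block = σ .block → PartialForest H τ →
      τ .numVerts 0 < E.size := by
    intro τ hb h
    refine lt_of_le_of_lt ?_ hV
    have : ((Finset.range (τ .numVerts 0)).image (τ .order)).card = τ .numVerts 0 := by
      rw [Finset.card_image_of_injOn, Finset.card_range]
      intro i hi j hj hij
      rw [Finset.coe_range, Set.mem_Iio] at hi hj
      have e1 := h.index_order i hi
      have e2 := h.index_order j hj
      rw [hij] at e1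
      omega
    rw [← this]
    refine Finset.card_le_card fun u hu => ?_
    obtain ⟨i, hi, rfl⟩ := Finset.mem_image.1 hu
    rw [Finset.mem_range] at hi
    refine hVb _ ?_
    rw [← hb, ← h.piece_eq i hi]
    exact h.piece_ne i hi
  have key := ArrProg.rep_induction_frame (E := E) (a := .pass) (σ := σ)
    (c := .rep .edge (whenLt (sc .edge) (sc .numEdges) discoverEdge))
    (fun t τ => PartialForest H τ ∧ (t ≤ τ .numVerts 0 ∨ AllClosed τ)) ⟨init, Or.inl (by omega)⟩ ?_
  · have hb : ρ .block = σ .block := by rw [hρ]; exact ArrProg.run_frame _ _ (by decide)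
    unfold discover at hρ
    rw [← hρ] at key
    have := bound ρ hb key.1
    exact ⟨key.1, key.2.resolve_left (by omega), this⟩
  · rintro t _ τ hf ⟨i1, i2⟩
    set τ₀ : ArrState := τ.upd .pass 0 t with hτ₀
    have g : ∀ a, a ≠ .pass → τ₀ a = τ a := fun a ha => ArrState.upd_of_ne _ ha _ _
    have inner := ArrProg.rep_induction_frame (E := E) (a := .edge) (σ := τ₀)
      (c := whenLt (sc .edge) (sc .numEdges) discoverEdge)
      (fun s κ => PartialForest H κ ∧
        (((∀ e < s, e < τ .numEdges 0 → EdgeClosed τ e) ∧ κ .numVerts = τ .numVerts ∧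
          κ .index = τ .index ∧ κ .seeded = τ .seeded) ∨
        (¬ AllClosed τ ∧ τ .numVerts 0 < κ .numVerts 0))) ?_ ?_
    · obtain ⟨j1, j2⟩ := inner
      set κ := (ArrProg.rep .edge (whenLt (sc .edge) (sc .numEdges) discoverEdge)).run E τ₀ with hκ
      have fr : ∀ a, a ∉ (ArrProg.rep .edge (whenLt (sc .edge) (sc .numEdges) discoverEdge)).mods →
          a ≠ .pass → κ a = τ a := fun a h h' => (ArrProg.run_frame _ _ h).trans (g a h')
      have fe : κ .numEdges = τ .numEdges := fr _ (by decide) (by decide)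
      refine ⟨j1, ?_⟩
      rcases j2 with ⟨k1, k2, k3, k4⟩ | ⟨k1, k2⟩
      · right
        intro e he
        rw [fe] at he
        have hNτ : τ .numEdges 0 ≤ E.size := by rw [hf _ (by decide)]; exact hN
        refine (k1 e (by omega) he).congr ?_
        simp only [List.mem_cons, List.not_mem_nil, or_false, forall_eq_or_imp, forall_eq]
        exact ⟨fr _ (by decide) (by decide), fr _ (by decide) (by decide),
          fr _ (by decide) (by decide), k4, k3⟩
      · left
        have := i2.resolve_right k1
        omega
    · refine ⟨i1.congr fun a ha => g a (by rintro rfl; exact absurd ha (by decide)),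
        Or.inl ⟨fun e he => absurd he (by omega), g _ (by decide), g _ (by decide),
          g _ (by decide)⟩⟩
    · rintro s _ κ hκ ⟨j1, j2⟩
      have fe : κ .numEdges = τ .numEdges := (hκ _ (by decide)).trans (g _ (by decide))
      have fb : κ .block = τ .block := (hκ _ (by decide)).trans (g _ (by decide))
      have fc : κ .edgeClause = τ .edgeClause := (hκ _ (by decide)).trans (g _ (by decide))
      have fv : κ .edgeVar = τ .edgeVar := (hκ _ (by decide)).trans (g _ (by decide))
      have g' : ∀ a, a ≠ .edge → κ.upd .edge 0 s a = κ a := fun a ha => ArrState.upd_of_ne _ ha _ _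
      have hP : PartialForest H (κ.upd .edge 0 s) :=
        j1.congr fun a ha => g' a (by rintro rfl; exact absurd ha (by decide))
      by_cases hs : s < τ .numEdges 0
      · rw [run_whenLt_pos (by simpa [fe] using hs)]
        have hE' : EdgesAre (κ.upd .edge 0 s) fun j x => x ∈ H j := by
          refine hE.congr ?_ ?_ ?_
          · rw [g' _ (by decide), fe]; exact hf _ (by decide)
          · rw [g' _ (by decide), fc]; exact hf _ (by decide)
          · rw [g' _ (by decide), fv]; exact hf _ (by decide)
        obtain ⟨d1, d2⟩ := run_discoverEdge E (κ.upd .edge 0 s) hP hE' (e := s) (by simp)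
          (by rw [g' _ (by decide), fe]; exact hs) rfl
        refine ⟨d1, ?_⟩
        rw [g' .numVerts (by decide), g' .index (by decide), g' .seeded (by decide)] at d2
        rcases j2 with ⟨k1, k2, k3, k4⟩ | ⟨k1, k2⟩
        · have hiff : EdgeClosed (κ.upd .edge 0 s) s ↔ EdgeClosed τ s := by
            unfold EdgeClosed
            rw [g' .block (by decide), g' .edgeClause (by decide), g' .edgeVar (by decide),
              g' .seeded (by decide), g' .index (by decide), fb, fc, fv, k3, k4]
          rw [hiff] at d2
          rcases d2 with ⟨m1, m2, m3, m4⟩ | ⟨m1, m2⟩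
          · left
            refine ⟨fun e he hen => ?_, m2.trans k2, m3.trans k3, m4.trans k4⟩
            rcases Nat.lt_succ_iff_lt_or_eq.1 he with he | rfl
            · exact k1 e he hen
            · exact m1
          · right
            exact ⟨fun h => m1 (h s hs), by rw [← k2]; exact m2⟩
        · right
          refine ⟨k1, ?_⟩
          rcases d2 with ⟨-, m2, -⟩ | ⟨-, m2⟩
          · rw [m2]; exact k2
          · exact k2.trans m2
      · rw [run_whenLt_neg (by simpa [fe] using hs)]
        refine ⟨hP, ?_⟩
        rw [g' .numVerts (by decide), g' .index (by decide), g' .seeded (by decide)]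
        rcases j2 with ⟨k1, k2⟩ | k
        · refine Or.inl ⟨fun e he hen => ?_, k2⟩
          rcases Nat.lt_succ_iff_lt_or_eq.1 he with he | rfl
          · exact k1 e he hen
          · exact absurd hen hs
        · exact Or.inr k

variable {σ}

/-- The forest that has been constructed, with its vertices numbered in the order of discovery. -/
def PartialForest.toForest (h : PartialForest H σ) : Forest H where
  n := σ .numVerts 0
  node := σ .order
  parent := σ .parent
  inj i hi j hj hij := by
    have e1 := h.index_order i hi
    have e2 := h.index_order j hj
    rw [hij] at e1
    omega
  parent_le := h.parent_le
  adj i hi hne := (h.parent_adj i hi hne).1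

theorem PartialForest.stores (h : PartialForest H σ) : Stores σ h.toForest :=
  ⟨rfl, fun _ _ => rfl, h.index_order, h.order_index⟩

theorem PartialForest.divides (h : PartialForest H σ) : h.toForest.Divides (σ .piece) := by
  have key : ∀ i < σ .numVerts 0, h.toForest.IsTop (σ .piece) i → σ .parent i = i := by
    intro i hi htop
    by_contra hne
    exact htop.elim hne fun h' => h' (h.parent_adj i hi hne).2
  intro i hi j hj _ hij hti htj
  exact h.root_unique i hi j hj (key i hi hti) (key j hj htj) hij

theorem PartialForest.card_labels (h : PartialForest H σ) :
    (h.toForest.labels (σ .piece)).card = σ .threshold 0 := by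
  obtain ⟨L, hL, hL'⟩ := h.card_eq
  rw [← hL]
  congr 1
  ext l
  rw [h.toForest.mem_labels, hL', h.seeded_iff]
  constructor
  · rintro ⟨-, h1⟩; exact h1
  · rintro ⟨i, hi, rfl⟩; exact ⟨h.piece_ne i hi, i, hi, rfl⟩

/-- A connected block with an incidence is spanned by its tree. -/
theorem PartialForest.mem_part (h : PartialForest H σ) (hc : AllClosed σ)
    (hE : EdgesAre σ fun j x => x ∈ H j) {l : ℕ} (hl : l ≠ 0)
    (hJ : Joined H {u | σ .block u = l})
    (hex : ∃ a b, IncAdj H a b ∧ σ .block a = l ∧ σ .block b = l) {u : ℕ} (hu : σ .block u = l) :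
    u ∈ h.toForest.part (σ .piece) l := by
  have key : ∀ a b, IncAdj H a b → σ .block a = l → σ .block b = l →
      σ .seeded l ≠ 0 ∧ (σ .index a ≠ 0 ↔ σ .index b ≠ 0) := by
    rintro a b ⟨j, x, hx, ⟨rfl, rfl⟩ | ⟨rfl, rfl⟩⟩ ha hb
    · obtain ⟨e, he, rfl, rfl⟩ := (hE j x).1 hx
      obtain ⟨h1, h2⟩ := hc e he (ha.trans hb.symm) (by omega)
      rw [hb] at h1
      exact ⟨h1, h2⟩
    · obtain ⟨e, he, rfl, rfl⟩ := (hE j x).1 hx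
      obtain ⟨h1, h2⟩ := hc e he (hb.trans ha.symm) (by omega)
      rw [ha] at h1
      exact ⟨h1, h2.symm⟩
  obtain ⟨a, b, hab, ha, hb⟩ := hex
  obtain ⟨i, hi, hil⟩ := (h.seeded_iff l).1 (key a b hab ha hb).1
  have hbi : σ .block (σ .order i) = l := by rw [← h.piece_eq i hi, hil]
  have hlink := hJ (σ .order i) hbi u hu
  have hidx : ∀ v, LinkedIn H {u | σ .block u = l} (σ .order i) v → σ .index v ≠ 0 := by
    intro v hv
    induction hv with
    | refl => rw [h.index_order i hi]; omega
    | tail _ h' ih => exact ((key _ _ h'.2.2 h'.1 h'.2.1).2).1 ih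
  obtain ⟨j, hj, rfl⟩ := h.order_index u (hidx u hlink)
  exact ⟨j, hj, by rw [h.piece_eq j hj, hu], rfl⟩

end

/-! ### The blocks of a model of the grid -/

/-- A model of the `r`-grid in the incidence graph of the sets `H j`, with vertices given by their
codes. -/
structure GridModel (H : ℕ → Finset ℕ) (r : ℕ) (bag : ℕ → ℕ → Set ℕ) : Prop where
  joined : ∀ i < r, ∀ j < r, Joined H (bag i j)
  disjoint : ∀ i < r, ∀ j < r, ∀ i' < r, ∀ j' < r, (i, j) ≠ (i', j') →
    Disjoint (bag i j) (bag i' j')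
  right : ∀ i < r, ∀ j, j + 1 < r → ∃ a ∈ bag i j, ∃ b ∈ bag i (j + 1), IncAdj H a b
  down : ∀ i, i + 1 < r → ∀ j < r, ∃ a ∈ bag i j, ∃ b ∈ bag (i + 1) j, IncAdj H a b

theorem GridModel.gridBlock {H : ℕ → Finset ℕ} {r : ℕ} {bag : ℕ → ℕ → Set ℕ}
    (h : GridModel H r bag) {i j : ℕ} (hi : i + 3 < r) (hj : j + 3 < r) :
    GridBlock H fun p q => bag (i + p) (j + q) where
  joined p hp q hq := h.joined _ (by omega) _ (by omega)
  disjoint p hp q hq p' hp' q' hq' hne := h.disjoint _ (by omega) _ (by omega) _ (by omega) _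
    (by omega) fun he => hne (by rw [Prod.mk.injEq] at he ⊢; omega)
  right p hp q hq := h.right _ (by omega) _ (by omega)
  down p hp q hq := h.down _ (by omega) _ (by omega)

/-- A block is connected: go along a row to its first column, and up to the first row. -/
theorem GridModel.joined_block {H : ℕ → Finset ℕ} {r : ℕ} {bag : ℕ → ℕ → Set ℕ}
    (h : GridModel H r bag) {i j : ℕ} (hi : i + 3 < r) (hj : j + 3 < r) :
    Joined H {u | ∃ p < 4, ∃ q < 4, u ∈ bag (i + p) (j + q)} := by
  set S : Set ℕ := {u | ∃ p < 4, ∃ q < 4, u ∈ bag (i + p) (j + q)} with hS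
  have sub : ∀ p < 4, ∀ q < 4, bag (i + p) (j + q) ⊆ S := fun p hp q hq u hu => ⟨p, hp, q, hq, hu⟩
  obtain ⟨u₀, hu₀, -⟩ := h.right i (by omega) j (by omega)
  have link : ∀ p < 4, ∀ q < 4, ∀ u ∈ bag (i + p) (j + q), ∀ v ∈ bag (i + p) (j + q),
      LinkedIn H S u v := fun p hp q hq u hu v hv =>
    (h.joined _ (by omega) _ (by omega) u hu v hv).mono (sub p hp q hq)
  have col : ∀ p < 4, ∀ u ∈ bag (i + p) (j + 0), LinkedIn H S u u₀ := by
    intro p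
    induction p with
    | zero => exact fun hp u hu => link 0 hp 0 (by omega) u hu u₀ hu₀
    | succ p ih =>
      intro hp u hu
      obtain ⟨a, ha, b, hb, hab⟩ := h.down (i + p) (by omega) (j + 0) (by omega)
      refine (link (p + 1) hp 0 (by omega) u hu b hb).trans
        (Relation.ReflTransGen.head ⟨sub (p + 1) hp 0 (by omega) hb, sub p (by omega) 0 (by omega) ha,
          hab.symm⟩ (ih (by omega) a ha))
  refine Joined.of_root u₀ ?_
  rintro u ⟨p, hp, q, hq, hu⟩
  induction q generalizing u with
  | zero => exact col p hp u hu
  | succ q ih =>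
    obtain ⟨a, ha, b, hb, hab⟩ := h.right (i + p) (by omega) (j + q) (by omega)
    exact (link p hp (q + 1) hq u hu b hb).trans
      (Relation.ReflTransGen.head ⟨sub p hp (q + 1) hq hb, sub p hp q (by omega) ha, hab.symm⟩
        (ih a (by omega) ha))

theorem blockLabel_of_lt {r a b p q : ℕ} (hp : p < 4) (hq : q < 4) (ha : 4 * a + 3 < r)
    (hb : 4 * b + 3 < r) : blockLabel r (4 * a + p) (4 * b + q) = 4 * a * r + 4 * b + 1 := by
  unfold blockLabel
  rw [show 4 * a + p - (4 * a + p) % 4 = 4 * a by omega,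
    show 4 * b + q - (4 * b + q) % 4 = 4 * b by omega, if_pos ⟨ha, hb⟩]

theorem blockLabel_of_ne {r i j : ℕ} (h : blockLabel r i j ≠ 0) :
    4 * (i / 4) + 3 < r ∧ 4 * (j / 4) + 3 < r ∧
      blockLabel r i j = 4 * (i / 4) * r + 4 * (j / 4) + 1 := by
  unfold blockLabel at h ⊢
  rw [show i - i % 4 = 4 * (i / 4) by omega, show j - j % 4 = 4 * (j / 4) by omega] at h ⊢
  split_ifs at h ⊢ with h1
  · exact ⟨h1.1, h1.2, rfl⟩
  · exact absurd rfl h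

theorem position_unique {r a b a' b' : ℕ} (hb : b < r) (hb' : b' < r)
    (h : a * r + b = a' * r + b') : a = a' ∧ b = b' := by
  have e1 := congrArg (· / r) h
  have e2 := congrArg (· % r) h
  have hr : 0 < r := by omega
  simp only [mul_comm _ r, Nat.mul_add_div hr, Nat.div_eq_of_lt hb, Nat.div_eq_of_lt hb', Nat.mul_add_mod,
    Nat.mod_eq_of_lt hb, Nat.mod_eq_of_lt hb'] at e1 e2
  exact ⟨by simpa using e1, e2⟩

/-- The vertices of the bags are labelled with their blocks. -/
structure BlockLabels (r : ℕ) (bag : ℕ → ℕ → Set ℕ) (σ : ArrState) : Prop where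
  block : ∀ i < r, ∀ j < r, ∀ u ∈ bag i j, σ .block u = blockLabel r i j
  exists_bag : ∀ u, σ .block u ≠ 0 → ∃ i < r, ∃ j < r, u ∈ bag i j

theorem BlockLabels.eq {r : ℕ} {bag : ℕ → ℕ → Set ℕ} {σ : ArrState} (h : BlockLabels r bag σ)
    {a b : ℕ} (ha : 4 * a + 3 < r) (hb : 4 * b + 3 < r) :
    {u | σ .block u = 4 * a * r + 4 * b + 1} =
      {u | ∃ p < 4, ∃ q < 4, u ∈ bag (4 * a + p) (4 * b + q)} := by
  ext u
  simp only [Set.mem_ofPred_eq]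
  constructor
  · intro hu
    obtain ⟨i, hi, j, hj, hu'⟩ := h.exists_bag u (by omega)
    have hl := h.block i hi j hj u hu'
    rw [hu] at hl
    obtain ⟨h1, h2, h3⟩ := blockLabel_of_ne (r := r) (i := i) (j := j)
      (by rw [← hl]; exact Nat.succ_ne_zero _)
    rw [h3] at hl
    obtain ⟨e1, e2⟩ := position_unique (by omega) (by omega) (Nat.succ_injective hl)
    exact ⟨i % 4, by omega, j % 4, by omega, by
      rw [e1, e2, Nat.div_add_mod, Nat.div_add_mod]; exact hu'⟩
  · rintro ⟨p, hp, q, hq, hu⟩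
    rw [h.block _ (by omega) _ (by omega) u hu, blockLabel_of_lt hp hq ha hb]

theorem le_gridSize (k : ℕ) (hk : 0 < k) : 28 * (k * 2 ^ k) ≤ gridSize k := by
  have h1 : 49 * (k * k) ≤ 60 * 2 ^ k := by
    rcases Nat.lt_or_ge k 3 with h | h
    · interval_cases k <;> norm_num
    · induction k, h using Nat.le_induction with
      | base => norm_num
      | succ n hn ih =>
        have := ih (by omega)
        rw [pow_succ]
        nlinarith
  have h2 : (7 * (k * 2 ^ k)) ^ 2 ≤ obs k + 1 := by
    unfold obs same
    have e : 2 ^ k * (15 * 2 ^ (2 * k + 2)) = 60 * 2 ^ k * (2 ^ k * 2 ^ k) := by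
      rw [pow_add, two_mul, pow_add]; ring
    rw [e]
    calc (7 * (k * 2 ^ k)) ^ 2 = 49 * (k * k) * (2 ^ k * 2 ^ k) := by ring
      _ ≤ 60 * 2 ^ k * (2 ^ k * 2 ^ k) := Nat.mul_le_mul_right _ h1
      _ ≤ _ := by omega
  have h3 : ((7 * (k * 2 ^ k) : ℕ) : ℝ) ≤ Real.sqrt ((obs k : ℝ) + 1) := by
    apply Real.le_sqrt_of_sq_le
    exact_mod_cast h2
  have h4 : ((28 * (k * 2 ^ k) : ℕ) : ℝ) ≤ 4 * Real.sqrt ((obs k : ℝ) + 1) := by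
    push_cast at h3 ⊢
    linarith
  have h5 : ((28 * (k * 2 ^ k) : ℕ) : ℝ) ≤ ((gridSize k : ℕ) : ℝ) := h4.trans (Nat.le_ceil _)
  exact Nat.cast_le.1 h5

/-- The number of the `4 × 4` blocks of the grid is large. -/
theorem le_card_blocks (k : ℕ) (hk : 0 < k) :
    49 * (k * k * 4 ^ k) ≤ gridSize k / 4 * (gridSize k / 4) := by
  have h := le_gridSize k hk
  have h1 : 7 * (k * 2 ^ k) ≤ gridSize k / 4 := by omega
  calc 49 * (k * k * 4 ^ k) = 7 * (k * 2 ^ k) * (7 * (k * 2 ^ k)) := by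
        rw [show (4 : ℕ) = 2 * 2 from rfl, mul_pow]; ring
    _ ≤ _ := Nat.mul_le_mul h1 h1

/-- The rounds can start with the blocks of the grid as pieces: every backdoor set touches every
block, by `GridBlock.exists_cross`. -/
theorem PartialForest.ready {H : ℕ → Finset ℕ} {E : ArrEnv} {k : ℕ} {σ : ArrState} (hk : 0 < k)
    (h : PartialForest H σ) (hc : AllClosed σ) (hE : EdgesAre σ fun j x => x ∈ H j)
    {bag : ℕ → ℕ → Set ℕ} (hG : GridModel H (gridSize k) bag)
    (hb : BlockLabels (gridSize k) bag σ) (hr : gridSize k * gridSize k ≤ E.size)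
    (h0 : σ .numPrev 0 = 0) (hp : σ .prevPieces 0 = 4 * quota k) :
    Ready E h.toForest k σ := by
  classical
  set r := gridSize k with hrd
  set T := h.toForest with hT
  have block_of : ∀ i < T.n, ∃ a b, 4 * a + 3 < r ∧ 4 * b + 3 < r ∧
      σ .piece i = 4 * a * r + 4 * b + 1 := by
    intro i hi
    have hne : σ .block (σ .order i) ≠ 0 := by rw [← h.piece_eq i hi]; exact h.piece_ne i hi
    obtain ⟨x, hx, y, hy, hu⟩ := hb.exists_bag _ hne
    have hl := hb.block x hx y hy _ hu
    rw [hl] at hne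
    obtain ⟨h1, h2, h3⟩ := blockLabel_of_ne hne
    exact ⟨x / 4, y / 4, h1, h2, by rw [h.piece_eq i hi, hl, h3]⟩
  have part : ∀ a b, 4 * a + 3 < r → 4 * b + 3 < r → ∀ p < 4, ∀ q < 4,
      ∀ u ∈ bag (4 * a + p) (4 * b + q), u ∈ T.part (σ .piece) (4 * a * r + 4 * b + 1) := by
    intro a b ha hb' p hp q hq u hu
    have hl : ∀ p < 4, ∀ q < 4, ∀ u ∈ bag (4 * a + p) (4 * b + q),
        σ .block u = 4 * a * r + 4 * b + 1 := fun p hp q hq u hu => by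
      rw [hb.block _ (by omega) _ (by omega) u hu, blockLabel_of_lt hp hq ha hb']
    refine h.mem_part hc hE (Nat.succ_ne_zero _) ?_ ?_ (hl p hp q hq u hu)
    · rw [hb.eq ha hb']; exact hG.joined_block ha hb'
    · obtain ⟨x, hx, y, hy, hxy⟩ := hG.right (4 * a) (by omega) (4 * b) (by omega)
      exact ⟨x, y, hxy, hl 0 (by omega) 0 (by omega) x hx, hl 0 (by omega) 1 (by omega) y hy⟩
  have hlabels : r / 4 * (r / 4) ≤ (T.labels (σ .piece)).card := by
    have hcard : (Finset.range (r / 4) ×ˢ Finset.range (r / 4)).card = r / 4 * (r / 4) := by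
      simp
    rw [← hcard]
    refine Finset.card_le_card_of_injOn (fun x => 4 * x.1 * r + 4 * x.2 + 1) ?_ ?_
    · rintro ⟨a, b⟩ hab
      rw [Finset.mem_coe, Finset.mem_product, Finset.mem_range, Finset.mem_range] at hab
      have ha : 4 * a + 3 < r := by have := hab.1; simp only at this; omega
      have hb' : 4 * b + 3 < r := by have := hab.2; simp only at this; omega
      obtain ⟨x, hx, -⟩ := hG.right (4 * a) (by omega) (4 * b) (by omega)
      obtain ⟨i, hi, hil, -⟩ := part a b ha hb' 0 (by omega) 0 (by omega) x hx
      exact T.mem_labels.2 ⟨Nat.succ_ne_zero _, i, hi, hil⟩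
    · rintro ⟨a, b⟩ hab ⟨a', b'⟩ hab' he
      rw [Finset.mem_coe, Finset.mem_product, Finset.mem_range, Finset.mem_range] at hab hab'
      simp only at hab hab' he
      obtain ⟨e1, e2⟩ := position_unique (by omega) (by omega) (Nat.succ_injective he)
      rw [Prod.mk.injEq]
      omega
  have hM : 49 * (k * k * 4 ^ k) ≤ (T.labels (σ .piece)).card := (le_card_blocks k hk).trans hlabels
  have hthr : σ .threshold 0 = (T.labels (σ .piece)).card := h.card_labels.symm
  have hpos : 0 < 49 * (k * k * 4 ^ k) := by positivity
  have hprev : prevVars σ = ∅ := by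
    unfold prevVars firstEntries; rw [h0]; rfl
  refine ⟨h.divides, fun i hi => ?_, by simp [hprev], by omega, by omega, fun B hB _ => ?_,
    Or.inl ⟨hp, hthr, hM⟩⟩
  · obtain ⟨a, b, ha, hb', he⟩ := block_of i hi
    have : (4 * a + 1) * r ≤ r * r := Nat.mul_le_mul_right _ (by omega)
    rw [he]
    rw [Nat.add_mul] at this
    omega
  · rw [hthr]
    refine Finset.card_le_card fun l hl => ?_
    rw [Forest.touchedBy, Finset.mem_filter]
    refine ⟨hl, ?_⟩
    obtain ⟨-, i, hi, rfl⟩ := T.mem_labels.1 hl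
    obtain ⟨a, b, ha, hb', he⟩ := block_of i hi
    obtain ⟨lt, hlt, hcr⟩ := hB.order
    obtain ⟨j, j', hne, ⟨p, hp, q, hq, hj⟩, ⟨p', hp', q', hq', hj'⟩, hx⟩ :=
      (hG.gridBlock ha hb').exists_cross hlt
    have hm := part a b ha hb' p hp q (by omega) _ hj
    have hm' := part a b ha hb' p' hp' q' (by omega) _ hj'
    rw [← he] at hm hm'
    by_cases hd : Disjoint (H j) B
    · by_cases hd' : Disjoint (H j') B
      · exact absurd hx (hcr j j' hne hd hd')
      · obtain ⟨x, hx1, hx2⟩ := Finset.not_disjoint_iff.1 hd'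
        exact ⟨x, hx2, j', hm', hx1⟩
    · obtain ⟨x, hx1, hx2⟩ := Finset.not_disjoint_iff.1 hd
      exact ⟨x, hx2, j, hm, hx1⟩

/-! ### The whole algorithm -/

/-- The algorithm: reads the input, grows a spanning forest of the blocks of the grid, and plays
the rounds. -/
def algorithm : ArrProg :=
  seqs [readFormula, readSide, readBags, discover,
    set .prevPieces (.add (.add .quota .quota) (.add .quota .quota)), playRounds, collectOutput]

/-- On an input with the clauses `cs` and the bags `bags`, the output consists of variables of the
clauses, and hits all backdoor sets. -/
theorem run_algorithm {k : ℕ} (hk : 0 < k) {H : ℕ → Finset ℕ} {cs : List (List Literal)}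
    {bags : List (List (ℕ ⊕ ℕ))} {w : List ℕ}
    (hw : w = k :: (encodeList (encodeList encodeLiteral) cs ++
      encodeList (encodeList encodeVertex) bags))
    (hH : ∀ j x, x ∈ H j ↔ ∃ c, cs[j]? = some c ∧ x ∈ c.map Prod.fst)
    (hlen : bags.length = gridSize k * gridSize k)
    (hdisj : ∀ (m m' : ℕ) l l' v, bags[m]? = some l → bags[m']? = some l' → v ∈ l → v ∈ l' → m = m')
    (hG : GridModel H (gridSize k)
      fun i j => {u | ∃ l, bags[i * gridSize k + j]? = some l ∧ ∃ v ∈ l, vertexCode v = u})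
    {ρ : ArrState}
    (hρ : ρ = algorithm.run ⟨w, w.length + quota k, quota k⟩ fun _ _ => 0) :
    ρ .numOut 0 ≤ 2 * quota k ∧
      (∀ x ∈ (Finset.range (ρ .numOut 0)).image (ρ .out), ∃ j, x ∈ H j) ∧
      ∀ B, IsBackdoorFor H k B → ∃ b ∈ B, b ∈ (Finset.range (ρ .numOut 0)).image (ρ .out) := by
  classical
  set r := gridSize k with hrd
  set E : ArrEnv := ⟨w, w.length + quota k, quota k⟩ with hE
  have hsize : E.size = w.length + quota k := rfl
  have hwl : w.length = 3 + (cs.length + 2 * (cs.map List.length).sum) +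
      (bags.length + 2 * (bags.map List.length).sum) := by
    rw [hw, ← length_flatMap_encodeList encodeLiteral (fun _ => rfl),
      ← length_flatMap_encodeList encodeVertex (fun v => by cases v <;> rfl)]
    simp [encodeList]
    omega
  have hrr : r * r ≤ E.size := by omega
  unfold algorithm at hρ
  simp only [run_seqs_cons, run_seqs_nil, run_set] at hρ
  obtain ⟨p1, n1, e1⟩ := run_readFormula E (fun _ _ => 0) k cs _ hw (Nat.le_add_right _ _) rfl
  set σ₁ := readFormula.run E fun _ _ => 0 with h₁
  have f₁ : ∀ a, a ∉ readFormula.mods → σ₁ a = fun _ => 0 := fun a ha => ArrProg.run_frame _ _ ha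
  obtain ⟨p2, s2⟩ := run_readSide E σ₁ r _ (by rw [p1, encodeList, hlen]) hrr
    (by rw [f₁ _ (by decide)]) (by rw [f₁ _ (by decide)])
  set σ₂ := readSide.run E σ₁ with h₂
  have f₂ : ∀ a, a ∉ readSide.mods → σ₂ a = σ₁ a := fun a ha => ArrProg.run_frame _ _ ha
  have b3 := run_readBags E σ₂ (r := r) (bags := bags)
    (fun l hl => (List.single_le_sum (fun _ _ => Nat.zero_le _) _
      (List.mem_map_of_mem (f := List.length) hl)).trans (by omega))
    hlen ((Nat.le_mul_self r).trans hrr) hdisj p2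
    (fun u => by rw [f₂ _ (by decide), f₁ _ (by decide)])
    (by rw [f₂ _ (by decide), f₁ _ (by decide)]) s2
    (by rw [f₂ _ (by decide), f₁ _ (by decide)])
  set σ₃ := readBags.run E σ₂ with h₃
  have f₃ : ∀ a, a ∉ readBags.mods → σ₃ a = σ₂ a := fun a ha => ArrProg.run_frame _ _ ha
  have g₃ : ∀ a, a ∉ readBags.mods → a ∉ readSide.mods → σ₃ a = σ₁ a := fun a ha ha' =>
    (f₃ a ha).trans (f₂ a ha')
  have z₃ : ∀ a, a ∉ readBags.mods → a ∉ readSide.mods → a ∉ readFormula.mods →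
    σ₃ a = fun _ => 0 := fun a h h' h'' => (g₃ a h h').trans (f₁ a h'')
  have e3 : EdgesAre σ₃ fun j x => x ∈ H j := by
    have : EdgesAre σ₁ fun j x => x ∈ H j := fun j x => (hH j x).trans (e1 j x)
    exact this.congr (g₃ _ (by decide) (by decide)) (g₃ _ (by decide) (by decide))
      (g₃ _ (by decide) (by decide))
  have n3 : σ₃ .numEdges 0 ≤ E.size := by
    rw [g₃ _ (by decide) (by decide)]; exact n1.trans (Nat.le_add_right _ _)
  obtain ⟨pf, ac, nv⟩ := run_discover (H := H) (E := E) (σ := σ₃) e3 n3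
    (V := (bags.flatten.map vertexCode).toFinset)
    (by
      refine (List.toFinset_card_le _).trans_lt ?_
      rw [List.length_map, List.length_flatten]
      omega)
    (fun u hu => by
      obtain ⟨m, -, l, hl, v, hv, rfl⟩ := b3.2 u hu
      rw [List.mem_toFinset]
      exact List.mem_map_of_mem (List.mem_flatten.2 ⟨l, List.mem_of_getElem? hl, hv⟩))
    (by rw [z₃ _ (by decide) (by decide) (by decide)])
    (fun u => by rw [z₃ _ (by decide) (by decide) (by decide)])
    (fun u => by rw [z₃ _ (by decide) (by decide) (by decide)])
    (by rw [z₃ _ (by decide) (by decide) (by decide)]) rfl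
  set σ₄ := discover.run E σ₃ with h₄
  have f₄ : ∀ a, a ∉ discover.mods → σ₄ a = σ₃ a := fun a ha => ArrProg.run_frame _ _ ha
  have z₄ : ∀ a, a ∉ discover.mods → a ∉ readBags.mods → a ∉ readSide.mods →
    a ∉ readFormula.mods → σ₄ a = fun _ => 0 := fun a h h' h'' h3 => (f₄ a h).trans (z₃ a h' h'' h3)
  set σ₅ := σ₄.upd .prevPieces 0 _ with h₅
  have f₅ : ∀ a, a ≠ .prevPieces → σ₅ a = σ₄ a := fun a ha => ArrState.upd_of_ne _ ha _ _
  have e4 : EdgesAre σ₄ fun j x => x ∈ H j :=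
    e3.congr (f₄ _ (by decide)) (f₄ _ (by decide)) (f₄ _ (by decide))
  have e5 : EdgesAre σ₅ fun j x => x ∈ H j :=
    e4.congr (f₅ _ (by decide)) (f₅ _ (by decide)) (f₅ _ (by decide))
  have pf5 : PartialForest H σ₅ := pf.congr fun a ha => f₅ a (by rintro rfl; revert ha; decide)
  have hn5 : σ₅ .numEdges = σ₄ .numEdges := f₅ _ (by decide)
  have ac5 : AllClosed σ₅ := fun e he => (ac e (by rw [← hn5]; exact he)).congr fun a ha =>
    f₅ a (by rintro rfl; revert ha; decide)
  have bl : BlockLabels r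
      (fun i j => {u | ∃ l, bags[i * r + j]? = some l ∧ ∃ v ∈ l, vertexCode v = u}) σ₅ := by
    have hb : σ₅ .block = σ₃ .block := (f₅ _ (by decide)).trans (f₄ _ (by decide))
    constructor
    · rintro i hi j hj u ⟨l, hl, v, hv, rfl⟩
      have hlt : i * r + j < r * r := by
        have : (i + 1) * r ≤ r * r := Nat.mul_le_mul_right _ hi
        rw [Nat.add_mul] at this
        omega
      have hr0 : 0 < r := by omega
      rw [hb, b3.1 _ hlt l hl v hv, mul_comm i r, Nat.mul_add_div hr0, Nat.div_eq_of_lt hj,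
        Nat.mul_add_mod, Nat.mod_eq_of_lt hj, add_zero]
    · intro u hu
      rw [hb] at hu
      obtain ⟨m, hm, l, hl, v, hv, rfl⟩ := b3.2 u hu
      have hr0 : 0 < r := Nat.pos_of_ne_zero fun h => by rw [h] at hm; simp at hm
      refine ⟨m / r, Nat.div_lt_of_lt_mul hm, m % r, Nat.mod_lt _ hr0, l, ?_, v, hv, rfl⟩
      rw [mul_comm, Nat.div_add_mod]
      exact hl
  have rd := pf5.ready (E := E) hk ac5 e5 hG bl hrr
    (by rw [f₅ _ (by decide), z₄ _ (by decide) (by decide) (by decide) (by decide)])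
    (by simp [h₅, hE]; omega)
  have ld : Loaded E pf5.toForest k σ₅ := by
    refine ⟨pf5.stores, e5, ?_, ?_, ?_, rfl, Nat.le_add_left _ _⟩
    · rw [hn5, f₄ _ (by decide)]; exact n3
    · show σ₅ .numVerts 0 < _
      rw [f₅ _ (by decide)]; exact nv
    · rw [ArrEnv.read, hE, hw]; rfl
  have fin := run_playRounds ld hk rd
    (by rw [f₅ _ (by decide), z₄ _ (by decide) (by decide) (by decide) (by decide)])
  have fr : ∀ a, a ∉ playRounds.mods → playRounds.run E σ₅ a = σ₅ a := fun a ha =>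
    ArrProg.run_frame _ _ ha
  have e6 : EdgesAre (playRounds.run E σ₅) fun j x => x ∈ H j :=
    e5.congr (fr _ (by decide)) (fr _ (by decide)) (fr _ (by decide))
  have hq : quota k ≤ E.size := Nat.le_add_left _ _
  obtain ⟨o1, o2⟩ := run_collectOutput (fin.numChosen_le.trans hq) (fin.numPrev_le.trans hq) hρ
  refine ⟨?_, ?_, ?_⟩
  · have := fin.numChosen_le
    have := fin.numPrev_le
    omega
  · rw [o2]
    intro x hx
    have : IsEdgeVar (playRounds.run E σ₅) x :=
      (Finset.mem_union.1 hx).elim (fin.chosen x) (fin.prev x)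
    obtain ⟨e, he, rfl⟩ := this
    exact ⟨_, (e6 _ _).2 ⟨e, he, rfl, rfl⟩⟩
  · rw [o2]; exact fin.hits

/-! ### Decoding the input -/

theorem getElem?_product {α β : Type*} (l : List α) (l' : List β) {i j : ℕ} (hi : i < l.length)
    (hj : j < l'.length) : (l.product l')[i * l'.length + j]? = some (l[i], l'[j]) := by
  induction l generalizing i with
  | nil => exact absurd hi (Nat.not_lt_zero _)
  | cons a l ih =>
    have e : (a :: l).product l' = l'.map (Prod.mk a) ++ l.product l' := rfl
    rw [e]
    cases i with
    | zero =>
      rw [List.getElem?_append_left (by simpa using hj)]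
      simp [hj]
    | succ i =>
      rw [List.getElem?_append_right (by rw [List.length_map, Nat.add_mul]; omega)]
      rw [List.length_map, show (i + 1) * l'.length + j - l'.length = i * l'.length + j by
        rw [Nat.add_mul]; omega, ih (by simpa using hi)]
      rfl

theorem getElem?_grid {α : Type*} {r : ℕ} (f : Fin r × Fin r → α) (i j : Fin r) :
    (((List.finRange r).product (List.finRange r)).map f)[(i : ℕ) * r + j]? = some (f (i, j)) := by
  have := getElem?_product (List.finRange r) (List.finRange r) (i := i) (j := j) (by simp) (by simp)
  simp only [List.length_finRange] at this
  rw [List.getElem?_map, this]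
  simp

theorem exists_of_getElem?_grid {α : Type*} {r : ℕ} {f : Fin r × Fin r → α} {m : ℕ} {l : α}
    (h : (((List.finRange r).product (List.finRange r)).map f)[m]? = some l) :
    ∃ i j : Fin r, m = i * r + j ∧ l = f (i, j) := by
  have hm : m < r * r := by
    have h1 := (List.getElem?_eq_some_iff.1 h).1
    have h2 : ((List.finRange r).product (List.finRange r)).length = _ := List.length_product _ _
    rwa [List.length_map, h2, List.length_finRange] at h1
  have hr : 0 < r := Nat.pos_of_ne_zero fun h => by rw [h] at hm; simp at hm
  have e : m = m / r * r + m % r := by rw [mul_comm, Nat.div_add_mod]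
  refine ⟨⟨m / r, Nat.div_lt_of_lt_mul hm⟩, ⟨m % r, Nat.mod_lt _ hr⟩, e, ?_⟩
  have := getElem?_grid f ⟨m / r, Nat.div_lt_of_lt_mul hm⟩ ⟨m % r, Nat.mod_lt _ hr⟩
  simp only at this
  rw [← e, h] at this
  exact Option.some.inj this

/-- The clause at position `j` of the list, and the empty clause beyond the end of the list. -/
def clauseOf (cs : List (List Literal)) (j : ℕ) : Clause := (cs.getD j []).toFinset

theorem mem_vars_clauseOf {cs : List (List Literal)} {j x : ℕ} :
    x ∈ (clauseOf cs j).vars ↔ ∃ c, cs[j]? = some c ∧ x ∈ c.map Prod.fst := by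
  rw [clauseOf, Clause.vars, List.getD_eq_getElem?_getD]
  cases h : cs[j]? <;> simp

theorem clauseOf_eq {cs : List (List Literal)} {j : ℕ} (hj : j < (cs.map List.toFinset).length) :
    clauseOf cs j = (cs.map List.toFinset)[j] := by
  rw [List.length_map] at hj
  rw [clauseOf, List.getD_eq_getElem _ _ hj, List.getElem_map]

theorem vars_clauseOf_of_le {cs : List (List Literal)} {j : ℕ} (hj : cs.length ≤ j) :
    (clauseOf cs j).vars = ∅ := by
  rw [clauseOf, List.getD_eq_default _ _ hj]; rfl

section
variable {cs : List (List Literal)} {F : CNF}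

theorem ListsFormula.mem_iff (h : ListsFormula cs F) {c : Clause} :
    c ∈ F ↔ c ∈ cs.map List.toFinset := by
  rw [← h.2.2, List.mem_toFinset]

theorem ListsFormula.clauseOf_mem (h : ListsFormula cs F) {j : ℕ} (hj : j < cs.length) :
    clauseOf cs j ∈ F := by
  have hj' : j < (cs.map List.toFinset).length := by simpa using hj
  rw [h.mem_iff, clauseOf_eq hj']
  exact List.getElem_mem hj'

theorem ListsFormula.clauseOf_injective (h : ListsFormula cs F) {i j : ℕ} (hi : i < cs.length)
    (hj : j < cs.length) (hij : clauseOf cs i = clauseOf cs j) : i = j := by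
  have hi' : i < (cs.map List.toFinset).length := by simpa using hi
  have hj' : j < (cs.map List.toFinset).length := by simpa using hj
  rw [clauseOf_eq hi', clauseOf_eq hj'] at hij
  exact (h.2.1.getElem_inj_iff).1 hij

theorem ListsFormula.clauseOf_idxOf (h : ListsFormula cs F) {c : Clause} (hc : c ∈ F) :
    clauseOf cs ((cs.map List.toFinset).idxOf c) = c := by
  have hc' := List.idxOf_lt_length_of_mem (h.mem_iff.1 hc)
  rw [clauseOf_eq hc']
  exact List.getElem_idxOf hc'

theorem ListsFormula.mem_vars (h : ListsFormula cs F) {j x : ℕ} (hx : x ∈ (clauseOf cs j).vars) :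
    x ∈ F.vars := by
  rcases Nat.lt_or_ge j cs.length with hj | hj
  · exact Finset.mem_biUnion.2 ⟨_, h.clauseOf_mem hj, hx⟩
  · rw [vars_clauseOf_of_le hj] at hx
    exact absurd hx (Finset.notMem_empty x)

theorem ListsFormula.isBackdoorFor (h : ListsFormula cs F) (hF : F.Proper) {B : Finset ℕ} {k : ℕ}
    (hB : IsStrongNestedBackdoor F B) (hk : B.card ≤ k) :
    IsBackdoorFor (fun j => (clauseOf cs j).vars) k B where
  card_le := hk
  order := by
    obtain ⟨lt, hlt, hc⟩ := hB.exists_order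
    refine ⟨lt, hlt, fun i j hij hi hj hx => ?_⟩
    obtain ⟨⟨x, hx, -⟩, ⟨y, hy, -⟩⟩ := id hx
    have hi' : i < cs.length := by
      by_contra hn
      rw [vars_clauseOf_of_le (by omega)] at hx
      exact Finset.notMem_empty x hx
    have hj' : j < cs.length := by
      by_contra hn
      rw [vars_clauseOf_of_le (by omega)] at hy
      exact Finset.notMem_empty y hy
    exact hc _ (h.clauseOf_mem hi') _ (h.clauseOf_mem hj')
      (fun he => hij (h.clauseOf_injective hi' hj' he)) hi hj ‹_›
  sum_le J Q hQ := by
    classical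
    have h1 : ∑ j ∈ J, ((clauseOf cs j).vars ∩ Q).card =
        ∑ j ∈ J with j < cs.length, ((clauseOf cs j).vars ∩ Q).card := by
      refine (Finset.sum_subset (Finset.filter_subset _ _) fun j hj hj' => ?_).symm
      rw [vars_clauseOf_of_le, Finset.empty_inter, Finset.card_empty]
      by_contra hn
      exact hj' (Finset.mem_filter.2 ⟨hj, by omega⟩)
    have hinj : Set.InjOn (clauseOf cs) (J.filter fun j => j < cs.length) := fun i hi j hj hij =>
      h.clauseOf_injective (Finset.mem_filter.1 hi).2 (Finset.mem_filter.1 hj).2 hij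
    have h2 := hB.sum_card_inter_le hF (J := (J.filter fun j => j < cs.length).image (clauseOf cs))
      (Q := Q) (fun c hc => by
        obtain ⟨j, hj, rfl⟩ := Finset.mem_image.1 hc
        exact h.clauseOf_mem (Finset.mem_filter.1 hj).2) hQ
    rw [Finset.sum_image hinj, Finset.card_image_of_injOn hinj] at h2
    rw [h1]
    have h3 : 4 ^ B.card * Q.card ≤ 4 ^ k * Q.card :=
      Nat.mul_le_mul_right _ (Nat.pow_le_pow_right (by norm_num) hk)
    have h4 := Finset.card_filter_le J fun j => j < cs.length
    omega

/-- The code of a vertex of the incidence graph. -/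
def incCode (cs : List (List Literal)) (v : IncVertex F) : ℕ := vertexCode (vertexName cs v)

theorem ListsFormula.incCode_injective (h : ListsFormula cs F) :
    Function.Injective (incCode cs (F := F)) := by
  refine vertexCode_injective.comp ?_
  rintro (x | c) (y | d) he <;> simp only [vertexName, Sum.inl.injEq, Sum.inr.injEq, reduceCtorEq] at he
  · exact congrArg _ (Subtype.ext he)
  · refine congrArg _ (Subtype.ext ?_)
    rw [← h.clauseOf_idxOf c.2, ← h.clauseOf_idxOf d.2, he]

theorem ListsFormula.incAdj (h : ListsFormula cs F) {u v : IncVertex F} (huv : (inc F).Adj u v) :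
    IncAdj (fun j => (clauseOf cs j).vars) (incCode cs u) (incCode cs v) := by
  rcases u with x | c <;> rcases v with y | d
  · exact huv.elim
  · exact ⟨_, x.1, by simp only [h.clauseOf_idxOf d.2]; exact huv, Or.inr ⟨rfl, rfl⟩⟩
  · exact ⟨_, y.1, by simp only [h.clauseOf_idxOf c.2]; exact huv, Or.inl ⟨rfl, rfl⟩⟩
  · exact huv.elim

theorem ListsFormula.joined (h : ListsFormula cs F) {A : Finset (IncVertex F)}
    (hA : ((inc F).induce (A : Set (IncVertex F))).Connected) :
    Joined (fun j => (clauseOf cs j).vars) (incCode cs '' (A : Set (IncVertex F))) := by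
  rintro _ ⟨u, hu, rfl⟩ _ ⟨v, hv, rfl⟩
  have := (SimpleGraph.reachable_iff_reflTransGen _ _).1 (hA.preconnected ⟨u, hu⟩ ⟨v, hv⟩)
  exact this.lift (fun x : (A : Set (IncVertex F)) => incCode cs x.1) fun a b hab =>
    ⟨⟨a, a.2, rfl⟩, ⟨b, b.2, rfl⟩, h.incAdj hab⟩

theorem ListsVertices.image_eq {l : List (ℕ ⊕ ℕ)} {A : Finset (IncVertex F)}
    (h : ListsVertices cs l A) : {u | ∃ v ∈ l, vertexCode v = u} = incCode cs '' (A : Set (IncVertex F)) := by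
  ext u
  simp only [Set.mem_ofPred_eq, Set.mem_image, Finset.mem_coe]
  constructor
  · rintro ⟨v, hv, rfl⟩
    rw [← List.mem_toFinset, h.2, Finset.mem_image] at hv
    obtain ⟨a, ha, rfl⟩ := hv
    exact ⟨a, ha, rfl⟩
  · rintro ⟨a, ha, rfl⟩
    refine ⟨vertexName cs a, ?_, rfl⟩
    rw [← List.mem_toFinset, h.2]
    exact Finset.mem_image_of_mem _ ha

variable {r : ℕ} {C : Fin r × Fin r → Finset (IncVertex F)} {bag : Fin r × Fin r → List (ℕ ⊕ ℕ)}

theorem setOf_bag_eq (hb : ∀ p, ListsVertices cs (bag p) (C p)) {i j : ℕ} (hi : i < r)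
    (hj : j < r) :
    {u | ∃ l, (((List.finRange r).product (List.finRange r)).map bag)[i * r + j]? = some l ∧
      ∃ v ∈ l, vertexCode v = u} = incCode cs '' (C (⟨i, hi⟩, ⟨j, hj⟩) : Set (IncVertex F)) := by
  rw [← (hb _).image_eq]
  have := getElem?_grid bag ⟨i, hi⟩ ⟨j, hj⟩
  simp only at this
  simp [this]

theorem ListsFormula.disjoint_image (h : ListsFormula cs F) {A A' : Finset (IncVertex F)}
    (hA : Disjoint A A') : Disjoint (incCode cs '' (A : Set (IncVertex F))) (incCode cs '' (A' : Set (IncVertex F))) :=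
  (Set.disjoint_image_iff h.incCode_injective).2 (Finset.disjoint_coe.2 hA)

theorem ListsFormula.gridModel (h : ListsFormula cs F)
    (hb : ∀ p, ListsVertices cs (bag p) (C p)) (hC : IsMinorModel (gridGraph r) (inc F) C) :
    GridModel (fun j => (clauseOf cs j).vars) r fun i j =>
      {u | ∃ l, (((List.finRange r).product (List.finRange r)).map bag)[i * r + j]? = some l ∧
        ∃ v ∈ l, vertexCode v = u} where
  joined i hi j hj := by
    rw [setOf_bag_eq hb hi hj]
    exact h.joined (hC.connected _)
  disjoint i hi j hj i' hi' j' hj' hne := by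
    rw [setOf_bag_eq hb hi hj, setOf_bag_eq hb hi' hj']
    exact h.disjoint_image (hC.disjoint _ _ fun he => hne (by simpa using he))
  right i hi j hj := by
    rw [setOf_bag_eq hb hi (by omega : j < r), setOf_bag_eq hb hi hj]
    obtain ⟨a, ha, b, hb, hab⟩ := hC.edge (⟨i, hi⟩, ⟨j, by omega⟩) (⟨i, hi⟩, ⟨j + 1, hj⟩)
      (by simp [gridGraph])
    exact ⟨_, ⟨a, ha, rfl⟩, _, ⟨b, hb, rfl⟩, h.incAdj hab⟩
  down i hi j hj := by
    rw [setOf_bag_eq hb (by omega : i < r) hj, setOf_bag_eq hb hi hj]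
    obtain ⟨a, ha, b, hb, hab⟩ := hC.edge (⟨i, by omega⟩, ⟨j, hj⟩) (⟨i + 1, hi⟩, ⟨j, hj⟩)
      (by simp [gridGraph])
    exact ⟨_, ⟨a, ha, rfl⟩, _, ⟨b, hb, rfl⟩, h.incAdj hab⟩

theorem ListsFormula.bag_unique (h : ListsFormula cs F)
    (hb : ∀ p, ListsVertices cs (bag p) (C p)) (hC : IsMinorModel (gridGraph r) (inc F) C)
    (m m' : ℕ) (l l' : List (ℕ ⊕ ℕ)) (v : ℕ ⊕ ℕ)
    (hl : (((List.finRange r).product (List.finRange r)).map bag)[m]? = some l)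
    (hl' : (((List.finRange r).product (List.finRange r)).map bag)[m']? = some l')
    (hv : v ∈ l) (hv' : v ∈ l') : m = m' := by
  obtain ⟨i, j, rfl, rfl⟩ := exists_of_getElem?_grid hl
  obtain ⟨i', j', rfl, rfl⟩ := exists_of_getElem?_grid hl'
  by_cases he : ((i, j) : Fin r × Fin r) = (i', j')
  · rw [Prod.mk.injEq] at he
    rw [he.1, he.2]
  · have hd := h.disjoint_image (hC.disjoint _ _ he)
    rw [← (hb _).image_eq, ← (hb _).image_eq] at hd
    exact (Set.disjoint_left.1 hd ⟨v, hv, rfl⟩ ⟨v, hv', rfl⟩).elim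

end

theorem headed_encodeList {α : Type} {f : α → List ℕ} (hf : ∀ a, (f a).length = 2) (l : List α) :
    Headed (encodeList f l) :=
  ⟨l.length, _, rfl, length_flatMap_pair f hf l⟩

theorem wellShaped_of_eq {k : ℕ} {cs : List (List Literal)} {bags : List (List (ℕ ⊕ ℕ))}
    {w : List ℕ} (hw : w = k :: (encodeList (encodeList encodeLiteral) cs ++
      encodeList (encodeList encodeVertex) bags)) : WellShaped k w := by
  refine ⟨cs.map (encodeList encodeLiteral), bags.map (encodeList encodeVertex), ?_, ?_, ?_⟩
  · intro l hl
    obtain ⟨c, -, rfl⟩ := List.mem_map.1 hl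
    exact headed_encodeList (fun _ => rfl) c
  · intro l hl
    obtain ⟨c, -, rfl⟩ := List.mem_map.1 hl
    exact headed_encodeList (fun v => by cases v <;> rfl) c
  · rw [hw]
    simp [encodeList, List.flatMap]

/-! ### The bounds -/

theorem length_le_wordSize (w : List ℕ) : w.length ≤ wordSize w := by
  induction w with
  | nil => exact Nat.zero_le _
  | cons a w ih =>
    simp only [wordSize, List.map_cons, List.sum_cons, List.length_cons] at ih ⊢
    omega

theorem two_mul_quota_le (k : ℕ) (hk : 0 < k) : 2 * quota k ≤ 2 ^ (7 * k ^ 10) := by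
  have h1 : k ≤ 2 ^ k := Nat.lt_two_pow_self.le
  calc 2 * quota k = 2 ^ 4 * k * (2 ^ 2) ^ k := by unfold quota; ring
    _ ≤ 2 ^ 4 * 2 ^ k * (2 ^ 2) ^ k := by gcongr
    _ = 2 ^ (4 + k + 2 * k) := by rw [← pow_mul, pow_add, pow_add]
    _ ≤ 2 ^ (7 * k) := Nat.pow_le_pow_right (by norm_num) (by omega)
    _ ≤ _ := Nat.pow_le_pow_right (by norm_num)
      (Nat.mul_le_mul_left _ (Nat.le_self_pow (by norm_num) k))

theorem primrec_pow_const (m d : ℕ) : Primrec fun k => m * (quota k + 2) ^ d := by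
  have hpow : ∀ {f g : ℕ → ℕ}, Primrec f → Primrec g → Primrec fun k => f k ^ g k := by
    intro f g hf hg
    have : Primrec fun k => Nat.rec (motive := fun _ => ℕ) 1 (fun _ a => a * f k) (g k) :=
      Primrec.nat_rec' hg (Primrec.const 1)
        (Primrec.nat_mul.comp (Primrec.snd.comp Primrec.snd) (hf.comp Primrec.fst)).to₂
    refine this.of_eq fun k => ?_
    induction g k with
    | zero => rfl
    | succ n ih => rw [pow_succ, ← ih]
  have hq : Primrec quota := Primrec.nat_mul.comp
    (Primrec.nat_mul.comp (Primrec.const 8) Primrec.id) (hpow (Primrec.const 4) Primrec.id)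
  exact Primrec.nat_mul.comp (Primrec.const m)
    (hpow (Primrec.nat_add.comp hq (Primrec.const 2)) (Primrec.const d))

end NestedSat

theorem lemma5 :
    ∃ (P : Prog) (f : ℕ → ℕ) (d A : ℕ), Computable f ∧
      ∀ (k : ℕ), 0 < k → ∀ (F : CNF), F.Proper →
      ∀ (C : Fin (gridSize k) × Fin (gridSize k) → Finset (IncVertex F)),
        IsMinorModel (gridGraph (gridSize k)) (inc F) C →
      ∀ (w : List ℕ), EncodesInput w k F (gridSize k) C →
      ∃ (t : ℕ) (s : MachineState),
        Runs P (initialState w) t s ∧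
        t ≤ f k * wordSize w ^ d ∧
        outputSet s ⊆ F.vars ∧
        (outputSet s).card ≤ 2 ^ (A * k ^ 10) ∧
        ∀ B : Finset ℕ, IsStrongNestedBackdoor F B → B.card ≤ k →
          ∃ x ∈ B, x ∈ outputSet s := by
  obtain ⟨P, A, d, hP⟩ := exists_prog algorithm .out .numOut
  refine ⟨P, fun k => A * (quota k + 2) ^ d, d, 7, (primrec_pow_const A d).to_comp, ?_⟩
  rintro k hk F hF C hC w ⟨cs, bag, hcs, hbag, hw⟩
  obtain ⟨h1, h2, h3⟩ := run_algorithm hk hw (H := fun j => (clauseOf cs j).vars)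
    (fun _ _ => mem_vars_clauseOf) (by
      have h : ((List.finRange (gridSize k)).product (List.finRange (gridSize k))).length = _ :=
        List.length_product _ _
      rw [List.length_map, h, List.length_finRange]) (hcs.bag_unique hbag hC) (hcs.gridModel hbag hC) rfl
  obtain ⟨t, s, hr, ht, ho⟩ := hP k w (wellShaped_of_eq hw) _ rfl h1
  refine ⟨t, s, hr, ht.trans ?_, ?_, ?_, ?_⟩
  · rw [mul_assoc, ← mul_pow]
    gcongr
    have hl := length_le_wordSize w
    have hpos : 1 ≤ wordSize w := le_trans (by rw [hw]; simp) hl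
    calc w.length + quota k + 1 ≤ wordSize w * 1 + quota k * 1 + 1 := by omega
      _ ≤ wordSize w * 1 + quota k * wordSize w + wordSize w := by gcongr
      _ = (quota k + 2) * wordSize w := by ring
  · rw [ho]
    intro x hx
    obtain ⟨j, hj⟩ := h2 x hx
    exact hcs.mem_vars hj
  · rw [ho]
    exact Finset.card_image_le.trans (by
      rw [Finset.card_range]; exact h1.trans (two_mul_quota_le k hk))
  · rw [ho]
    exact fun B hB hBk => h3 B (hcs.isBackdoorFor hF hB hBk)
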